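/- Let $0<k<1$ and let $\mathrm{sn},\mathrm{cn},\mathrm{dn}$ be the Jacobi elliptic functions, written $\mathrm{cn}(u;k)$ etc., with modulus $k$ when it is not shown. Put $K=K(k)=\int_0^{\pi/2}\frac{d\theta}{\sqrt{1-k^2\sin^2\theta}}$, $k'=\sqrt{1-k^2}$, $K'=K(k')$ and $q=\exp(-\pi K'/K)$. Let $N\ge 1$ be an integer and $w=K/N$. Define reflection parameters $$a_{2n}=\mathrm{cn}(w(2n+1)),\qquad a_{2n+1}=-\mathrm{dn}(w(2n+2)),\qquad n=0,1,\dots,N-1,$$ and monic polynomials $\Phi_0,\dots,\Phi_{2N}$ by $$\Phi_0(z)=1,\qquad \Phi_{n+1}(z)=z\Phi_n(z)-a_n z^n\Phi_n(1/z).$$ Then $a_{2N-1}=-1$, $\Phi_n$ is monic of degree $n$ for $0\le n\le 2N$, and $\Phi_{2N}(z)=z^{2N}+1$ has the simple zeros $$z_j=\exp\bigl(\pi i(j-\tfrac12)/N\bigr),\qquad j=-N+1,-N+2,\dots,N,$$ the vertices of a regular $2N$-gon. The polynomials $\Phi_0,\dots,\Phi_{2N-1}$ are orthogonal on these points: $$\sum_{j=-N+1}^{N}\rho_j\,\Phi_n(z_j)\,\Phi_m(1/z_j)=h_n\,\delta_{nm},\qquad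 n,m=0,1,\dots,2N-1,$$ where $h_n=\prod_{i=0}^{n-1}(1-a_i^2)>0$ and $$\rho_j=\frac{\pi}{kK}\,S(j;N),\qquad S(j;N)=\sum_{m=-\infty}^{\infty}\frac{1}{q^{\,j+2Nm-1/2}+q^{-j-2Nm+1/2}},$$ the series being convergent. With $(x;p)_\infty=\prod_{n\ge0}(1-xp^n)$ and $(x_1,\dots,x_r;p)_\infty=\prod_{i}(x_i;p)_\infty$, the sum $S(j;N)$ has, for $j=-N+1,\dots,N$, the product form $$S(j;N)=\frac{1}{q^{\,j-1/2}+q^{1/2-j}}\;\frac{(-q^{2N+2j-1},\,-q^{2N-2j+1},\,q^{4N},\,q^{4N};\,q^{4N})_\infty}{(-q^{4N+2j-1},\,-q^{4N-2j+1},\,q^{2N},\,q^{2N};\,q^{4N})_\infty}$$ and the $\mathrm{dn}$ form $$S(j;N)=\frac{\tilde K}{\pi}\,\mathrm{dn}\Bigl(\frac{j-1/2}{N}\,\tilde K';\,\tilde k'\Bigr),$$ where $\tilde k\in(0,1)$ is the unique modulus with $\exp(-\pi\tilde K'/\tilde K)=q^{2N}$, and $\tilde K=K(\tilde k)$, $\tilde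 k'=\sqrt{1-\tilde k^2}$, $\tilde K'=K(\tilde k')$. -/

import Mathlib

open Polynomial

namespace EllipticCircle

/-! ### Jacobi elliptic functions of a real argument, modulus `k` with `0 < k < 1` -/

/-- The incomplete elliptic integral of the first kind
`F(φ, k) = ∫_0^φ dθ / √(1 - k² sin² θ)`. -/
noncomputable def ellipticF (k φ : ℝ) : ℝ :=
  ∫ θ in (0 : ℝ)..φ, 1 / √(1 - k ^ 2 * Real.sin θ ^ 2)

/-- The complete elliptic integral of the first kind `K(k) = F(π/2, k)`. -/
noncomputable def ellipticK (k : ℝ) : ℝ := ellipticF k (Real.pi / 2)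

/-- The complementary modulus `k' = √(1 - k²)`. -/
noncomputable def coModulus (k : ℝ) : ℝ := √(1 - k ^ 2)

/-- The nome `q = exp (-π K' / K)`, where `K' = K(k')`. -/
noncomputable def nome (k : ℝ) : ℝ :=
  Real.exp (-Real.pi * ellipticK (coModulus k) / ellipticK k)

/-- The Jacobi amplitude `am(·; k)`: the inverse function of `F(·, k)`, which is a bijection of
the real line when `0 < k < 1` (see `ellipticF_bijective`). -/
noncomputable def jacobiAm (k : ℝ) : ℝ → ℝ := Function.invFun (ellipticF k)

/-- `sn(u; k) = sin (am(u; k))`. -/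
noncomputable def jacobiSn (k u : ℝ) : ℝ := Real.sin (jacobiAm k u)

/-- `cn(u; k) = cos (am(u; k))`. -/
noncomputable def jacobiCn (k u : ℝ) : ℝ := Real.cos (jacobiAm k u)

/-- `dn(u; k) = √(1 - k² sn²(u; k))`. -/
noncomputable def jacobiDn (k u : ℝ) : ℝ := √(1 - k ^ 2 * jacobiSn k u ^ 2)

lemma radicand_pos {k : ℝ} (hk0 : 0 < k) (hk1 : k < 1) (θ : ℝ) :
    0 < 1 - k ^ 2 * Real.sin θ ^ 2 := by
  have h1 := Real.sin_sq_le_one θ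
  have h2 : k ^ 2 < 1 := by nlinarith
  nlinarith [sq_nonneg (Real.sin θ), sq_nonneg k]

lemma one_le_integrand {k : ℝ} (hk0 : 0 < k) (hk1 : k < 1) (θ : ℝ) :
    1 ≤ 1 / √(1 - k ^ 2 * Real.sin θ ^ 2) := by
  have h := radicand_pos hk0 hk1 θ
  rw [le_div_iff₀ (Real.sqrt_pos.2 h), one_mul, Real.sqrt_le_iff]
  refine ⟨zero_le_one, ?_⟩
  nlinarith [mul_nonneg (sq_nonneg k) (sq_nonneg (Real.sin θ))]

lemma continuous_integrand {k : ℝ} (hk0 : 0 < k) (hk1 : k < 1) :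
    Continuous fun θ : ℝ => 1 / √(1 - k ^ 2 * Real.sin θ ^ 2) := by
  refine Continuous.div continuous_const (by fun_prop) fun θ => ?_
  exact (Real.sqrt_pos.2 (radicand_pos hk0 hk1 θ)).ne'

lemma ellipticF_sub_ge {k : ℝ} (hk0 : 0 < k) (hk1 : k < 1) {x y : ℝ} (hxy : x ≤ y) :
    y - x ≤ ellipticF k y - ellipticF k x := by
  have hc := continuous_integrand hk0 hk1
  unfold ellipticF
  rw [intervalIntegral.integral_interval_sub_left (hc.intervalIntegrable _ _)
    (hc.intervalIntegrable _ _)]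
  have h := intervalIntegral.integral_mono_on (μ := MeasureTheory.volume) hxy
    (intervalIntegrable_const (c := (1 : ℝ))) (hc.intervalIntegrable x y)
    (fun θ _ => one_le_integrand hk0 hk1 θ)
  simpa using h

/-- The amplitude is well defined: `F(·, k)` is a bijection of the real line. -/
theorem ellipticF_bijective {k : ℝ} (hk0 : 0 < k) (hk1 : k < 1) :
    Function.Bijective (ellipticF k) := by
  have hF0 : ellipticF k 0 = 0 := by simp [ellipticF]
  have hcont : Continuous (ellipticF k) :=
    intervalIntegral.continuous_primitive
      (fun a b => (continuous_integrand hk0 hk1).intervalIntegrable a b) 0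
  have hmono : StrictMono (ellipticF k) := by
    intro x y hxy
    have := ellipticF_sub_ge hk0 hk1 hxy.le
    linarith
  refine ⟨hmono.injective, hcont.surjective ?_ ?_⟩
  · refine Filter.tendsto_atTop_mono' _ ?_ Filter.tendsto_id
    filter_upwards [Filter.eventually_ge_atTop 0] with x hx
    have := ellipticF_sub_ge hk0 hk1 hx
    simp only [id]
    linarith
  · refine Filter.tendsto_atBot_mono' _ ?_ Filter.tendsto_id
    filter_upwards [Filter.eventually_le_atBot 0] with x hx
    have := ellipticF_sub_ge hk0 hk1 hx
    simp only [id]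
    linarith

/-! ### Polynomials on the unit circle with real reflection parameters -/

/-- The polynomials with `Φ_0 = 1` and `Φ_{n+1}(z) = z Φ_n(z) - a_n z^n Φ_n(1/z)`. Here
`reflect n Φ_n` is the polynomial `z^n Φ_n(1/z)`; see `eval_szegoPoly_succ`. -/
noncomputable def szegoPoly (a : ℕ → ℝ) : ℕ → ℂ[X]
  | 0 => 1
  | n + 1 => X * szegoPoly a n - C (a n : ℂ) * reflect n (szegoPoly a n)

lemma natDegree_szegoPoly_le (a : ℕ → ℝ) (n : ℕ) : (szegoPoly a n).natDegree ≤ n := by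
  induction n with
  | zero => simp [szegoPoly]
  | succ n ih =>
    rw [szegoPoly]
    refine (natDegree_sub_le _ _).trans (max_le ?_ ?_)
    · refine natDegree_mul_le.trans ?_
      have : (X : ℂ[X]).natDegree ≤ 1 := natDegree_X_le
      omega
    · refine natDegree_mul_le.trans ?_
      have h := (natDegree_reflect_le (p := szegoPoly a n) (N := n))
      rw [natDegree_C]
      omega

lemma eval_szegoPoly_succ (a : ℕ → ℝ) (n : ℕ) {z : ℂ} (hz : z ≠ 0) :
    (szegoPoly a (n + 1)).eval z
      = z * (szegoPoly a n).eval z - (a n : ℂ) * (z ^ n * (szegoPoly a n).eval (1 / z)) := by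
  have h : (reflect n (szegoPoly a n)).eval z = z ^ n * (szegoPoly a n).eval (1 / z) := by
    let _ : Invertible (1 / z) := invertibleOfNonzero (one_div_ne_zero hz)
    have h1 := eval₂_reflect_mul_pow (RingHom.id ℂ) (1 / z) n (szegoPoly a n)
      (natDegree_szegoPoly_le a n)
    have h2 : ⅟(1 / z) = z := by simp [invOf_eq_inv]
    rw [h2] at h1
    simp only [eval₂_id] at h1
    rw [← h1]
    have h3 : z ^ n * (1 / z) ^ n = 1 := by
      rw [← mul_pow, mul_one_div_cancel hz, one_pow]
    linear_combination -(reflect n (szegoPoly a n)).eval z * h3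
  rw [szegoPoly, eval_sub, eval_mul, eval_mul, eval_X, eval_C, h]

/-- The normalization constants `h_n = (1 - a_0²) (1 - a_1²) ⋯ (1 - a_{n-1}²)`. -/
noncomputable def szegoNorm (a : ℕ → ℝ) (n : ℕ) : ℝ :=
  ∏ i ∈ Finset.range n, (1 - a i ^ 2)

/-- The reflection parameters `a_{2n} = cn(w(2n+1))`, `a_{2n+1} = -dn(w(2n+2))`. -/
noncomputable def cnReflection (k w : ℝ) (n : ℕ) : ℝ :=
  if Even n then jacobiCn k (w * (n + 1)) else -jacobiDn k (w * (n + 1))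

/-! ### The nodes and the weights -/

/-- The nodes `z_j = exp(π i (j - 1/2) / N)`. -/
noncomputable def node (N : ℕ) (j : ℤ) : ℂ :=
  Complex.exp (Real.pi * Complex.I * ((j : ℂ) - 1 / 2) / N)

/-- The terms `1 / (q^{j+2Nm-1/2} + q^{-j-2Nm+1/2})`, with `m ∈ ℤ`, of the series `S(j; N)`. -/
noncomputable def weightTerm (q : ℝ) (N : ℕ) (j m : ℤ) : ℝ :=
  1 / (q ^ ((j : ℝ) + 2 * N * m - 1 / 2) + q ^ (-(j : ℝ) - 2 * N * m + 1 / 2))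

/-- The series `S(j; N) = ∑_{m ∈ ℤ} 1 / (q^{j+2Nm-1/2} + q^{-j-2Nm+1/2})`. -/
noncomputable def weightSum (q : ℝ) (N : ℕ) (j : ℤ) : ℝ :=
  ∑' m : ℤ, weightTerm q N j m

/-- The infinite `q`-shifted factorial `(x; q)_∞ = ∏_{n ≥ 0} (1 - x q^n)`; the product converges
for `|q| < 1` (see `multipliable_qFactorial`). -/
noncomputable def qFactorial (x q : ℝ) : ℝ := ∏' n : ℕ, (1 - x * q ^ n)

lemma multipliable_qFactorial (x : ℝ) {q : ℝ} (hq : |q| < 1) :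
    Multipliable fun n : ℕ => 1 - x * q ^ n := by
  have h : Summable fun n : ℕ => -(x * q ^ n) :=
    ((summable_geometric_of_abs_lt_one hq).mul_left x).neg
  simpa [sub_eq_add_neg] using Real.multipliable_one_add_of_summable h

end EllipticCircle

open EllipticCircle

/-!
The orthogonality is governed by the trigonometric moments of the weights. If the discrete measure
`∑ ρ_j δ_{z_j}` has the moments `∑ ρ_j z_j^n = cn(nw)`, then the addition formulas
`cn(u - v) = cn u cn v + sn u sn v dn(u - v)` and `dn(u - v) = dn u dn v + k² sn u sn v cn(u - v)`
show, by induction along the Szegő recurrence, that the pairing of `Φ_n` with `z^m` is a constant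
times `∏_{j < n} sn((m - j)w)` times a value of `cn` or `dn` (`exists_moment_eq_prod_sn`). It
vanishes for `0 ≤ m < n`, which is the orthogonality (`szegoPoly_orthogonal`). As `z^{2N} + 1` is
orthogonal to the same monomials, because `cn(2K - u) = -cn u`, and there are `2N` nodes with
positive weights, `Φ_{2N} = z^{2N} + 1` (`szegoPoly_two_mul`). The addition formulas, and the
uniqueness statements below, come from first integrals of the differential system of `cn, sn, dn`
(`IsJacobiSystem`), so that no complex theory of elliptic functions is needed.

The moments come from the Fourier series of `cn`. For `τ > 0` the series `cnSeries`, `snSeries` and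
`dnSeries` with coefficients `1 / (2 cosh (τ(m + 1/2)))`, `1 / (2 sinh (τ(m + 1/2)))` and
`1 / (2 cosh (τ m))` satisfy the differential system of the Jacobi functions in the strip
`|Im θ| < τ/2`, since the convolutions of their coefficients reduce to telescoping sums. On the real
axis they are therefore multiples of `cn, i sn, dn` for some modulus `nomeModulus τ`, and on the
imaginary axis their quotients are Jacobi functions of the complementary modulus. The first zero of
`cnSeries` on the real axis, and its blow-up at the end of the strip on the imaginary axis, give `K`
and `K'`, and hence `nome (nomeModulus τ) = e^{-τ}` (`nome_nomeModulus`). As the nome is strictly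
increasing in the modulus, every modulus is obtained in this way. Grouping the Fourier series of
`cn` at the points `πn/(2N)` by residues modulo `2N` gives the moments
(`sum_weightSum_mul_node_zpow`).

The zeros of `cnSeries`, the product form and the `dn` form of the weights rest on Kronecker's
formula `kroneckerSeries_mul` for `∑ y^m / (1 - x p^m)` as a quotient of theta series, together with
Jacobi's triple product `thetaSeries_eq_prod`: the series `S(j; N)`, `cnSeries` and `dnSeries` are
all of Kronecker's type, and `S(j; N)` is a multiple of the ratio of `dnSeries` to `cnSeries` at a
point of the imaginary axis, for the nome `q^{2N}`.
-/

open EllipticCircle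

namespace EllipticCircle

/-! ### The real Jacobi functions -/

section Jacobi

variable {k : ℝ}

lemma hasDerivAt_ellipticF (hk0 : 0 < k) (hk1 : k < 1) (φ : ℝ) :
    HasDerivAt (ellipticF k) (1 / √(1 - k ^ 2 * Real.sin φ ^ 2)) φ :=
  (continuous_integrand hk0 hk1).integral_hasStrictDerivAt 0 φ |>.hasDerivAt

lemma strictMono_ellipticF (hk0 : 0 < k) (hk1 : k < 1) : StrictMono (ellipticF k) := by
  intro x y hxy
  have := ellipticF_sub_ge hk0 hk1 hxy.le
  linarith

lemma ellipticF_jacobiAm (hk0 : 0 < k) (hk1 : k < 1) (u : ℝ) :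
    ellipticF k (jacobiAm k u) = u :=
  Function.rightInverse_invFun (ellipticF_bijective hk0 hk1).2 u

lemma jacobiAm_ellipticF (hk0 : 0 < k) (hk1 : k < 1) (φ : ℝ) :
    jacobiAm k (ellipticF k φ) = φ :=
  Function.leftInverse_invFun (ellipticF_bijective hk0 hk1).1 φ

lemma strictMono_jacobiAm (hk0 : 0 < k) (hk1 : k < 1) : StrictMono (jacobiAm k) := by
  intro u v huv
  rw [← (strictMono_ellipticF hk0 hk1).lt_iff_lt, ellipticF_jacobiAm hk0 hk1,
    ellipticF_jacobiAm hk0 hk1]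
  exact huv

lemma continuous_jacobiAm (hk0 : 0 < k) (hk1 : k < 1) : Continuous (jacobiAm k) :=
  (strictMono_jacobiAm hk0 hk1).monotone.continuous_of_surjective fun φ =>
    ⟨ellipticF k φ, jacobiAm_ellipticF hk0 hk1 φ⟩

lemma hasDerivAt_jacobiAm (hk0 : 0 < k) (hk1 : k < 1) (u : ℝ) :
    HasDerivAt (jacobiAm k) (jacobiDn k u) u := by
  have h := HasDerivAt.of_local_left_inverse (continuous_jacobiAm hk0 hk1).continuousAt
    (hasDerivAt_ellipticF hk0 hk1 (jacobiAm k u))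
    (one_div_ne_zero (Real.sqrt_pos.2 (radicand_pos hk0 hk1 _)).ne')
    (Filter.Eventually.of_forall (ellipticF_jacobiAm hk0 hk1))
  simpa [jacobiDn, jacobiSn] using h

lemma jacobiCn_sq_add_jacobiSn_sq (k u : ℝ) : jacobiCn k u ^ 2 + jacobiSn k u ^ 2 = 1 :=
  Real.cos_sq_add_sin_sq _

lemma jacobiDn_sq_add (hk0 : 0 < k) (hk1 : k < 1) (u : ℝ) :
    jacobiDn k u ^ 2 + k ^ 2 * jacobiSn k u ^ 2 = 1 := by
  have h : jacobiDn k u ^ 2 = 1 - k ^ 2 * jacobiSn k u ^ 2 :=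
    Real.sq_sqrt (radicand_pos hk0 hk1 _).le
  rw [h]
  ring

lemma jacobiDn_pos (hk0 : 0 < k) (hk1 : k < 1) (u : ℝ) : 0 < jacobiDn k u :=
  Real.sqrt_pos.2 (radicand_pos hk0 hk1 _)

lemma hasDerivAt_jacobiSn (hk0 : 0 < k) (hk1 : k < 1) (u : ℝ) :
    HasDerivAt (jacobiSn k) (jacobiCn k u * jacobiDn k u) u :=
  (hasDerivAt_jacobiAm hk0 hk1 u).sin

lemma hasDerivAt_jacobiCn (hk0 : 0 < k) (hk1 : k < 1) (u : ℝ) :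
    HasDerivAt (jacobiCn k) (-(jacobiSn k u * jacobiDn k u)) u := by
  exact (hasDerivAt_jacobiAm hk0 hk1 u).cos.congr_deriv (by rw [jacobiSn]; ring)

lemma hasDerivAt_jacobiDn (hk0 : 0 < k) (hk1 : k < 1) (u : ℝ) :
    HasDerivAt (jacobiDn k) (-(k ^ 2 * (jacobiCn k u * jacobiSn k u))) u := by
  have h := ((((hasDerivAt_jacobiSn hk0 hk1 u).pow 2).const_mul (k ^ 2)).const_sub 1).sqrt
    (radicand_pos hk0 hk1 _).ne'
  refine h.congr_deriv ?_
  have hd : √(1 - k ^ 2 * jacobiSn k u ^ 2) = jacobiDn k u := rfl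
  simp only [Pi.pow_apply, hd]
  have := (jacobiDn_pos hk0 hk1 u).ne'
  field_simp
  push_cast
  ring

lemma jacobiAm_zero (hk0 : 0 < k) (hk1 : k < 1) : jacobiAm k 0 = 0 := by
  have := jacobiAm_ellipticF hk0 hk1 0
  rwa [show ellipticF k 0 = 0 by simp [ellipticF]] at this

lemma jacobiAm_ellipticK (hk0 : 0 < k) (hk1 : k < 1) : jacobiAm k (ellipticK k) = Real.pi / 2 :=
  jacobiAm_ellipticF hk0 hk1 _

lemma jacobiSn_zero (hk0 : 0 < k) (hk1 : k < 1) : jacobiSn k 0 = 0 := by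
  simp [jacobiSn, jacobiAm_zero hk0 hk1]

lemma jacobiCn_zero (hk0 : 0 < k) (hk1 : k < 1) : jacobiCn k 0 = 1 := by
  simp [jacobiCn, jacobiAm_zero hk0 hk1]

lemma jacobiDn_zero (hk0 : 0 < k) (hk1 : k < 1) : jacobiDn k 0 = 1 := by
  simp [jacobiDn, jacobiSn_zero hk0 hk1]

lemma ellipticK_pos (hk0 : 0 < k) (hk1 : k < 1) : 0 < ellipticK k := by
  have h := ellipticF_sub_ge hk0 hk1 (x := 0) (y := Real.pi / 2) (by positivity)
  have h0 : ellipticF k 0 = 0 := by simp [ellipticF]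
  have := Real.pi_pos
  rw [ellipticK]
  linarith


lemma ellipticF_neg (k φ : ℝ) : ellipticF k (-φ) = -ellipticF k φ := by
  have h := intervalIntegral.integral_comp_neg (a := 0) (b := φ)
    (fun θ : ℝ => 1 / √(1 - k ^ 2 * Real.sin θ ^ 2))
  simp only [Real.sin_neg, neg_sq, neg_zero] at h
  rw [ellipticF, ellipticF, intervalIntegral.integral_symm, h]

lemma ellipticF_pi_sub (hk0 : 0 < k) (hk1 : k < 1) (φ : ℝ) :
    ellipticF k (Real.pi - φ) = 2 * ellipticK k - ellipticF k φ := by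
  have hc := continuous_integrand hk0 hk1
  have h := intervalIntegral.integral_comp_sub_left (a := φ) (b := Real.pi / 2)
    (fun θ : ℝ => 1 / √(1 - k ^ 2 * Real.sin θ ^ 2)) Real.pi
  simp only [Real.sin_pi_sub] at h
  have h1 := intervalIntegral.integral_interval_sub_left
    (hc.intervalIntegrable (μ := MeasureTheory.volume) 0 (Real.pi / 2)) (hc.intervalIntegrable 0 φ)
  have h2 := intervalIntegral.integral_interval_sub_left
    (hc.intervalIntegrable (μ := MeasureTheory.volume) 0 (Real.pi - φ))
    (hc.intervalIntegrable 0 (Real.pi / 2))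
  rw [show Real.pi - Real.pi / 2 = Real.pi / 2 by ring] at h
  simp only [ellipticK, ellipticF]
  linarith

lemma jacobiAm_neg (hk0 : 0 < k) (hk1 : k < 1) (u : ℝ) : jacobiAm k (-u) = -jacobiAm k u := by
  apply (strictMono_ellipticF hk0 hk1).injective
  rw [ellipticF_neg, ellipticF_jacobiAm hk0 hk1, ellipticF_jacobiAm hk0 hk1]

lemma jacobiAm_two_mul_ellipticK_sub (hk0 : 0 < k) (hk1 : k < 1) (u : ℝ) :
    jacobiAm k (2 * ellipticK k - u) = Real.pi - jacobiAm k u := by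
  apply (strictMono_ellipticF hk0 hk1).injective
  rw [ellipticF_pi_sub hk0 hk1, ellipticF_jacobiAm hk0 hk1, ellipticF_jacobiAm hk0 hk1]

lemma jacobiCn_neg (hk0 : 0 < k) (hk1 : k < 1) (u : ℝ) : jacobiCn k (-u) = jacobiCn k u := by
  simp [jacobiCn, jacobiAm_neg hk0 hk1]

lemma jacobiSn_neg (hk0 : 0 < k) (hk1 : k < 1) (u : ℝ) : jacobiSn k (-u) = -jacobiSn k u := by
  simp [jacobiSn, jacobiAm_neg hk0 hk1]

lemma jacobiDn_neg (hk0 : 0 < k) (hk1 : k < 1) (u : ℝ) : jacobiDn k (-u) = jacobiDn k u := by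
  simp [jacobiDn, jacobiSn_neg hk0 hk1]

lemma jacobiCn_two_mul_ellipticK_sub (hk0 : 0 < k) (hk1 : k < 1) (u : ℝ) :
    jacobiCn k (2 * ellipticK k - u) = -jacobiCn k u := by
  simp [jacobiCn, jacobiAm_two_mul_ellipticK_sub hk0 hk1]

lemma jacobiAm_mem_Ioo (hk0 : 0 < k) (hk1 : k < 1) {u : ℝ} (hu0 : 0 < u)
    (hu1 : u < 2 * ellipticK k) : jacobiAm k u ∈ Set.Ioo 0 Real.pi := by
  have h0 := strictMono_jacobiAm hk0 hk1 hu0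
  have h1 := strictMono_jacobiAm hk0 hk1 hu1
  have h2 := jacobiAm_two_mul_ellipticK_sub hk0 hk1 0
  rw [sub_zero] at h2
  rw [jacobiAm_zero hk0 hk1] at h0 h2
  rw [h2, sub_zero] at h1
  exact ⟨h0, h1⟩

lemma jacobiSn_pos (hk0 : 0 < k) (hk1 : k < 1) {u : ℝ} (hu0 : 0 < u)
    (hu1 : u < 2 * ellipticK k) : 0 < jacobiSn k u :=
  Real.sin_pos_of_mem_Ioo (jacobiAm_mem_Ioo hk0 hk1 hu0 hu1)

lemma jacobiCn_ellipticK (hk0 : 0 < k) (hk1 : k < 1) : jacobiCn k (ellipticK k) = 0 := by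
  simp [jacobiCn, jacobiAm_ellipticK hk0 hk1]

/-- `K` is the first positive zero of `cn`. -/
lemma eq_ellipticK_of_jacobiCn_eq_zero (hk0 : 0 < k) (hk1 : k < 1) {b : ℝ} (hb : 0 < b)
    (h0 : jacobiCn k b = 0) (hpos : ∀ u, 0 ≤ u → u < b → jacobiCn k u ≠ 0) :
    b = ellipticK k := by
  have hK := ellipticK_pos hk0 hk1
  rcases lt_trichotomy b (ellipticK k) with h | h | h
  · have h1 := strictMono_jacobiAm hk0 hk1 h
    have h2 := strictMono_jacobiAm hk0 hk1 hb
    rw [jacobiAm_ellipticK hk0 hk1] at h1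
    rw [jacobiAm_zero hk0 hk1] at h2
    exact absurd h0 (Real.cos_pos_of_mem_Ioo ⟨by linarith [Real.pi_pos], h1⟩).ne'
  · exact h
  · exact absurd (jacobiCn_ellipticK hk0 hk1) (hpos _ hK.le h)

end Jacobi

/-! ### The differential system of the Jacobi functions -/

/-- `(x, y, z)` solves on `I` the system satisfied by `cn (A t)`, `sn (A t)`, `dn (A t)` for the
parameter `m = k ^ 2`, together with the quadratic relations between these functions. -/
structure IsJacobiSystem (A m : ℝ) (I : Set ℝ) (x y z : ℝ → ℝ) : Prop where
  hasDerivAt_x : ∀ t ∈ I, HasDerivAt x (-(A * (y t * z t))) t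
  hasDerivAt_y : ∀ t ∈ I, HasDerivAt y (A * (x t * z t)) t
  hasDerivAt_z : ∀ t ∈ I, HasDerivAt z (-(A * m * (x t * y t))) t
  sq_x : ∀ t ∈ I, x t ^ 2 = 1 - y t ^ 2
  sq_z : ∀ t ∈ I, z t ^ 2 = 1 - m * y t ^ 2

namespace IsJacobiSystem

variable {A m : ℝ} {I : Set ℝ} {x y z X Y Z : ℝ → ℝ}

lemma denom_pos (hm0 : 0 ≤ m) (hm1 : m < 1) (h : IsJacobiSystem A m I x y z)
    (H : IsJacobiSystem A m I X Y Z) {t : ℝ} (ht : t ∈ I) :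
    0 < 1 - m * (y t * Y t) ^ 2 := by
  have h1 : y t ^ 2 ≤ 1 := by nlinarith [h.sq_x t ht, sq_nonneg (x t)]
  have h2 : Y t ^ 2 ≤ 1 := by nlinarith [H.sq_x t ht, sq_nonneg (X t)]
  have h3 : (y t * Y t) ^ 2 ≤ 1 := by
    rw [mul_pow]
    exact mul_le_one₀ h1 (sq_nonneg _) h2
  nlinarith

lemma eq_of_hasDerivAt_zero (hI : IsOpen I) (hI' : IsPreconnected I) {f : ℝ → ℝ}
    (hf : ∀ t ∈ I, HasDerivAt f 0 t) {s t : ℝ} (hs : s ∈ I) (ht : t ∈ I) : f s = f t :=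
  hI.is_const_of_deriv_eq_zero hI' (fun t ht => (hf t ht).differentiableAt.differentiableWithinAt)
    (fun t ht => (hf t ht).deriv) hs ht

/-- The addition formula for `cn`, as a first integral of two solutions of the same system. -/
lemma cn_quotient (hm0 : 0 ≤ m) (hm1 : m < 1) (hI : IsOpen I) (hI' : IsPreconnected I)
    (h : IsJacobiSystem A m I x y z) (H : IsJacobiSystem A m I X Y Z)
    {s t : ℝ} (hs : s ∈ I) (ht : t ∈ I) :
    (x s * X s + y s * Y s * (z s * Z s)) / (1 - m * (y s * Y s) ^ 2)
      = (x t * X t + y t * Y t * (z t * Z t)) / (1 - m * (y t * Y t) ^ 2) := by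
  refine eq_of_hasDerivAt_zero hI hI' (f := fun t =>
    (x t * X t + y t * Y t * (z t * Z t)) / (1 - m * (y t * Y t) ^ 2)) (fun t ht => ?_) hs ht
  have hD := (h.denom_pos hm0 hm1 H ht).ne'
  have h1 := (((h.hasDerivAt_x t ht).mul (H.hasDerivAt_x t ht)).add
    (((h.hasDerivAt_y t ht).mul (H.hasDerivAt_y t ht)).mul
      ((h.hasDerivAt_z t ht).mul (H.hasDerivAt_z t ht)))).div
    (((((h.hasDerivAt_y t ht).mul (H.hasDerivAt_y t ht)).pow 2).const_mul m).const_sub 1) hD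
  refine h1.congr_deriv ?_
  rw [div_eq_zero_iff]
  left
  have e1 := h.sq_x t ht
  have e2 := h.sq_z t ht
  have e3 := H.sq_x t ht
  have e4 := H.sq_z t ht
  simp only [Pi.mul_apply, Pi.pow_apply, Pi.add_apply]
  push_cast
  generalize x t = a at *
  generalize y t = b at *
  generalize z t = c at *
  generalize X t = a' at *
  generalize Y t = b' at *
  generalize Z t = c' at *
  clear h1 h H hD
  grind

/-- The addition formula for `dn`, as a first integral of two solutions of the same system. -/
lemma dn_quotient (hm0 : 0 ≤ m) (hm1 : m < 1) (hI : IsOpen I) (hI' : IsPreconnected I)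
    (h : IsJacobiSystem A m I x y z) (H : IsJacobiSystem A m I X Y Z)
    {s t : ℝ} (hs : s ∈ I) (ht : t ∈ I) :
    (z s * Z s + m * (y s * Y s * (x s * X s))) / (1 - m * (y s * Y s) ^ 2)
      = (z t * Z t + m * (y t * Y t * (x t * X t))) / (1 - m * (y t * Y t) ^ 2) := by
  refine eq_of_hasDerivAt_zero hI hI' (f := fun t =>
    (z t * Z t + m * (y t * Y t * (x t * X t))) / (1 - m * (y t * Y t) ^ 2))
    (fun t ht => ?_) hs ht
  have hD := (h.denom_pos hm0 hm1 H ht).ne'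
  have h1 := (((h.hasDerivAt_z t ht).mul (H.hasDerivAt_z t ht)).add
    ((((h.hasDerivAt_y t ht).mul (H.hasDerivAt_y t ht)).mul
      ((h.hasDerivAt_x t ht).mul (H.hasDerivAt_x t ht))).const_mul m)).div
    (((((h.hasDerivAt_y t ht).mul (H.hasDerivAt_y t ht)).pow 2).const_mul m).const_sub 1) hD
  refine h1.congr_deriv ?_
  rw [div_eq_zero_iff]
  left
  have e1 := h.sq_x t ht
  have e2 := h.sq_z t ht
  have e3 := H.sq_x t ht
  have e4 := H.sq_z t ht
  simp only [Pi.mul_apply, Pi.pow_apply, Pi.add_apply]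
  push_cast
  generalize x t = a at *
  generalize y t = b at *
  generalize z t = c at *
  generalize X t = a' at *
  generalize Y t = b' at *
  generalize Z t = c' at *
  clear h1 h H hD
  grind

/-- Solutions of the system with initial value `(1, 0, 1)` are unique: by the addition formulas the
formal difference of two solutions has constant `cn` and `dn` equal to `1`. -/
lemma unique (hm0 : 0 ≤ m) (hm1 : m < 1) (hI : IsOpen I) (hI' : IsPreconnected I)
    (h : IsJacobiSystem A m I x y z) (H : IsJacobiSystem A m I X Y Z) (h0 : (0 : ℝ) ∈ I)
    (hx : x 0 = 1) (hz : z 0 = 1) (hX : X 0 = 1) (hZ : Z 0 = 1) {t : ℝ} (ht : t ∈ I) :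
    x t = X t ∧ y t = Y t ∧ z t = Z t := by
  have hy : y 0 = 0 := by
    have := h.sq_x 0 h0
    rw [hx] at this
    nlinarith
  have hY : Y 0 = 0 := by
    have := H.sq_x 0 h0
    rw [hX] at this
    nlinarith
  have hc := h.cn_quotient hm0 hm1 hI hI' H ht h0
  have hd := h.dn_quotient hm0 hm1 hI hI' H ht h0
  have hD := h.denom_pos hm0 hm1 H ht
  simp only [hx, hX, hy, hY, hz, hZ] at hc hd
  rw [div_eq_iff hD.ne'] at hc hd
  norm_num at hc hd
  have e1 := h.sq_x t ht
  have e2 := h.sq_z t ht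
  have e3 := H.sq_x t ht
  have e4 := H.sq_z t ht
  clear h H h0 hx hz hX hZ hy hY hI hI' ht
  generalize x t = a at *
  generalize y t = b at *
  generalize z t = c at *
  generalize X t = a' at *
  generalize Y t = b' at *
  generalize Z t = c' at *
  -- The companion numerator, that of the addition formula for `sn`, vanishes.
  have hs : b * a' * c' - b' * a * c = 0 := by
    have h1 : (b * a' * c' - b' * a * c) ^ 2
        = (1 - m * (b * b') ^ 2) ^ 2 - (a * a' + b * b' * (c * c')) ^ 2 := by
      clear hc hd
      grind
    rw [hc, sub_self] at h1
    exact pow_eq_zero_iff (two_ne_zero) |>.1 h1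
  have hxX : a = a' := by
    apply mul_right_cancel₀ hD.ne'
    linear_combination (-a) * hc - b * c' * hs + a' * e1 + a' * b ^ 2 * e4
  have hzZ : c = c' := by
    apply mul_right_cancel₀ hD.ne'
    linear_combination (-c) * hd - m * b * a' * hs + c' * e2 + m * b ^ 2 * c' * e3
  subst hxX hzZ
  refine ⟨rfl, ?_, rfl⟩
  have hc0 : 0 < c ^ 2 := by nlinarith [sq_nonneg a, sq_nonneg b]
  have hb : (b - b') ^ 2 * c ^ 2 = 0 := by grind
  have hb' := (mul_eq_zero.1 hb).resolve_right hc0.ne'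
  exact sub_eq_zero.1 (pow_eq_zero_iff two_ne_zero |>.1 hb')

end IsJacobiSystem

lemma isJacobiSystem_jacobi {k : ℝ} (hk0 : 0 < k) (hk1 : k < 1) (A b : ℝ) :
    IsJacobiSystem A (k ^ 2) Set.univ (fun t => jacobiCn k (A * t - b))
      (fun t => jacobiSn k (A * t - b)) (fun t => jacobiDn k (A * t - b)) := by
  have hl (t : ℝ) : HasDerivAt (fun t : ℝ => A * t - b) A t := by
    simpa using ((hasDerivAt_id t).const_mul A).sub_const b
  refine ⟨fun t _ => ?_, fun t _ => ?_, fun t _ => ?_, fun t _ => ?_, fun t _ => ?_⟩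
  · exact ((hasDerivAt_jacobiCn hk0 hk1 _).comp t (hl t)).congr_deriv (by ring)
  · exact ((hasDerivAt_jacobiSn hk0 hk1 _).comp t (hl t)).congr_deriv (by ring)
  · exact ((hasDerivAt_jacobiDn hk0 hk1 _).comp t (hl t)).congr_deriv (by ring)
  · linarith [jacobiCn_sq_add_jacobiSn_sq k (A * t - b)]
  · linarith [jacobiDn_sq_add hk0 hk1 (A * t - b)]

section Addition

variable {k : ℝ}

lemma cn_dn_sub_mul (hk0 : 0 < k) (hk1 : k < 1) (u v : ℝ) :
    0 < 1 - k ^ 2 * (jacobiSn k u * jacobiSn k v) ^ 2 ∧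
    jacobiCn k (u - v) * (1 - k ^ 2 * (jacobiSn k u * jacobiSn k v) ^ 2)
      = jacobiCn k u * jacobiCn k v + jacobiSn k u * jacobiSn k v *
        (jacobiDn k u * jacobiDn k v) ∧
    jacobiDn k (u - v) * (1 - k ^ 2 * (jacobiSn k u * jacobiSn k v) ^ 2)
      = jacobiDn k u * jacobiDn k v + k ^ 2 * (jacobiSn k u * jacobiSn k v *
        (jacobiCn k u * jacobiCn k v)) := by
  have h := isJacobiSystem_jacobi hk0 hk1 1 0
  have H := isJacobiSystem_jacobi hk0 hk1 1 (u - v)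
  have hm1 : k ^ 2 < 1 := by nlinarith
  have hD := h.denom_pos (sq_nonneg k) hm1 H (Set.mem_univ u)
  have hc := h.cn_quotient (sq_nonneg k) hm1 isOpen_univ isPreconnected_univ H
    (Set.mem_univ u) (Set.mem_univ (u - v))
  have hd := h.dn_quotient (sq_nonneg k) hm1 isOpen_univ isPreconnected_univ H
    (Set.mem_univ u) (Set.mem_univ (u - v))
  simp only [one_mul, sub_zero, sub_self, sub_sub_cancel, jacobiCn_zero hk0 hk1,
    jacobiSn_zero hk0 hk1, jacobiDn_zero hk0 hk1] at hc hd hD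
  rw [div_eq_iff hD.ne'] at hc hd
  refine ⟨hD, ?_, ?_⟩
  · rw [hc]; ring
  · rw [hd]; ring

lemma jacobiCn_sub (hk0 : 0 < k) (hk1 : k < 1) (u v : ℝ) :
    jacobiCn k (u - v) = jacobiCn k u * jacobiCn k v
      + jacobiSn k u * jacobiSn k v * jacobiDn k (u - v) := by
  obtain ⟨hD, hc, hd⟩ := cn_dn_sub_mul hk0 hk1 u v
  apply mul_right_cancel₀ hD.ne'
  rw [add_mul, mul_assoc _ (jacobiDn k (u - v)), hc, hd]
  ring

lemma jacobiDn_sub (hk0 : 0 < k) (hk1 : k < 1) (u v : ℝ) :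
    jacobiDn k (u - v) = jacobiDn k u * jacobiDn k v
      + k ^ 2 * (jacobiSn k u * jacobiSn k v * jacobiCn k (u - v)) := by
  obtain ⟨hD, hc, hd⟩ := cn_dn_sub_mul hk0 hk1 u v
  apply mul_right_cancel₀ hD.ne'
  rw [add_mul, mul_assoc (k ^ 2), mul_assoc _ (jacobiCn k (u - v)), hc, hd]
  ring

end Addition

/-! ### Moments of the polynomials on the circle -/

section Moments

variable {ι : Type*} (s : Finset ι) (z : ι → ℂ) (ρ : ι → ℝ)

/-- The pairing `∑ ρ_j p(z_j) z_j^{-m}` of a polynomial with a Laurent monomial, for the discrete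
measure with masses `ρ_j` at the points `z_j`. -/
noncomputable def moment (p : ℂ[X]) (m : ℤ) : ℂ :=
  ∑ j ∈ s, (ρ j : ℂ) * p.eval (z j) * z j ^ (-m)

variable {s z ρ}

lemma sum_mul_eval_inv (f : ι → ℂ) (hz : ∀ j ∈ s, z j ≠ 0) (p : ℂ[X]) {n : ℕ}
    (hn : p.natDegree ≤ n) (m : ℤ) :
    ∑ j ∈ s, f j * p.eval (1 / z j) * z j ^ m
      = ∑ i ∈ Finset.range (n + 1), p.coeff i * ∑ j ∈ s, f j * z j ^ (m - i) := by
  simp_rw [Finset.mul_sum]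
  rw [Finset.sum_comm]
  refine Finset.sum_congr rfl fun j hj => ?_
  rw [eval_eq_sum_range' (Nat.lt_succ_of_le hn), Finset.mul_sum, Finset.sum_mul]
  refine Finset.sum_congr rfl fun i _ => ?_
  rw [zpow_sub₀ (hz j hj), zpow_natCast, one_div, inv_pow]
  have := hz j hj
  field_simp

lemma moment_eq_sum (hz : ∀ j ∈ s, z j ≠ 0) (p : ℂ[X]) {n : ℕ}
    (hn : p.natDegree ≤ n) (m : ℤ) :
    moment s z ρ p m
      = ∑ i ∈ Finset.range (n + 1), p.coeff i * ∑ j ∈ s, (ρ j : ℂ) * z j ^ ((i : ℤ) - m) := by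
  simp_rw [moment, Finset.mul_sum]
  rw [Finset.sum_comm]
  refine Finset.sum_congr rfl fun j hj => ?_
  rw [eval_eq_sum_range' (Nat.lt_succ_of_le hn), Finset.mul_sum, Finset.sum_mul]
  refine Finset.sum_congr rfl fun i _ => ?_
  rw [zpow_sub₀ (hz j hj), zpow_natCast, zpow_neg]
  have := hz j hj
  field_simp

variable {c : ℤ → ℝ}

/-- The moments being even, `z_j` may be replaced by `1 / z_j`. -/
lemma sum_eval_inv_eq_moment (hz : ∀ j ∈ s, z j ≠ 0)
    (hc : ∀ n : ℤ, ∑ j ∈ s, (ρ j : ℂ) * z j ^ n = c n) (hce : ∀ n, c (-n) = c n)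
    (p : ℂ[X]) (m : ℤ) :
    ∑ j ∈ s, (ρ j : ℂ) * p.eval (1 / z j) * z j ^ m = moment s z ρ p m := by
  rw [sum_mul_eval_inv _ hz p le_rfl, moment_eq_sum hz p le_rfl]
  refine Finset.sum_congr rfl fun i _ => ?_
  rw [hc, hc, ← hce, neg_sub]

/-- The Szegő recurrence in terms of moments. -/
lemma moment_szegoPoly_succ (hz : ∀ j ∈ s, z j ≠ 0)
    (hc : ∀ n : ℤ, ∑ j ∈ s, (ρ j : ℂ) * z j ^ n = c n) (hce : ∀ n, c (-n) = c n)
    (a : ℕ → ℝ) (n : ℕ) (m : ℤ) :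
    moment s z ρ (szegoPoly a (n + 1)) m = moment s z ρ (szegoPoly a n) (m - 1)
      - a n * moment s z ρ (szegoPoly a n) (n - m) := by
  rw [← sum_eval_inv_eq_moment hz hc hce _ (n - m), moment, moment, Finset.mul_sum,
    ← Finset.sum_sub_distrib]
  refine Finset.sum_congr rfl fun j hj => ?_
  have h0 := hz j hj
  rw [eval_szegoPoly_succ a n h0, zpow_sub₀ h0, zpow_natCast, zpow_neg, neg_sub, zpow_sub₀ h0,
    zpow_one]
  field_simp

lemma moment_szegoPoly_zero (hc : ∀ n : ℤ, ∑ j ∈ s, (ρ j : ℂ) * z j ^ n = c n)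
    (hce : ∀ n, c (-n) = c n) (a : ℕ → ℝ) (m : ℤ) :
    moment s z ρ (szegoPoly a 0) m = c m := by
  simp only [moment, szegoPoly, eval_one, mul_one, hc, hce]

/-- If all `Φ_n` with `n ≥ 1` are orthogonal to `1`, the recurrence at `m = 0` yields the pairing of
`Φ_n` with `z^n`. -/
lemma moment_self_of_orthogonal (hz : ∀ j ∈ s, z j ≠ 0)
    (hc : ∀ n : ℤ, ∑ j ∈ s, (ρ j : ℂ) * z j ^ n = c n) (hce : ∀ n, c (-n) = c n)
    (hc0 : c 0 = 1) (a : ℕ → ℝ) (h0 : ∀ n, moment s z ρ (szegoPoly a (n + 1)) 0 = 0) (n : ℕ) :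
    moment s z ρ (szegoPoly a n) n = szegoNorm a n := by
  induction n with
  | zero => simp [moment_szegoPoly_zero hc hce, hc0, szegoNorm]
  | succ n ih =>
    have h1 := h0 n
    rw [moment_szegoPoly_succ hz hc hce] at h1 ⊢
    rw [szegoNorm, Finset.prod_range_succ, ← szegoNorm]
    push_cast
    rw [show (n : ℤ) + 1 - 1 = n by ring, show (n : ℤ) - (n + 1) = 0 - 1 by ring, ih]
    rw [show (n : ℤ) - 0 = n by ring, ih] at h1
    linear_combination -(a n : ℂ) * h1

end Moments

lemma szegoPoly_monic_and_natDegree (a : ℕ → ℝ) (n : ℕ) :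
    (szegoPoly a n).Monic ∧ (szegoPoly a n).natDegree = n := by
  have hcoeff : (szegoPoly a n).coeff n = 1 := by
    induction n with
    | zero => simp [szegoPoly]
    | succ n ih =>
      have h : (reflect n (szegoPoly a n)).coeff (n + 1) = 0 := by
        refine coeff_eq_zero_of_natDegree_lt (lt_of_le_of_lt natDegree_reflect_le ?_)
        have := natDegree_szegoPoly_le a n
        omega
      rw [szegoPoly, coeff_sub, coeff_X_mul, coeff_C_mul, h, ih]
      simp
  exact ⟨monic_of_natDegree_le_of_coeff_eq_one n (natDegree_szegoPoly_le a n) hcoeff,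
    natDegree_eq_of_le_of_coeff_ne_zero (natDegree_szegoPoly_le a n) (by simp [hcoeff])⟩

section Explicit

variable {ι : Type*} {s : Finset ι} {z : ι → ℂ} {ρ : ι → ℝ} {k : ℝ}

lemma prod_sn_neg (hk0 : 0 < k) (hk1 : k < 1) (w : ℝ) (n : ℕ) (m : ℤ) :
    ∏ j ∈ Finset.range n, jacobiSn k (((((n : ℤ) - m : ℤ) : ℝ) - j) * w)
      = (-1) ^ n * ∏ j ∈ Finset.range n, jacobiSn k ((((m - 1 : ℤ) : ℝ) - j) * w) := by
  rw [← Finset.prod_range_reflect]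
  have hpow : (-1 : ℝ) ^ n = ∏ j ∈ Finset.range n, (-1 : ℝ) := by simp
  rw [hpow, ← Finset.prod_mul_distrib]
  refine Finset.prod_congr rfl fun j hj => ?_
  have hj' := Finset.mem_range.1 hj
  rw [neg_one_mul, ← jacobiSn_neg hk0 hk1]
  congr 1
  rw [Nat.sub_sub, Nat.cast_sub (by omega)]
  push_cast
  ring

lemma prod_sn_succ (w : ℝ) (n : ℕ) (m : ℤ) :
    ∏ j ∈ Finset.range (n + 1), jacobiSn k (((m : ℝ) - j) * w)
      = (∏ j ∈ Finset.range n, jacobiSn k ((((m - 1 : ℤ) : ℝ) - j) * w)) *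
        jacobiSn k (m * w) := by
  rw [Finset.prod_range_succ']
  congr 1
  · refine Finset.prod_congr rfl fun j _ => ?_
    push_cast
    congr 1
    ring
  · simp

/-- The moments of `Φ_{2n}` and `Φ_{2n+1}` in closed form: up to constants they are
`sn(mw) sn((m-1)w) ⋯ sn((m-2n+1)w) cn((m-2n)w)` and
`sn(mw) sn((m-1)w) ⋯ sn((m-2n)w) dn((m-2n-1)w)`. -/
lemma exists_moment_eq_prod_sn (hk0 : 0 < k) (hk1 : k < 1) (w : ℝ) (hz : ∀ j ∈ s, z j ≠ 0)
    (hc : ∀ n : ℤ, ∑ j ∈ s, (ρ j : ℂ) * z j ^ n = (jacobiCn k (n * w) : ℝ)) (n : ℕ) :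
    (∃ C : ℝ, ∀ m : ℤ, moment s z ρ (szegoPoly (cnReflection k w) (2 * n)) m
      = ((C * (∏ j ∈ Finset.range (2 * n), jacobiSn k (((m : ℝ) - j) * w)) *
          jacobiCn k (((m : ℝ) - (2 * n : ℕ)) * w) : ℝ) : ℂ)) ∧
    (∃ C : ℝ, ∀ m : ℤ, moment s z ρ (szegoPoly (cnReflection k w) (2 * n + 1)) m
      = ((C * (∏ j ∈ Finset.range (2 * n + 1), jacobiSn k (((m : ℝ) - j) * w)) *
          jacobiDn k (((m : ℝ) - (2 * n + 1 : ℕ)) * w) : ℝ) : ℂ)) := by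
  have hce : ∀ n : ℤ, jacobiCn k ((-n : ℤ) * w) = jacobiCn k (n * w) := by
    intro n
    rw [Int.cast_neg, neg_mul, jacobiCn_neg hk0 hk1]
  have step1 (n : ℕ) (h : ∃ C : ℝ, ∀ m : ℤ,
      moment s z ρ (szegoPoly (cnReflection k w) (2 * n)) m
      = ((C * (∏ j ∈ Finset.range (2 * n), jacobiSn k (((m : ℝ) - j) * w)) *
          jacobiCn k (((m : ℝ) - (2 * n : ℕ)) * w) : ℝ) : ℂ)) :
      ∃ C : ℝ, ∀ m : ℤ, moment s z ρ (szegoPoly (cnReflection k w) (2 * n + 1)) m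
      = ((C * (∏ j ∈ Finset.range (2 * n + 1), jacobiSn k (((m : ℝ) - j) * w)) *
          jacobiDn k (((m : ℝ) - (2 * n + 1 : ℕ)) * w) : ℝ) : ℂ) := by
    obtain ⟨C, hC⟩ := h
    refine ⟨C * jacobiSn k ((2 * n + 1 : ℕ) * w), fun m => ?_⟩
    rw [moment_szegoPoly_succ hz hc hce, hC, hC, prod_sn_neg hk0 hk1, prod_sn_succ, cnReflection,
      if_pos (even_two_mul n)]
    rw [← Complex.ofReal_mul, ← Complex.ofReal_sub, Complex.ofReal_inj]
    have h1 := jacobiCn_sub hk0 hk1 (m * w) ((2 * n + 1 : ℕ) * w)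
    rw [← sub_mul] at h1
    have e1 : (((m - 1 : ℤ) : ℝ) - (2 * n : ℕ)) * w = ((m : ℝ) - (2 * n + 1 : ℕ)) * w := by
      push_cast; ring
    have e2 : ((((2 * n : ℕ) - m : ℤ) : ℝ) - (2 * n : ℕ)) * w = -(m * w) := by
      push_cast; ring
    have e3 : w * (((2 * n : ℕ) : ℝ) + 1) = (2 * n + 1 : ℕ) * w := by push_cast; ring
    rw [e1, e2, e3, jacobiCn_neg hk0 hk1, h1, (even_two_mul n).neg_one_pow]
    ring
  have step2 (n : ℕ) (h : ∃ C : ℝ, ∀ m : ℤ,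
      moment s z ρ (szegoPoly (cnReflection k w) (2 * n + 1)) m
      = ((C * (∏ j ∈ Finset.range (2 * n + 1), jacobiSn k (((m : ℝ) - j) * w)) *
          jacobiDn k (((m : ℝ) - (2 * n + 1 : ℕ)) * w) : ℝ) : ℂ)) :
      ∃ C : ℝ, ∀ m : ℤ, moment s z ρ (szegoPoly (cnReflection k w) (2 * (n + 1))) m
      = ((C * (∏ j ∈ Finset.range (2 * (n + 1)), jacobiSn k (((m : ℝ) - j) * w)) *
          jacobiCn k (((m : ℝ) - (2 * (n + 1) : ℕ)) * w) : ℝ) : ℂ) := by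
    obtain ⟨C, hC⟩ := h
    refine ⟨C * (k ^ 2 * jacobiSn k ((2 * n + 1 + 1 : ℕ) * w)), fun m => ?_⟩
    rw [show 2 * (n + 1) = 2 * n + 1 + 1 by ring]
    rw [moment_szegoPoly_succ hz hc hce, hC, hC, prod_sn_neg hk0 hk1,
      prod_sn_succ w (2 * n + 1) m, cnReflection,
      if_neg (Nat.not_even_iff_odd.2 (odd_two_mul_add_one n))]
    rw [← Complex.ofReal_mul, ← Complex.ofReal_sub, Complex.ofReal_inj]
    have h1 := jacobiDn_sub hk0 hk1 (m * w) ((2 * n + 1 + 1 : ℕ) * w)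
    rw [← sub_mul] at h1
    have e1 : (((m - 1 : ℤ) : ℝ) - (2 * n + 1 : ℕ)) * w = ((m : ℝ) - (2 * n + 1 + 1 : ℕ)) * w := by
      push_cast; ring
    have e2 : ((((2 * n + 1 : ℕ) - m : ℤ) : ℝ) - (2 * n + 1 : ℕ)) * w = -(m * w) := by
      push_cast; ring
    have e3 : w * (((2 * n + 1 : ℕ) : ℝ) + 1) = (2 * n + 1 + 1 : ℕ) * w := by push_cast; ring
    rw [e1, e2, e3, jacobiDn_neg hk0 hk1, h1, (odd_two_mul_add_one n).neg_one_pow]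
    ring
  have hmain : ∃ C : ℝ, ∀ m : ℤ, moment s z ρ (szegoPoly (cnReflection k w) (2 * n)) m
      = ((C * (∏ j ∈ Finset.range (2 * n), jacobiSn k (((m : ℝ) - j) * w)) *
          jacobiCn k (((m : ℝ) - (2 * n : ℕ)) * w) : ℝ) : ℂ) := by
    induction n with
    | zero =>
      refine ⟨1, fun m => ?_⟩
      rw [mul_zero, moment_szegoPoly_zero hc hce]
      simp
    | succ n ih => exact step2 n (step1 n ih)
  exact ⟨hmain, step1 n hmain⟩

/-- For `0 ≤ m < n` the factor `sn((m - j)w)` with `j = m` vanishes. -/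
lemma moment_szegoPoly_eq_zero (hk0 : 0 < k) (hk1 : k < 1) (w : ℝ) (hz : ∀ j ∈ s, z j ≠ 0)
    (hc : ∀ n : ℤ, ∑ j ∈ s, (ρ j : ℂ) * z j ^ n = (jacobiCn k (n * w) : ℝ)) {n m : ℕ}
    (hmn : m < n) : moment s z ρ (szegoPoly (cnReflection k w) n) m = 0 := by
  have hprod : ∏ j ∈ Finset.range n, jacobiSn k ((((m : ℤ) : ℝ) - j) * w) = 0 := by
    refine Finset.prod_eq_zero (Finset.mem_range.2 hmn) ?_
    simp [jacobiSn_zero hk0 hk1]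
  obtain ⟨i, rfl | rfl⟩ := Nat.even_or_odd' n
  · obtain ⟨C, hC⟩ := (exists_moment_eq_prod_sn hk0 hk1 w hz hc i).1
    rw [hC, hprod]
    simp
  · obtain ⟨C, hC⟩ := (exists_moment_eq_prod_sn hk0 hk1 w hz hc i).2
    rw [hC, hprod]
    simp

/-- The orthogonality needs only that the trigonometric moments are the values `cn(nw)`. -/
lemma szegoPoly_orthogonal (hk0 : 0 < k) (hk1 : k < 1) (w : ℝ) (hz : ∀ j ∈ s, z j ≠ 0)
    (hc : ∀ n : ℤ, ∑ j ∈ s, (ρ j : ℂ) * z j ^ n = (jacobiCn k (n * w) : ℝ)) (n m : ℕ) :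
    ∑ j ∈ s, (ρ j : ℂ) * (szegoPoly (cnReflection k w) n).eval (z j) *
        (szegoPoly (cnReflection k w) m).eval (1 / z j)
      = if n = m then (szegoNorm (cnReflection k w) n : ℂ) else 0 := by
  set a := cnReflection k w
  have hce : ∀ n : ℤ, jacobiCn k ((-n : ℤ) * w) = jacobiCn k (n * w) := by
    intro n
    rw [Int.cast_neg, neg_mul, jacobiCn_neg hk0 hk1]
  rcases le_or_gt m n with hmn | hmn
  · have h := sum_mul_eval_inv (fun j => (ρ j : ℂ) * (szegoPoly a n).eval (z j)) hz
      (szegoPoly a m) (natDegree_szegoPoly_le a m) 0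
    simp only [zpow_zero, mul_one, zero_sub] at h
    rw [h, Finset.sum_range_succ, Finset.sum_eq_zero, zero_add]
    · have h1 : (szegoPoly a m).coeff m = 1 := by
        have := szegoPoly_monic_and_natDegree a m
        have h2 := this.1.coeff_natDegree
        rwa [this.2] at h2
      rw [h1, one_mul, ← moment]
      split_ifs with hnm
      · subst hnm
        refine moment_self_of_orthogonal hz hc hce ?_ a (fun i => ?_) n
        · simp [jacobiCn_zero hk0 hk1]
        · exact_mod_cast moment_szegoPoly_eq_zero hk0 hk1 w hz hc (Nat.succ_pos i)
      · exact moment_szegoPoly_eq_zero hk0 hk1 w hz hc (by omega)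
    · intro i hi
      rw [← moment, moment_szegoPoly_eq_zero hk0 hk1 w hz hc, mul_zero]
      have := Finset.mem_range.1 hi
      omega
  · rw [if_neg hmn.ne]
    have h (j : ι) : (ρ j : ℂ) * (szegoPoly a n).eval (z j) * (szegoPoly a m).eval (1 / z j)
        = ∑ i ∈ Finset.range (n + 1), (szegoPoly a n).coeff i *
          ((ρ j : ℂ) * (szegoPoly a m).eval (1 / z j) * z j ^ (i : ℤ)) := by
      rw [eval_eq_sum_range' (Nat.lt_succ_of_le (natDegree_szegoPoly_le a n)) (z j),
        Finset.mul_sum, Finset.sum_mul]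
      refine Finset.sum_congr rfl fun i _ => ?_
      rw [zpow_natCast]
      ring
    simp_rw [h]
    rw [Finset.sum_comm]
    refine Finset.sum_eq_zero fun i hi => ?_
    rw [← Finset.mul_sum, sum_eval_inv_eq_moment hz hc hce,
      moment_szegoPoly_eq_zero hk0 hk1 w hz hc, mul_zero]
    have := Finset.mem_range.1 hi
    omega

/-- A polynomial of degree below the number of points of the unit circle carrying positive masses
vanishes if it is orthogonal to the monomials. -/
lemma eq_zero_of_moment_eq_zero (hz : ∀ j ∈ s, ‖z j‖ = 1) (hinj : Set.InjOn z s)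
    (hρ : ∀ j ∈ s, 0 < ρ j) {p : ℂ[X]} (hdeg : p.natDegree < s.card)
    (h : ∀ m : ℕ, m < s.card → moment s z ρ p m = 0) : p = 0 := by
  classical
  have hz0 : ∀ j ∈ s, z j ≠ 0 := fun j hj h0 => by simpa [h0] using hz j hj
  have hconj : ∀ j ∈ s, (starRingEnd ℂ) (p.eval (z j))
      = (p.map (starRingEnd ℂ)).eval (1 / z j) := by
    intro j hj
    rw [one_div, Complex.inv_eq_conj (hz j hj), eval_map, eval₂_hom]
  have hsum : ∑ j ∈ s, ρ j * Complex.normSq (p.eval (z j)) = 0 := by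
    have h1 : ∑ j ∈ s, (ρ j : ℂ) * p.eval (z j) *
        (p.map (starRingEnd ℂ)).eval (1 / z j) * z j ^ (0 : ℤ) = 0 := by
      rw [sum_mul_eval_inv _ hz0 _ (natDegree_map_le) 0]
      refine Finset.sum_eq_zero fun i hi => ?_
      have h2 := h i (by have := Finset.mem_range.1 hi; omega)
      rw [moment] at h2
      rw [zero_sub, h2, mul_zero]
    have h3 : ((∑ j ∈ s, ρ j * Complex.normSq (p.eval (z j)) : ℝ) : ℂ) = 0 := by
      rw [← h1]
      push_cast
      refine Finset.sum_congr rfl fun j hj => ?_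
      rw [← hconj j hj, zpow_zero, mul_one, mul_assoc, Complex.mul_conj]
    exact_mod_cast h3
  have hroot : ∀ j ∈ s, p.eval (z j) = 0 := by
    intro j hj
    have h1 := (Finset.sum_eq_zero_iff_of_nonneg (fun i hi =>
      mul_nonneg (hρ i hi).le (Complex.normSq_nonneg _))).1 hsum j hj
    exact Complex.normSq_eq_zero.1 ((mul_eq_zero.1 h1).resolve_left (hρ j hj).ne')
  refine eq_zero_of_natDegree_lt_card_of_eval_eq_zero' p (s.image z) ?_ ?_
  · intro x hx
    obtain ⟨j, hj, rfl⟩ := Finset.mem_image.1 hx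
    exact hroot j hj
  · rwa [Finset.card_image_of_injOn hinj]

end Explicit

/-! ### The nodes -/

section Nodes

variable {N : ℕ}

lemma node_eq_exp (N : ℕ) (j : ℤ) :
    node N j = Complex.exp ((Real.pi * ((j : ℝ) - 1 / 2) / N : ℝ) * Complex.I) := by
  rw [node]
  congr 1
  push_cast
  ring

lemma norm_node (N : ℕ) (j : ℤ) : ‖node N j‖ = 1 := by
  rw [node_eq_exp, Complex.norm_exp_ofReal_mul_I]

lemma node_injOn (hN : 1 ≤ N) :
    Set.InjOn (node N) (Finset.Icc (-(N : ℤ) + 1) N : Finset ℤ) := by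
  intro i hi j hj hij
  simp only [Finset.coe_Icc, Set.mem_Icc] at hi hj
  rw [node, node, Complex.exp_eq_exp_iff_exists_int] at hij
  obtain ⟨n, hn⟩ := hij
  have hN0 : (N : ℂ) ≠ 0 := by exact_mod_cast (by omega : N ≠ 0)
  have h : (i : ℂ) - j = 2 * N * n := by
    field_simp at hn
    linear_combination hn / 2
  have h' : i - j = 2 * N * n := by exact_mod_cast h
  have hn0 : n = 0 := by
    have h1 : n < 1 := by nlinarith
    have h2 : -1 < n := by nlinarith
    omega
  rw [hn0] at h'
  omega

lemma node_pow_two_mul (hN : 1 ≤ N) (j : ℤ) : node N j ^ (2 * N) = -1 := by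
  have hN0 : (N : ℂ) ≠ 0 := by exact_mod_cast (by omega : N ≠ 0)
  rw [node, ← Complex.exp_nat_mul, ← Complex.exp_pi_mul_I, Complex.exp_eq_exp_iff_exists_int]
  refine ⟨j - 1, ?_⟩
  push_cast
  field_simp
  ring

lemma card_Icc_nodes (N : ℕ) : (Finset.Icc (-(N : ℤ) + 1) N).card = 2 * N := by
  rw [Int.card_Icc]
  omega

lemma roots_X_pow_add_one (hN : 1 ≤ N) :
    (X ^ (2 * N) + 1 : ℂ[X]).roots = (Finset.Icc (-(N : ℤ) + 1) N).val.map (node N) ∧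
    (X ^ (2 * N) + 1 : ℂ[X]).roots.Nodup := by
  have hnodup : ((Finset.Icc (-(N : ℤ) + 1) N).val.map (node N)).Nodup :=
    Finset.nodup_map_iff_injOn.2 (node_injOn hN)
  have hne : (X ^ (2 * N) + 1 : ℂ[X]) ≠ 0 :=
    (monic_X_pow_add_C 1 (by omega : 2 * N ≠ 0)).ne_zero
  have hdeg : (X ^ (2 * N) + 1 : ℂ[X]).natDegree = 2 * N := by
    simpa using natDegree_X_pow_add_C (n := 2 * N) (r := (1 : ℂ))
  have heq : (Finset.Icc (-(N : ℤ) + 1) N).val.map (node N) = (X ^ (2 * N) + 1 : ℂ[X]).roots := by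
    refine Multiset.eq_of_le_of_card_le ((Multiset.le_iff_subset hnodup).2 ?_) ?_
    · intro x hx
      obtain ⟨j, -, rfl⟩ := Multiset.mem_map.1 hx
      rw [mem_roots hne, IsRoot.def]
      simp [node_pow_two_mul hN]
    · refine (card_roots' _).trans ?_
      rw [hdeg, Multiset.card_map, Finset.card_val, card_Icc_nodes]
  exact ⟨heq.symm, heq ▸ hnodup⟩

end Nodes

section Szego

variable {k : ℝ} {N : ℕ}

/-- Both sides are monic of degree `2N` and orthogonal to `1, z, …, z^{2N-1}`, so their difference
vanishes. For the right-hand side this is the relation `cn(2K - u) = -cn u`. -/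
lemma szegoPoly_two_mul (hk0 : 0 < k) (hk1 : k < 1) (hN : 1 ≤ N) {ρ : ℤ → ℝ}
    (hρ : ∀ j ∈ Finset.Icc (-(N : ℤ) + 1) N, 0 < ρ j)
    (hc : ∀ n : ℤ, ∑ j ∈ Finset.Icc (-(N : ℤ) + 1) N, (ρ j : ℂ) * node N j ^ n
      = (jacobiCn k (n * (ellipticK k / N)) : ℝ)) :
    szegoPoly (cnReflection k (ellipticK k / N)) (2 * N) = X ^ (2 * N) + 1 := by
  set a := cnReflection k (ellipticK k / N)
  have hN0 : (N : ℝ) ≠ 0 := by exact_mod_cast (by omega : N ≠ 0)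
  have hz0 : ∀ j ∈ Finset.Icc (-(N : ℤ) + 1) N, node N j ≠ 0 := fun j _ => Complex.exp_ne_zero _
  have hmonic := szegoPoly_monic_and_natDegree a (2 * N)
  rw [← sub_eq_zero]
  refine eq_zero_of_moment_eq_zero (fun j _ => norm_node N j) (node_injOn hN) hρ ?_ ?_
  · rw [card_Icc_nodes]
    have hq : (X ^ (2 * N) + 1 : ℂ[X]).Monic := monic_X_pow_add_C 1 (by omega)
    have hqd : (X ^ (2 * N) + 1 : ℂ[X]).natDegree = 2 * N := by
      simpa using natDegree_X_pow_add_C (n := 2 * N) (r := (1 : ℂ))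
    have hlt := degree_sub_lt_left (p := szegoPoly a (2 * N)) (q := X ^ (2 * N) + 1)
      (by rw [degree_eq_natDegree hmonic.1.ne_zero, degree_eq_natDegree hq.ne_zero, hmonic.2, hqd])
      hmonic.1.ne_zero (by rw [hmonic.1.leadingCoeff, hq.leadingCoeff])
    by_cases h0 : szegoPoly a (2 * N) - (X ^ (2 * N) + 1) = 0
    · rw [h0, natDegree_zero]
      omega
    · have := natDegree_lt_natDegree h0 hlt
      rwa [hmonic.2] at this
  · intro m hm
    rw [card_Icc_nodes] at hm
    have h1 := moment_szegoPoly_eq_zero hk0 hk1 _ hz0 hc hm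
    have h2 : moment (Finset.Icc (-(N : ℤ) + 1) N) (node N) ρ (X ^ (2 * N) + 1) m = 0 := by
      have h3 : moment (Finset.Icc (-(N : ℤ) + 1) N) (node N) ρ (X ^ (2 * N) + 1) m
          = (∑ j ∈ Finset.Icc (-(N : ℤ) + 1) N, (ρ j : ℂ) * node N j ^ ((2 * N : ℤ) - m))
          + ∑ j ∈ Finset.Icc (-(N : ℤ) + 1) N, (ρ j : ℂ) * node N j ^ (-(m : ℤ)) := by
        rw [moment, ← Finset.sum_add_distrib]
        refine Finset.sum_congr rfl fun j hj => ?_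
        have := hz0 j hj
        rw [eval_add, eval_pow, eval_X, eval_one, zpow_sub₀ this, zpow_neg,
          show (2 * N : ℤ) = ((2 * N : ℕ) : ℤ) by push_cast; ring, zpow_natCast]
        field_simp
        rw [zpow_natCast]
      rw [h3, hc, hc]
      norm_cast
      have e1 : (((2 * N : ℕ) - (m : ℤ) : ℤ) : ℝ) * (ellipticK k / N)
          = 2 * ellipticK k - m * (ellipticK k / N) := by
        push_cast
        field_simp
      have e2 : ((-(m : ℤ) : ℤ) : ℝ) * (ellipticK k / N) = -(m * (ellipticK k / N)) := by
        push_cast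
        ring
      rw [e2, jacobiCn_neg hk0 hk1]
      push_cast at e1 ⊢
      rw [e1, jacobiCn_two_mul_ellipticK_sub hk0 hk1]
      ring
    have h3 : moment (Finset.Icc (-(N : ℤ) + 1) N) (node N) ρ
        (szegoPoly a (2 * N) - (X ^ (2 * N) + 1)) m
        = moment (Finset.Icc (-(N : ℤ) + 1) N) (node N) ρ (szegoPoly a (2 * N)) m
          - moment (Finset.Icc (-(N : ℤ) + 1) N) (node N) ρ (X ^ (2 * N) + 1) m := by
      simp only [moment, eval_sub, ← Finset.sum_sub_distrib]
      refine Finset.sum_congr rfl fun j _ => ?_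
      ring
    rw [h3, h1, h2, sub_zero]

lemma cnReflection_last (hk0 : 0 < k) (hk1 : k < 1) (hN : 1 ≤ N) :
    cnReflection k (ellipticK k / N) (2 * N - 1) = -1 := by
  have hN0 : (N : ℝ) ≠ 0 := by exact_mod_cast (by omega : N ≠ 0)
  rw [cnReflection, if_neg (by rw [Nat.not_even_iff_odd]; exact ⟨N - 1, by omega⟩),
    Nat.cast_sub (by omega)]
  have e : ellipticK k / N * (((2 * N : ℕ) : ℝ) - (1 : ℕ) + 1) = 2 * ellipticK k - 0 := by
    push_cast
    field_simp
    ring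
  rw [e, jacobiDn, jacobiSn, jacobiAm_two_mul_ellipticK_sub hk0 hk1, jacobiAm_zero hk0 hk1]
  simp

lemma szegoNorm_pos (hk0 : 0 < k) (hk1 : k < 1) {n : ℕ} (hn : n < 2 * N) :
    0 < szegoNorm (cnReflection k (ellipticK k / N)) n := by
  have hK := ellipticK_pos hk0 hk1
  refine Finset.prod_pos fun i hi => ?_
  have hi' := Finset.mem_range.1 hi
  have hN0 : (0 : ℝ) < N := by exact_mod_cast (by omega : 0 < N)
  have hu0 : 0 < ellipticK k / N * (i + 1) := by positivity
  have hu1 : ellipticK k / N * (i + 1) < 2 * ellipticK k := by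
    have : ((i : ℝ) + 1) < 2 * N := by exact_mod_cast (by omega : i + 1 < 2 * N)
    rw [div_mul_eq_mul_div, div_lt_iff₀ hN0]
    nlinarith
  have hs := jacobiSn_pos hk0 hk1 hu0 hu1
  rw [cnReflection]
  split_ifs
  · have := jacobiCn_sq_add_jacobiSn_sq k (ellipticK k / N * (i + 1))
    nlinarith
  · have := jacobiDn_sq_add hk0 hk1 (ellipticK k / N * (i + 1))
    have : 0 < k ^ 2 * jacobiSn k (ellipticK k / N * (i + 1)) ^ 2 := by positivity
    rw [neg_sq]
    linarith

end Szego

/-! ### Series indexed by the integers -/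

section IntSeries

lemma summable_pow_natAbs {r : ℝ} (hr0 : 0 ≤ r) (hr1 : r < 1) :
    Summable fun n : ℤ => r ^ n.natAbs := by
  refine Summable.of_nat_of_neg ?_ ?_ <;>
  simpa using summable_geometric_of_lt_one hr0 hr1

/-- The Cauchy product of two series indexed by `ℤ`. -/
lemma tsum_mul_tsum_int {a b : ℤ → ℂ} (ha : Summable fun n => ‖a n‖)
    (hb : Summable fun n => ‖b n‖) :
    (∑' n, a n) * ∑' n, b n = ∑' n, ∑' j, a (n - j) * b j := by
  rw [tsum_mul_tsum_of_summable_norm ha hb]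
  let e : ℤ × ℤ ≃ ℤ × ℤ :=
    { toFun := fun z => (z.1 - z.2, z.2)
      invFun := fun z => (z.1 + z.2, z.2)
      left_inv := fun z => by simp
      right_inv := fun z => by simp }
  have hs := summable_mul_of_summable_norm ha hb
  rw [← e.tsum_eq]
  exact (e.summable_iff.2 hs).tsum_prod

end IntSeries

/-! ### The triple product -/

section Theta

/-- The infinite product `(x; p)_∞` for complex arguments. -/
noncomputable def cqFactorial (x p : ℂ) : ℂ := ∏' n : ℕ, (1 - x * p ^ n)

variable {p q : ℂ}

lemma summable_norm_mul_pow (x : ℂ) (hp : ‖p‖ < 1) : Summable fun n : ℕ => ‖-(x * p ^ n)‖ := by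
  simpa [norm_mul, norm_pow] using (summable_geometric_of_lt_one (norm_nonneg p) hp).mul_left ‖x‖

lemma multipliable_cqFactorial (x : ℂ) (hp : ‖p‖ < 1) :
    Multipliable fun n : ℕ => 1 - x * p ^ n := by
  simpa [sub_eq_add_neg] using multipliable_one_add_of_summable (summable_norm_mul_pow x hp)

lemma cqFactorial_ne_zero {x : ℂ} (hp : ‖p‖ < 1) (h : ∀ n : ℕ, x * p ^ n ≠ 1) :
    cqFactorial x p ≠ 0 := by
  have := tprod_one_add_ne_zero_of_summable (f := fun n : ℕ => -(x * p ^ n))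
    (fun n => by rw [← sub_eq_add_neg, sub_ne_zero]; exact (h n).symm)
    (summable_norm_mul_pow x hp)
  simpa [cqFactorial, sub_eq_add_neg] using this

lemma cqFactorial_self_ne_zero (hp : ‖p‖ < 1) : cqFactorial p p ≠ 0 := by
  refine cqFactorial_ne_zero hp fun n h => ?_
  have h1 : ‖p ^ (n + 1)‖ = 1 := by rw [pow_succ', h, norm_one]
  rw [norm_pow] at h1
  exact (pow_lt_one₀ (norm_nonneg p) hp (Nat.succ_ne_zero n)).ne h1

lemma cqFactorial_eq_mul (x : ℂ) (hp : ‖p‖ < 1) :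
    cqFactorial x p = (1 - x) * cqFactorial (x * p) p := by
  have h : (fun n : ℕ => 1 - x * p ^ (n + 1)) = fun n : ℕ => 1 - x * p * p ^ n := by
    funext n
    rw [pow_succ', mul_assoc]
  have h1 := tprod_eq_zero_mul' (f := fun n : ℕ => 1 - x * p ^ n)
    (h ▸ multipliable_cqFactorial (x * p) hp)
  rw [h, pow_zero, mul_one] at h1
  exact h1

lemma continuous_cqFactorial (hp : ‖p‖ < 1) : Continuous fun x => cqFactorial x p := by
  rw [continuous_iff_continuousAt]
  intro x
  have h := tendsto_tprod_one_add_of_dominated_convergence (𝓕 := nhds x)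
    (f := fun (y : ℂ) (n : ℕ) => -(y * p ^ n)) (g := fun n : ℕ => -(x * p ^ n))
    (bound := fun n : ℕ => (‖x‖ + 1) * ‖p‖ ^ n)
    ((summable_geometric_of_lt_one (norm_nonneg p) hp).mul_left _)
    (fun n => (Continuous.tendsto (by fun_prop) x)) ?_
  · simpa [ContinuousAt, cqFactorial, sub_eq_add_neg] using h
  · filter_upwards [Metric.ball_mem_nhds x one_pos] with y hy n
    rw [norm_neg, norm_mul, norm_pow]
    gcongr
    have h1 := norm_sub_norm_le y x
    rw [Metric.mem_ball, dist_eq_norm] at hy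
    linarith

/-- The coefficients `(-1)^n q^{n(n-1)}` of the theta series. -/
noncomputable def thetaCoeff (q : ℂ) (n : ℤ) : ℂ := (-1) ^ n * q ^ (n * (n - 1))

/-- The theta series `∑ (-1)^n q^{n(n-1)} x^n`. -/
noncomputable def thetaSeries (q x : ℂ) : ℂ := ∑' n : ℤ, thetaCoeff q n * x ^ n

lemma thetaCoeff_ne_zero (hq0 : q ≠ 0) (n : ℤ) : thetaCoeff q n ≠ 0 :=
  mul_ne_zero (zpow_ne_zero _ (by norm_num)) (zpow_ne_zero _ hq0)

lemma thetaCoeff_add_one (hq0 : q ≠ 0) (n : ℤ) :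
    thetaCoeff q (n + 1) = -((q ^ 2) ^ n * thetaCoeff q n) := by
  rw [thetaCoeff, thetaCoeff, zpow_add_one₀ (by norm_num),
    show (n + 1) * (n + 1 - 1) = 2 * n + n * (n - 1) by ring, zpow_add₀ hq0, zpow_mul, zpow_ofNat]
  ring

lemma thetaCoeff_sub_one (hq0 : q ≠ 0) (n : ℤ) :
    (q ^ 2) ^ n * thetaCoeff q (n - 1) = -(q ^ 2 * thetaCoeff q n) := by
  have h := thetaCoeff_add_one hq0 (n - 1)
  rw [sub_add_cancel] at h
  rw [h, zpow_sub_one₀ (pow_ne_zero 2 hq0)]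
  field_simp

lemma summable_thetaSeries (hq0 : q ≠ 0) (hq1 : ‖q‖ < 1) {x : ℂ} (hx : x ≠ 0) :
    Summable fun n : ℤ => ‖thetaCoeff q n * x ^ n‖ := by
  have hq2 : ‖q ^ 2‖ < 1 := by
    rw [norm_pow]
    exact pow_lt_one₀ (norm_nonneg q) hq1 two_ne_zero
  have hlim (c : ℝ) : Filter.Tendsto (fun n : ℕ => ‖q ^ 2‖ ^ n * c) Filter.atTop (nhds 0) := by
    simpa using (tendsto_pow_atTop_nhds_zero_of_lt_one (norm_nonneg _) hq2).mul_const c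
  have hne (n : ℤ) : thetaCoeff q n * x ^ n ≠ 0 :=
    mul_ne_zero (thetaCoeff_ne_zero hq0 n) (zpow_ne_zero _ hx)
  refine Summable.of_nat_of_neg ?_ ?_
  · refine summable_of_ratio_test_tendsto_lt_one zero_lt_one
      (Filter.Eventually.of_forall fun n => norm_ne_zero_iff.2 (hne n)) ?_
    refine (hlim ‖x‖).congr fun n => ?_
    rw [norm_norm, norm_norm, eq_div_iff (norm_ne_zero_iff.2 (hne n))]
    push_cast
    rw [thetaCoeff_add_one hq0, zpow_add_one₀ hx, ← norm_pow, ← norm_mul, ← norm_mul, ← norm_neg]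
    congr 1
    simp only [zpow_natCast]
    ring
  · refine summable_of_ratio_test_tendsto_lt_one zero_lt_one
      (Filter.Eventually.of_forall fun n => norm_ne_zero_iff.2 (hne _)) ?_
    refine (hlim ‖q ^ 2 * x⁻¹‖).congr fun n => ?_
    rw [norm_norm, norm_norm, eq_div_iff (norm_ne_zero_iff.2 (hne _))]
    push_cast
    rw [← norm_pow, ← norm_mul, ← norm_mul, ← norm_neg]
    congr 1
    have h := thetaCoeff_sub_one hq0 (-(n : ℤ))
    rw [neg_add, ← sub_eq_add_neg, zpow_sub_one₀ hx]
    have hp := pow_ne_zero n (pow_ne_zero 2 hq0)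
    rw [zpow_neg, zpow_natCast, inv_mul_eq_iff_eq_mul₀ hp] at h
    rw [h]
    ring

variable (p) in
/-- `1 / (p; p)_m` for `m ≥ 0` and `0` for `m < 0`, so that `g (m - 1) = (1 - p ^ m) g m` on `ℤ`. -/
noncomputable def invPochhammer (m : ℤ) : ℂ :=
  if 0 ≤ m then (∏ i ∈ Finset.range m.toNat, (1 - p * p ^ i))⁻¹ else 0

lemma one_sub_pow_ne_zero (hp : ‖p‖ < 1) (n : ℕ) : 1 - p * p ^ n ≠ 0 := by
  intro h
  have h1 : ‖p ^ (n + 1)‖ = 1 := by rw [pow_succ', ← sub_eq_zero.1 h, norm_one]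
  rw [norm_pow] at h1
  exact (pow_lt_one₀ (norm_nonneg p) hp (Nat.succ_ne_zero n)).ne h1

lemma invPochhammer_sub_one (hp : ‖p‖ < 1) (m : ℤ) :
    invPochhammer p (m - 1) = (1 - p ^ m) * invPochhammer p m := by
  rcases lt_trichotomy m 0 with h | rfl | h
  · rw [invPochhammer, invPochhammer, if_neg (by omega), if_neg (by omega), mul_zero]
  · simp [invPochhammer]
  · obtain ⟨n, rfl⟩ : ∃ n : ℕ, m = n + 1 := ⟨(m - 1).toNat, by omega⟩
    rw [invPochhammer, invPochhammer, if_pos (by omega), if_pos (by omega), add_sub_cancel_right]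
    rw [show ((n : ℤ) + 1).toNat = n + 1 by omega, Int.toNat_natCast, Finset.prod_range_succ,
      mul_inv, mul_comm, mul_assoc, ← pow_succ']
    have := one_sub_pow_ne_zero hp n
    rw [← pow_succ'] at this
    rw [show ((n : ℤ) + 1) = ((n + 1 : ℕ) : ℤ) by push_cast; ring, zpow_natCast,
      inv_mul_cancel₀ this, mul_one]

/-- The finite form of the triple product identity. The induction step is the recurrence that arises
from multiplying the Laurent polynomial by `(1 - x p^n) (1 - p^{n+1} / x)`, where `p = q²`. -/
lemma hasSum_finite_triple_product (hq0 : q ≠ 0) (hq1 : ‖q ^ 2‖ < 1) {x : ℂ} (hx : x ≠ 0)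
    (n : ℕ) :
    HasSum (fun j : ℤ => (∏ i ∈ Finset.range (2 * n), (1 - q ^ 2 * (q ^ 2) ^ i)) *
        (invPochhammer (q ^ 2) (n + j) * invPochhammer (q ^ 2) (n - j)) *
        (thetaCoeff q j * x ^ j))
      ((∏ i ∈ Finset.range n, (1 - x * (q ^ 2) ^ i)) *
        ∏ i ∈ Finset.range n, (1 - q ^ 2 / x * (q ^ 2) ^ i)) := by
  have hp0 : q ^ 2 ≠ 0 := pow_ne_zero 2 hq0
  induction n with
  | zero =>
    convert hasSum_single (0 : ℤ) ?_ using 1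
    · simp [invPochhammer, thetaCoeff]
    · intro j hj
      rcases lt_or_gt_of_ne hj with h | h
      · rw [invPochhammer, if_neg (by push_cast; omega)]
        simp
      · rw [mul_comm (invPochhammer _ _), invPochhammer, if_neg (by push_cast; omega)]
        simp
  | succ n ih =>
    set D := ∏ i ∈ Finset.range (2 * n), (1 - q ^ 2 * (q ^ 2) ^ i)
    set A := (∏ i ∈ Finset.range n, (1 - x * (q ^ 2) ^ i)) *
        ∏ i ∈ Finset.range n, (1 - q ^ 2 / x * (q ^ 2) ^ i)
    have h1 := (Equiv.subRight (1 : ℤ)).hasSum_iff.2 ih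
    have h2 := (Equiv.addRight (1 : ℤ)).hasSum_iff.2 ih
    have h3 := ((ih.mul_left (1 + (q ^ 2) ^ (2 * n + 1))).sub
      (h1.mul_left (x * (q ^ 2) ^ n))).sub (h2.mul_left (x⁻¹ * (q ^ 2) ^ (n + 1)))
    have hA : (∏ i ∈ Finset.range (n + 1), (1 - x * (q ^ 2) ^ i)) *
        ∏ i ∈ Finset.range (n + 1), (1 - q ^ 2 / x * (q ^ 2) ^ i)
        = (1 + (q ^ 2) ^ (2 * n + 1)) * A - x * (q ^ 2) ^ n * A - x⁻¹ * (q ^ 2) ^ (n + 1) * A := by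
      rw [Finset.prod_range_succ, Finset.prod_range_succ, mul_mul_mul_comm]
      change A * _ = _
      rw [show 2 * n + 1 = n + n + 1 by ring]
      simp only [pow_add, pow_one]
      field_simp
      ring
    rw [hA]
    refine h3.congr_fun fun j => ?_
    simp only [Function.comp_apply, Equiv.subRight_apply, Equiv.coe_addRight]
    rw [show 2 * (n + 1) = 2 * n + 1 + 1 by ring, Finset.prod_range_succ,
      Finset.prod_range_succ]
    change D * _ * _ * _ * _ = _
    clear_value D
    push_cast
    set u := invPochhammer (q ^ 2) (n + 1 + j) with hu
    set v := invPochhammer (q ^ 2) (n + 1 - j) with hv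
    have e1 : invPochhammer (q ^ 2) (n + j) = (1 - (q ^ 2) ^ ((n : ℤ) + 1 + j)) * u := by
      rw [hu, ← invPochhammer_sub_one hq1]; congr 1; ring
    have e2 : invPochhammer (q ^ 2) (n + (j - 1))
        = (1 - (q ^ 2) ^ ((n : ℤ) + j)) * ((1 - (q ^ 2) ^ ((n : ℤ) + 1 + j)) * u) := by
      rw [← e1, ← invPochhammer_sub_one hq1]; congr 1; ring
    have e3 : invPochhammer (q ^ 2) (n - j) = (1 - (q ^ 2) ^ ((n : ℤ) + 1 - j)) * v := by
      rw [hv, ← invPochhammer_sub_one hq1]; congr 1; ring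
    have e4 : invPochhammer (q ^ 2) (n - (j + 1))
        = (1 - (q ^ 2) ^ ((n : ℤ) - j)) * ((1 - (q ^ 2) ^ ((n : ℤ) + 1 - j)) * v) := by
      rw [← e3, ← invPochhammer_sub_one hq1]; congr 1; ring
    have e5 : invPochhammer (q ^ 2) (n - (j - 1)) = v := by rw [hv]; congr 1; ring
    have e6 : invPochhammer (q ^ 2) (n + (j + 1)) = u := by rw [hu]; congr 1; ring
    rw [e1, e2, e3, e4, e5, e6, zpow_sub_one₀ hx, zpow_add_one₀ hx, thetaCoeff_add_one hq0]
    have hs := thetaCoeff_sub_one hq0 j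
    rw [mul_comm, ← eq_div_iff (zpow_ne_zero _ hp0)] at hs
    rw [hs]
    simp only [zpow_add₀ hp0, zpow_sub₀ hp0, zpow_natCast, zpow_one]
    have hP := zpow_ne_zero j hp0
    generalize (q ^ 2) ^ j = Pj at *
    rw [show 2 * n + 1 = n + n + 1 by ring, show 2 * n = n + n by ring]
    simp only [pow_add, pow_one]
    generalize (q ^ 2) ^ n = Pn at *
    generalize q ^ 2 = P at *
    field_simp
    ring

lemma tendsto_prod_cqFactorial (x : ℂ) (hp : ‖p‖ < 1) :
    Filter.Tendsto (fun n => ∏ i ∈ Finset.range n, (1 - x * p ^ i)) Filter.atTop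
      (nhds (cqFactorial x p)) :=
  (multipliable_cqFactorial x hp).tendsto_prod_tprod_nat

lemma tendsto_invPochhammer (hp : ‖p‖ < 1) (j : ℤ) :
    Filter.Tendsto (fun n : ℕ => invPochhammer p (n + j)) Filter.atTop
      (nhds (cqFactorial p p)⁻¹) := by
  have h := (tendsto_prod_cqFactorial p hp).inv₀ (cqFactorial_self_ne_zero hp)
  have h1 : Filter.Tendsto (fun n : ℕ => ((n : ℤ) + j).toNat) Filter.atTop Filter.atTop := by
    rw [Filter.tendsto_atTop]
    intro b
    filter_upwards [Filter.eventually_ge_atTop (b + j.natAbs)] with n hn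
    omega
  refine (h.comp h1).congr' ?_
  filter_upwards [Filter.eventually_ge_atTop j.natAbs] with n hn
  rw [invPochhammer, if_pos (by omega)]
  rfl

lemma exists_norm_invPochhammer_le (hp : ‖p‖ < 1) : ∃ C, ∀ m, ‖invPochhammer p m‖ ≤ C := by
  have h := tendsto_invPochhammer hp 0
  obtain ⟨C, hC⟩ := (Metric.isBounded_range_of_tendsto _ h).exists_norm_le
  refine ⟨C, fun m => ?_⟩
  rcases le_or_gt 0 m with hm | hm
  · have := hC _ ⟨m.toNat, rfl⟩
    simpa [hm] using this
  · rw [invPochhammer, if_neg (by omega), norm_zero]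
    exact (norm_nonneg _).trans (hC _ ⟨0, rfl⟩)

/-- **Jacobi's triple product identity.** -/
theorem thetaSeries_eq_prod (hq0 : q ≠ 0) (hq1 : ‖q‖ < 1) {x : ℂ} (hx : x ≠ 0) :
    thetaSeries q x = cqFactorial x (q ^ 2) * cqFactorial (q ^ 2 / x) (q ^ 2) *
      cqFactorial (q ^ 2) (q ^ 2) := by
  have hp : ‖q ^ 2‖ < 1 := by
    rw [norm_pow]
    exact pow_lt_one₀ (norm_nonneg q) hq1 two_ne_zero
  have hne := cqFactorial_self_ne_zero hp
  set e := cqFactorial (q ^ 2) (q ^ 2)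
  have hleft := (tendsto_prod_cqFactorial x hp).mul (tendsto_prod_cqFactorial (q ^ 2 / x) hp)
  have hD : Filter.Tendsto (fun n => ∏ i ∈ Finset.range (2 * n), (1 - q ^ 2 * (q ^ 2) ^ i))
      Filter.atTop (nhds e) :=
    (tendsto_prod_cqFactorial (q ^ 2) hp).comp
      (Filter.tendsto_id.const_mul_atTop' (by norm_num : (0 : ℕ) < 2))
  obtain ⟨C₁, hC₁⟩ := (Metric.isBounded_range_of_tendsto _ hD).exists_norm_le
  obtain ⟨C₂, hC₂⟩ := exists_norm_invPochhammer_le hp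
  have hright := tendsto_tsum_of_dominated_convergence (𝓕 := Filter.atTop)
    (f := fun (n : ℕ) (j : ℤ) => (∏ i ∈ Finset.range (2 * n), (1 - q ^ 2 * (q ^ 2) ^ i)) *
        (invPochhammer (q ^ 2) (n + j) * invPochhammer (q ^ 2) (n - j)) *
        (thetaCoeff q j * x ^ j))
    (g := fun j => e * (e⁻¹ * e⁻¹) * (thetaCoeff q j * x ^ j))
    (bound := fun j => C₁ * (C₂ * C₂) * ‖thetaCoeff q j * x ^ j‖)
    ((summable_thetaSeries hq0 hq1 hx).mul_left _) (fun j => ?_) ?_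
  · simp_rw [fun n => (hasSum_finite_triple_product hq0 hp hx n).tsum_eq] at hright
    have h := tendsto_nhds_unique hleft hright
    rw [tsum_mul_left] at h
    rw [h, thetaSeries]
    field_simp
  · refine (hD.mul ((tendsto_invPochhammer hp j).mul ?_)).mul_const _
    simpa only [sub_eq_add_neg] using tendsto_invPochhammer hp (-j)
  · refine Filter.Eventually.of_forall fun n j => ?_
    have h0 := (norm_nonneg _).trans (hC₂ 0)
    have h1 := (norm_nonneg _).trans (hC₁ _ ⟨0, rfl⟩)
    rw [norm_mul, norm_mul, norm_mul (invPochhammer _ _)]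
    gcongr
    · exact hC₁ _ ⟨n, rfl⟩
    · exact hC₂ _
    · exact hC₂ _

lemma thetaSeries_ne_zero (hq0 : q ≠ 0) (hq1 : ‖q‖ < 1) {x : ℂ} (hx : x ≠ 0)
    (h : ∀ n : ℤ, x * (q ^ 2) ^ n ≠ 1) : thetaSeries q x ≠ 0 := by
  have hp : ‖q ^ 2‖ < 1 := by
    rw [norm_pow]
    exact pow_lt_one₀ (norm_nonneg q) hq1 two_ne_zero
  rw [thetaSeries_eq_prod hq0 hq1 hx]
  refine mul_ne_zero (mul_ne_zero (cqFactorial_ne_zero hp fun n => ?_)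
    (cqFactorial_ne_zero hp fun n hn => ?_)) (cqFactorial_self_ne_zero hp)
  · exact_mod_cast h n
  · refine h (-(n + 1 : ℕ)) ?_
    have hp0 := pow_ne_zero (n + 1) (pow_ne_zero 2 hq0)
    rw [zpow_neg, zpow_natCast, ← div_eq_mul_inv, div_eq_one_iff_eq hp0]
    field_simp at hn
    rw [pow_succ', hn]

lemma thetaSeries_one (hq0 : q ≠ 0) (hq1 : ‖q‖ < 1) : thetaSeries q 1 = 0 := by
  have hp : ‖q ^ 2‖ < 1 := by
    rw [norm_pow]
    exact pow_lt_one₀ (norm_nonneg q) hq1 two_ne_zero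
  rw [thetaSeries_eq_prod hq0 hq1 one_ne_zero, cqFactorial_eq_mul 1 hp]
  simp

/-- Quasi-periodicity of the theta series. -/
lemma thetaSeries_sq_mul (hq0 : q ≠ 0) {x : ℂ} (hx : x ≠ 0) :
    thetaSeries q (q ^ 2 * x) = -x⁻¹ * thetaSeries q x := by
  rw [thetaSeries, thetaSeries, ← tsum_mul_left, ← (Equiv.addRight (1 : ℤ)).tsum_eq fun n =>
    -x⁻¹ * (thetaCoeff q n * x ^ n)]
  refine tsum_congr fun n => ?_
  rw [Equiv.coe_addRight, thetaCoeff_add_one hq0, mul_zpow, zpow_add_one₀ hx]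
  field_simp

end Theta

/-! ### Kronecker's bilateral series -/

section Kronecker

variable {p q x y : ℂ}

/-- The bilateral series `∑ y^m / (1 - x p^m)`, convergent for `|p| < |y| < 1`. -/
noncomputable def kroneckerSeries (p x y : ℂ) : ℂ := ∑' m : ℤ, y ^ m / (1 - x * p ^ m)

lemma exists_norm_one_div_le (hp0 : p ≠ 0) (hp : ‖p‖ < 1) (hx : x ≠ 0) :
    ∃ C : ℝ, 0 ≤ C ∧ (∀ n : ℕ, ‖1 / (1 - x * p ^ (n : ℤ))‖ ≤ C) ∧
      ∀ n : ℕ, ‖1 / (1 - x * p ^ (-(n : ℤ)))‖ ≤ C * ‖p‖ ^ n := by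
  have ht := tendsto_pow_atTop_nhds_zero_of_norm_lt_one hp
  have h1 : Filter.Tendsto (fun n : ℕ => 1 / (1 - x * p ^ n)) Filter.atTop
      (nhds (1 / (1 - x * 0))) :=
    tendsto_const_nhds.div (tendsto_const_nhds.sub (ht.const_mul x)) (by simp)
  have h2 : Filter.Tendsto (fun n : ℕ => 1 / (p ^ n - x)) Filter.atTop (nhds (1 / (0 - x))) :=
    tendsto_const_nhds.div (ht.sub tendsto_const_nhds) (by simpa using hx)
  obtain ⟨C₁, hC₁⟩ := (Metric.isBounded_range_of_tendsto _ h1).exists_norm_le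
  obtain ⟨C₂, hC₂⟩ := (Metric.isBounded_range_of_tendsto _ h2).exists_norm_le
  refine ⟨max C₁ C₂, (norm_nonneg _).trans ((hC₁ _ ⟨0, rfl⟩).trans (le_max_left _ _)),
    fun n => ?_, fun n => ?_⟩
  · rw [zpow_natCast]
    exact (hC₁ _ ⟨n, rfl⟩).trans (le_max_left _ _)
  · have hpn := pow_ne_zero n hp0
    have e : 1 / (1 - x * p ^ (-(n : ℤ))) = 1 / (p ^ n - x) * p ^ n := by
      rw [zpow_neg, zpow_natCast, show 1 - x * (p ^ n)⁻¹ = (p ^ n - x) / p ^ n by field_simp]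
      rw [one_div_div, div_eq_mul_one_div, mul_comm]
    rw [e, norm_mul, norm_pow]
    gcongr
    exact (hC₂ _ ⟨n, rfl⟩).trans (le_max_right _ _)

lemma summable_kroneckerSeries (hp0 : p ≠ 0) (hx : x ≠ 0) (hy : ‖p‖ < ‖y‖) (hy1 : ‖y‖ < 1) :
    Summable fun m : ℤ => ‖y ^ m / (1 - x * p ^ m)‖ := by
  obtain ⟨C, hC, h1, h2⟩ := exists_norm_one_div_le hp0 (hy.trans hy1) hx
  have hy0 : 0 < ‖y‖ := (norm_nonneg p).trans_lt hy
  refine Summable.of_nat_of_neg ?_ ?_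
  · refine Summable.of_nonneg_of_le (fun n => norm_nonneg _) (fun n => ?_)
      ((summable_geometric_of_lt_one hy0.le hy1).mul_left C)
    rw [div_eq_mul_one_div, norm_mul, zpow_natCast, norm_pow, mul_comm]
    gcongr
    exact_mod_cast h1 n
  · refine Summable.of_nonneg_of_le (fun n => norm_nonneg _) (fun n => ?_)
      ((summable_geometric_of_lt_one (div_nonneg (norm_nonneg p) hy0.le)
        ((div_lt_one hy0).2 hy)).mul_left C)
    have e : C * (‖p‖ / ‖y‖) ^ n = ‖y ^ (-(n : ℤ))‖ * (C * ‖p‖ ^ n) := by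
      rw [zpow_neg, norm_inv, zpow_natCast, norm_pow, div_pow]
      field_simp
    rw [div_eq_mul_one_div, norm_mul, e]
    gcongr
    exact h2 n

variable (q x) in
/-- The coefficients of the product of the Kronecker series with the theta series, as a Laurent
series in `y`. -/
noncomputable def kroneckerCoeff (n : ℤ) : ℂ :=
  ∑' j : ℤ, thetaCoeff q j / (1 - x * (q ^ 2) ^ (n - j))

lemma norm_sq_lt_one (hq1 : ‖q‖ < 1) : ‖q ^ 2‖ < 1 := by
  rw [norm_pow]
  exact pow_lt_one₀ (norm_nonneg q) hq1 two_ne_zero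

lemma summable_kroneckerCoeff (hq0 : q ≠ 0) (hq1 : ‖q‖ < 1) (hx : x ≠ 0) (n : ℤ) :
    Summable fun j : ℤ => thetaCoeff q j / (1 - x * (q ^ 2) ^ (n - j)) := by
  have hp := norm_sq_lt_one hq1
  obtain ⟨C, hC, h1, h2⟩ := exists_norm_one_div_le (pow_ne_zero 2 hq0) hp hx
  have hb (m : ℤ) : ‖1 / (1 - x * (q ^ 2) ^ m)‖ ≤ C := by
    obtain ⟨n, rfl | rfl⟩ := m.eq_nat_or_neg
    · exact h1 n
    · exact (h2 n).trans (mul_le_of_le_one_right hC (pow_le_one₀ (norm_nonneg _) hp.le))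
  refine Summable.of_norm_bounded
    ((summable_thetaSeries hq0 hq1 one_ne_zero).mul_left C) fun j => ?_
  rw [div_eq_mul_one_div, norm_mul, mul_comm, one_zpow, mul_one]
  gcongr
  exact hb _

/-- The difference of the two sides is the theta series at `1`, which vanishes. -/
lemma kroneckerCoeff_succ (hq0 : q ≠ 0) (hq1 : ‖q‖ < 1) (hx : x ≠ 0)
    (hxp : ∀ m : ℤ, x * (q ^ 2) ^ m ≠ 1) (n : ℤ) :
    kroneckerCoeff q x (n + 1) = -(x * (q ^ 2) ^ n) * kroneckerCoeff q x n := by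
  have hp0 := pow_ne_zero 2 hq0
  have hs := summable_kroneckerCoeff hq0 hq1 hx
  have h1 : -(x * (q ^ 2) ^ n) * kroneckerCoeff q x n = ∑' j : ℤ,
      x * (q ^ 2) ^ (n + 1 - j) * (thetaCoeff q j / (1 - x * (q ^ 2) ^ (n + 1 - j))) := by
    rw [kroneckerCoeff, ← tsum_mul_left, ← (Equiv.addRight (1 : ℤ)).tsum_eq fun j =>
      x * (q ^ 2) ^ (n + 1 - j) * (thetaCoeff q j / (1 - x * (q ^ 2) ^ (n + 1 - j)))]
    refine tsum_congr fun j => ?_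
    rw [Equiv.coe_addRight, add_sub_add_right_eq_sub, thetaCoeff_add_one hq0, zpow_sub₀ hp0]
    have := zpow_ne_zero j hp0
    field_simp
  have h2 : thetaSeries q 1 = ∑' j : ℤ,
      (thetaCoeff q j / (1 - x * (q ^ 2) ^ (n + 1 - j))
        - x * (q ^ 2) ^ (n + 1 - j) * (thetaCoeff q j / (1 - x * (q ^ 2) ^ (n + 1 - j)))) := by
    refine tsum_congr fun j => ?_
    have := sub_ne_zero.2 (hxp (n + 1 - j)).symm
    rw [one_zpow, mul_one]
    field_simp
  have hs2 : Summable fun j : ℤ =>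
      x * (q ^ 2) ^ (n + 1 - j) * (thetaCoeff q j / (1 - x * (q ^ 2) ^ (n + 1 - j))) := by
    refine ((hs (n + 1)).sub
      (summable_thetaSeries hq0 hq1 one_ne_zero).of_norm).congr fun j => ?_
    have := sub_ne_zero.2 (hxp (n + 1 - j)).symm
    rw [one_zpow, mul_one]
    field_simp
    ring
  rw [thetaSeries_one hq0 hq1, (hs (n + 1)).tsum_sub hs2, ← h1] at h2
  exact (sub_eq_zero.1 h2.symm)

/-- The recurrence determines the coefficients up to a factor: they are proportional to those of
the theta series of `x y`. -/
lemma kroneckerCoeff_eq (hq0 : q ≠ 0) (hq1 : ‖q‖ < 1) (hx : x ≠ 0)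
    (hxp : ∀ m : ℤ, x * (q ^ 2) ^ m ≠ 1) (n : ℤ) :
    kroneckerCoeff q x n = kroneckerCoeff q x 0 * (thetaCoeff q n * x ^ n) := by
  have hp0 := pow_ne_zero 2 hq0
  induction n using Int.induction_on with
  | zero => simp [thetaCoeff]
  | succ n ih =>
    rw [kroneckerCoeff_succ hq0 hq1 hx hxp, ih, thetaCoeff_add_one hq0, zpow_add_one₀ hx]
    ring
  | pred n ih =>
    have h := kroneckerCoeff_succ hq0 hq1 hx hxp (-(n : ℤ) - 1)
    have h1 := thetaCoeff_add_one hq0 (-(n : ℤ) - 1)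
    rw [sub_add_cancel] at h h1
    have h2 : x * (q ^ 2) ^ (-(n : ℤ) - 1) ≠ 0 := mul_ne_zero hx (zpow_ne_zero _ hp0)
    rw [ih, h1] at h
    apply mul_left_cancel₀ (neg_ne_zero.2 h2)
    rw [← h, zpow_sub_one₀ hx]
    field_simp

lemma kroneckerSeries_mul_thetaSeries (hq0 : q ≠ 0) (hx : x ≠ 0)
    (hxp : ∀ m : ℤ, x * (q ^ 2) ^ m ≠ 1) (hy : ‖q ^ 2‖ < ‖y‖) (hy1 : ‖y‖ < 1) :
    kroneckerSeries (q ^ 2) x y * thetaSeries q y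
      = kroneckerCoeff q x 0 * thetaSeries q (x * y) := by
  have hp0 := pow_ne_zero 2 hq0
  have hq1 : ‖q‖ < 1 := by
    have := hy.trans hy1
    rw [norm_pow] at this
    exact (pow_lt_one_iff_of_nonneg (norm_nonneg q) two_ne_zero).1 this
  have hy0 : y ≠ 0 := norm_pos_iff.1 ((norm_nonneg _).trans_lt hy)
  rw [kroneckerSeries, thetaSeries, tsum_mul_tsum_int (summable_kroneckerSeries hp0 hx hy hy1)
    (summable_thetaSeries hq0 hq1 hy0), thetaSeries, ← tsum_mul_left]
  refine tsum_congr fun n => ?_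
  rw [mul_zpow, ← mul_assoc (thetaCoeff q n), ← mul_assoc (kroneckerCoeff q x 0),
    ← kroneckerCoeff_eq hq0 hq1 hx hxp, kroneckerCoeff, ← tsum_mul_right]
  refine tsum_congr fun j => ?_
  rw [zpow_sub₀ hy0]
  have := zpow_ne_zero j hy0
  field_simp

/-- The residue of the Kronecker series at `y = 1`. -/
lemma tendsto_one_sub_mul_kroneckerSeries (hq0 : q ≠ 0) (hq1 : ‖q‖ < 1) (hx : x ≠ 0)
    (hxp : ∀ m : ℤ, x * (q ^ 2) ^ m ≠ 1) :
    Filter.Tendsto (fun y : ℝ => (1 - (y : ℂ)) * kroneckerSeries (q ^ 2) x y)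
      (nhdsWithin 1 (Set.Iio 1)) (nhds 1) := by
  have hp0 := pow_ne_zero 2 hq0
  have hp := norm_sq_lt_one hq1
  have hqp : 0 < ‖q‖ := norm_pos_iff.2 hq0
  obtain ⟨C, hC, h1, h2⟩ := exists_norm_one_div_le hp0 hp hx
  -- Subtracting the pole `1 / (1 - y)` leaves coefficients that decay geometrically.
  let g : ℤ → ℂ := fun m => 1 / (1 - x * (q ^ 2) ^ m) - if 0 ≤ m then 1 else 0
  have hg (m : ℤ) : ‖g m‖ ≤ C * (1 + ‖x‖) * ‖q ^ 2‖ ^ m.natAbs := by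
    obtain ⟨n, rfl | rfl⟩ := m.eq_nat_or_neg
    · have e : g n = 1 / (1 - x * (q ^ 2) ^ (n : ℤ)) * (x * (q ^ 2) ^ n) := by
        have := sub_ne_zero.2 (hxp n).symm
        simp only [g, Int.natCast_nonneg, if_true]
        rw [zpow_natCast] at *
        field_simp
        ring
      rw [e, norm_mul, norm_mul, norm_pow, Int.natAbs_natCast, mul_assoc C]
      gcongr
      · exact h1 n
      · linarith
    · rcases Nat.eq_zero_or_pos n with rfl | hn
      · have e : g (-(0 : ℕ)) = 1 / (1 - x * (q ^ 2) ^ ((0 : ℕ) : ℤ)) * x := by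
          have := sub_ne_zero.2 (hxp 0).symm
          simp only [g]
          simp at *
          field_simp
          ring
        rw [e, norm_mul]
        simp only [Nat.cast_zero, neg_zero, Int.natAbs_zero, pow_zero, mul_one]
        gcongr
        · exact_mod_cast h1 0
        · linarith
      · have e : g (-(n : ℤ)) = 1 / (1 - x * (q ^ 2) ^ (-(n : ℤ))) := by
          simp only [g]
          rw [if_neg (by omega), sub_zero]
        rw [e, Int.natAbs_neg, Int.natAbs_natCast]
        refine (h2 n).trans ?_
        gcongr
        nlinarith [norm_nonneg x]
  set M : ℝ := ∑' m : ℤ, C * (1 + ‖x‖) * ‖q‖ ^ m.natAbs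
  have hM : Summable fun m : ℤ => C * (1 + ‖x‖) * ‖q‖ ^ m.natAbs :=
    (summable_pow_natAbs hqp.le hq1).mul_left _
  have key : ∀ y : ℝ, ‖q‖ < y → y < 1 →
      ‖(1 - (y : ℂ)) * kroneckerSeries (q ^ 2) x y - 1‖ ≤ (1 - y) * M := by
    intro y hy hy1
    have hy0 : 0 < y := hqp.trans hy
    have hyn : ‖(y : ℂ)‖ = y := by rw [Complex.norm_real, Real.norm_of_nonneg hy0.le]
    have hpy : ‖q ^ 2‖ < ‖(y : ℂ)‖ := by
      rw [hyn, norm_pow]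
      nlinarith
    have hterm (m : ℤ) : ‖g m * (y : ℂ) ^ m‖ ≤ C * (1 + ‖x‖) * ‖q‖ ^ m.natAbs := by
      have hym : y ^ m ≤ ‖q‖⁻¹ ^ m.natAbs := by
        obtain ⟨n, rfl | rfl⟩ := m.eq_nat_or_neg
        · rw [zpow_natCast, Int.natAbs_natCast]
          exact (pow_le_one₀ hy0.le hy1.le).trans
            (one_le_pow₀ ((one_le_inv₀ hqp).2 hq1.le))
        · rw [zpow_neg, zpow_natCast, Int.natAbs_neg, Int.natAbs_natCast, ← inv_pow]
          gcongr
      rw [norm_mul, norm_zpow, hyn]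
      calc ‖g m‖ * y ^ m ≤ (C * (1 + ‖x‖) * ‖q ^ 2‖ ^ m.natAbs) * ‖q‖⁻¹ ^ m.natAbs := by
            gcongr
            exact hg m
        _ = C * (1 + ‖x‖) * ‖q‖ ^ m.natAbs := by
            rw [norm_pow, inv_pow, ← pow_mul, two_mul, pow_add]
            field_simp
    have hsg : Summable fun m : ℤ => g m * (y : ℂ) ^ m := Summable.of_norm_bounded hM hterm
    have hgeo : HasSum (fun m : ℤ => if 0 ≤ m then (y : ℂ) ^ m else 0) (1 - (y : ℂ))⁻¹ := by
      have h3 := hasSum_geometric_of_norm_lt_one (ξ := (y : ℂ)) (by rwa [hyn])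
      refine (Nat.cast_injective.hasSum_iff fun m hm => ?_).1 (h3.congr_fun fun n => by simp)
      refine if_neg fun h => hm ⟨m.toNat, by omega⟩
    have hF : kroneckerSeries (q ^ 2) x y = (∑' m : ℤ, g m * (y : ℂ) ^ m) + (1 - (y : ℂ))⁻¹ := by
      rw [← hgeo.tsum_eq, ← hsg.tsum_add hgeo.summable, kroneckerSeries]
      refine tsum_congr fun m => ?_
      simp only [g]
      split_ifs <;> ring
    have hy1' : 1 - (y : ℂ) ≠ 0 := by
      rw [sub_ne_zero]
      exact_mod_cast hy1.ne'
    rw [hF, mul_add, mul_inv_cancel₀ hy1', add_sub_cancel_right, norm_mul]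
    have h5 : ‖1 - (y : ℂ)‖ = 1 - y := by
      rw [← Complex.ofReal_one, ← Complex.ofReal_sub, Complex.norm_real,
        Real.norm_of_nonneg (by linarith)]
    rw [h5]
    exact mul_le_mul_of_nonneg_left (tsum_of_norm_bounded hM.hasSum hterm) (by linarith)
  rw [tendsto_iff_norm_sub_tendsto_zero]
  have hlim : Filter.Tendsto (fun y : ℝ => (1 - y) * M) (nhdsWithin 1 (Set.Iio 1)) (nhds 0) := by
    have : Filter.Tendsto (fun y : ℝ => (1 - y) * M) (nhds 1) (nhds ((1 - 1) * M)) :=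
      Continuous.tendsto (by fun_prop) 1
    rw [sub_self, zero_mul] at this
    exact this.mono_left nhdsWithin_le_nhds
  refine squeeze_zero' (Filter.Eventually.of_forall fun _ => norm_nonneg _) ?_ hlim
  filter_upwards [Ioo_mem_nhdsLT hq1] with y hy
  exact key y hy.1 hy.2

/-- The factor of proportionality, found by comparing residues at `y = 1`. -/
lemma kroneckerCoeff_zero_mul_thetaSeries (hq0 : q ≠ 0) (hq1 : ‖q‖ < 1) (hx : x ≠ 0)
    (hxp : ∀ m : ℤ, x * (q ^ 2) ^ m ≠ 1) :
    kroneckerCoeff q x 0 * thetaSeries q x = cqFactorial (q ^ 2) (q ^ 2) ^ 3 := by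
  have hp := norm_sq_lt_one hq1
  have hcont := continuous_cqFactorial hp
  set e := cqFactorial (q ^ 2) (q ^ 2) with he
  have hy : Filter.Tendsto (fun y : ℝ => (y : ℂ)) (nhdsWithin 1 (Set.Iio 1)) (nhds 1) :=
    (Complex.continuous_ofReal.tendsto' 1 1 (by simp)).mono_left nhdsWithin_le_nhds
  have h1 := (tendsto_one_sub_mul_kroneckerSeries hq0 hq1 hx hxp).mul
    (((hcont.tendsto _).comp (hy.mul_const (q ^ 2))).mul
      (((hcont.tendsto _).comp ((tendsto_const_nhds (x := q ^ 2)).div hy one_ne_zero)).mul_const e))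
  have h2 : Filter.Tendsto (fun y : ℝ => kroneckerCoeff q x 0 *
      (cqFactorial (x * y) (q ^ 2) * cqFactorial (q ^ 2 / (x * y)) (q ^ 2) * e))
      (nhdsWithin 1 (Set.Iio 1)) (nhds (kroneckerCoeff q x 0 *
      (cqFactorial (x * 1) (q ^ 2) * cqFactorial (q ^ 2 / (x * 1)) (q ^ 2) * e))) := by
    refine Filter.Tendsto.const_mul _ (Filter.Tendsto.mul_const _ (Filter.Tendsto.mul ?_ ?_))
    · exact (hcont.tendsto _).comp (hy.const_mul x)
    · exact (hcont.tendsto _).comp (tendsto_const_nhds.div (hy.const_mul x) (by simpa using hx))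
  have h3 := tendsto_nhds_unique (h1.congr' ?_) h2
  · rw [thetaSeries_eq_prod hq0 hq1 hx, ← he]
    simp only [one_mul, mul_one, div_one, ← he] at h3
    rw [← h3]
    ring
  · filter_upwards [Ioo_mem_nhdsLT hq1] with y hy
    have hy0 : 0 < y := (norm_nonneg q).trans_lt hy.1
    have hyc : (y : ℂ) ≠ 0 := by exact_mod_cast hy0.ne'
    have hyn : ‖(y : ℂ)‖ = y := by rw [Complex.norm_real, Real.norm_of_nonneg hy0.le]
    have h4 := kroneckerSeries_mul_thetaSeries hq0 hx hxp (y := y)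
      (by rw [hyn, norm_pow]; nlinarith [hy.1, hy.2, norm_nonneg q]) (by rw [hyn]; exact hy.2)
    rw [thetaSeries_eq_prod hq0 hq1 hyc, thetaSeries_eq_prod hq0 hq1 (mul_ne_zero hx hyc),
      cqFactorial_eq_mul _ hp, ← he] at h4
    simp only [Function.comp_apply, Pi.div_apply]
    rw [← h4]
    ring

/-- **Kronecker's formula** for the bilateral series `∑ y^m / (1 - x q^{2m})` in terms of theta
series. -/
theorem kroneckerSeries_mul (hq0 : q ≠ 0) (hx : x ≠ 0)
    (hxp : ∀ m : ℤ, x * (q ^ 2) ^ m ≠ 1) (hy : ‖q ^ 2‖ < ‖y‖) (hy1 : ‖y‖ < 1) :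
    kroneckerSeries (q ^ 2) x y * (thetaSeries q x * thetaSeries q y)
      = cqFactorial (q ^ 2) (q ^ 2) ^ 3 * thetaSeries q (x * y) := by
  have hq1 : ‖q‖ < 1 := by
    have := hy.trans hy1
    rw [norm_pow] at this
    exact (pow_lt_one_iff_of_nonneg (norm_nonneg q) two_ne_zero).1 this
  rw [← kroneckerCoeff_zero_mul_thetaSeries hq0 hq1 hx hxp]
  linear_combination thetaSeries q x * kroneckerSeries_mul_thetaSeries hq0 hx hxp hy hy1

end Kronecker

/-! ### Trigonometric series in a strip -/

section TrigSeries

open Complex in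
/-- The series `∑ A_m e^{i(2m+ε)θ}`; the shift `ε` is `0` or `1`, up to reindexing. -/
noncomputable def trigSeries (A : ℤ → ℝ) (ε : ℤ) (θ : ℂ) : ℂ :=
  ∑' m : ℤ, (A m : ℂ) * exp (I * (2 * m + ε) * θ)

variable {A B : ℤ → ℝ} {ε δ : ℤ} {τ C C' b : ℝ} {θ : ℂ}

lemma norm_exp_trig_le (hε : |(ε : ℝ)| ≤ 1) (hθ : |θ.im| ≤ b) (m : ℤ) :
    ‖Complex.exp (Complex.I * (2 * m + ε) * θ)‖
      ≤ Real.exp b * Real.exp (2 * b) ^ m.natAbs := by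
  rw [Complex.norm_exp, ← Real.exp_nat_mul, ← Real.exp_add, Real.exp_le_exp]
  have h : (Complex.I * (2 * m + ε) * θ).re = -((2 * m + ε) * θ.im) := by
    simp [Complex.mul_re, Complex.mul_im]
  have h1 : |(2 * m + ε : ℝ)| ≤ 2 * (m.natAbs : ℝ) + 1 := by
    refine (abs_add_le _ _).trans (add_le_add ?_ hε)
    rw [abs_mul, abs_two, Nat.cast_natAbs, Int.cast_abs]
  rw [h]
  calc -((2 * m + ε) * θ.im) ≤ |(2 * m + ε : ℝ)| * |θ.im| := by
        rw [← abs_mul]; exact neg_le_abs _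
    _ ≤ (2 * (m.natAbs : ℝ) + 1) * b := by gcongr
    _ = b + m.natAbs * (2 * b) := by ring

lemma norm_trig_term_le (hε : |(ε : ℝ)| ≤ 1) (hA : ∀ m, |A m| ≤ C * Real.exp (-τ) ^ m.natAbs)
    (hθ : |θ.im| ≤ b) (m : ℤ) :
    ‖(A m : ℂ) * Complex.exp (Complex.I * (2 * m + ε) * θ)‖
      ≤ C * Real.exp b * Real.exp (2 * b - τ) ^ m.natAbs := by
  rw [norm_mul, Complex.norm_real, Real.norm_eq_abs]
  calc |A m| * _ ≤ (C * Real.exp (-τ) ^ m.natAbs) * (Real.exp b * Real.exp (2 * b) ^ m.natAbs) :=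
        mul_le_mul (hA m) (norm_exp_trig_le hε hθ m) (norm_nonneg _)
          ((abs_nonneg _).trans (hA m))
    _ = _ := by
        rw [sub_eq_add_neg, Real.exp_add, mul_pow]
        ring

lemma summable_trigSeries (hε : |(ε : ℝ)| ≤ 1)
    (hA : ∀ m, |A m| ≤ C * Real.exp (-τ) ^ m.natAbs) (hθ : |θ.im| < τ / 2) :
    Summable fun m : ℤ => ‖(A m : ℂ) * Complex.exp (Complex.I * (2 * m + ε) * θ)‖ := by
  refine Summable.of_nonneg_of_le (fun _ => norm_nonneg _)
    (fun m => norm_trig_term_le hε hA le_rfl m)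
    ((summable_pow_natAbs (Real.exp_pos _).le ?_).mul_left _)
  rw [Real.exp_lt_one_iff]
  linarith

lemma summable_mul_pow_natAbs {r : ℝ} (hr0 : 0 ≤ r) (hr1 : r < 1) :
    Summable fun m : ℤ => (2 * (m.natAbs : ℝ) + 1) * r ^ m.natAbs := by
  have h1 : Summable fun n : ℕ => (2 * (n : ℝ) + 1) * r ^ n := by
    have := ((summable_pow_mul_geometric_of_norm_lt_one 1
      (by rwa [Real.norm_of_nonneg hr0] : ‖r‖ < 1)).mul_left 2).add
      (summable_geometric_of_lt_one hr0 hr1)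
    refine this.congr fun n => ?_
    ring
  refine Summable.of_nat_of_neg ?_ ?_ <;> simpa using h1

lemma hasDerivAt_trigSeries (hε : |(ε : ℝ)| ≤ 1)
    (hA : ∀ m, |A m| ≤ C * Real.exp (-τ) ^ m.natAbs) (hθ : |θ.im| < τ / 2) :
    HasDerivAt (trigSeries A ε)
      (∑' m : ℤ, Complex.I * (2 * m + ε) * A m * Complex.exp (Complex.I * (2 * m + ε) * θ)) θ := by
  set b := (|θ.im| + τ / 2) / 2 with hb
  have hb1 : |θ.im| < b := by linarith
  have hb2 : b < τ / 2 := by linarith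
  have hr : Real.exp (2 * b - τ) < 1 := by
    rw [Real.exp_lt_one_iff]
    linarith
  have hu := (summable_mul_pow_natAbs (Real.exp_pos _).le hr).mul_left (C * Real.exp b)
  have hball : ∀ z ∈ Metric.ball θ (b - |θ.im|), |z.im| ≤ b := by
    intro z hz
    have h1 := Complex.abs_im_le_norm (z - θ)
    rw [Metric.mem_ball, dist_eq_norm] at hz
    rw [Complex.sub_im] at h1
    have h2 := abs_add_le (z.im - θ.im) θ.im
    rw [sub_add_cancel] at h2
    linarith
  refine hasDerivAt_tsum_of_isPreconnected
    (g := fun (m : ℤ) (z : ℂ) => (A m : ℂ) * Complex.exp (Complex.I * (2 * m + ε) * z))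
    (g' := fun (m : ℤ) (z : ℂ) =>
      Complex.I * (2 * m + ε) * A m * Complex.exp (Complex.I * (2 * m + ε) * z))
    (y₀ := θ) (y := θ) hu Metric.isOpen_ball
    (convex_ball θ (b - |θ.im|)).isPreconnected (fun m z _ => ?_) (fun m z hz => ?_)
    (Metric.mem_ball_self (sub_pos.2 hb1)) (summable_trigSeries hε hA hθ).of_norm
    (Metric.mem_ball_self (sub_pos.2 hb1))
  · have h := (((hasDerivAt_id z).const_mul (Complex.I * (2 * m + ε))).cexp).const_mul (A m : ℂ)
    refine h.congr_deriv ?_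
    simp only [id, mul_one]
    ring
  · have h1 := norm_trig_term_le hε hA (hball z hz) m
    have h2 : ‖Complex.I * (2 * (m : ℂ) + ε)‖ ≤ 2 * (m.natAbs : ℝ) + 1 := by
      have h3 : (2 * (m : ℂ) + ε) = ((2 * m + ε : ℝ) : ℂ) := by push_cast; ring
      rw [norm_mul, Complex.norm_I, one_mul, h3, Complex.norm_real, Real.norm_eq_abs]
      refine (abs_add_le _ _).trans (add_le_add ?_ hε)
      rw [abs_mul, abs_two, Nat.cast_natAbs, Int.cast_abs]
    rw [mul_assoc, norm_mul]
    calc _ ≤ (2 * (m.natAbs : ℝ) + 1) * (C * Real.exp b * Real.exp (2 * b - τ) ^ m.natAbs) := by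
          gcongr
      _ = _ := by ring

/-- The product of two series is given by the convolution of the coefficients. It suffices to know
the convolution as a function of the index. -/
lemma trigSeries_mul_trigSeries (hε : |(ε : ℝ)| ≤ 1) (hδ : |(δ : ℝ)| ≤ 1)
    (hA : ∀ m, |A m| ≤ C * Real.exp (-τ) ^ m.natAbs)
    (hB : ∀ m, |B m| ≤ C' * Real.exp (-τ) ^ m.natAbs) (hθ : |θ.im| < τ / 2)
    {F : ℤ → ℝ} (hF : ∀ n, ∑' j, A (n - j) * B j = F n) :
    trigSeries A ε θ * trigSeries B δ θ = trigSeries F (ε + δ) θ := by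
  rw [trigSeries, trigSeries,
    tsum_mul_tsum_int (summable_trigSeries hε hA hθ) (summable_trigSeries hδ hB hθ), trigSeries]
  refine tsum_congr fun n => ?_
  rw [← hF, Complex.ofReal_tsum, ← tsum_mul_right]
  refine tsum_congr fun j => ?_
  push_cast
  rw [mul_mul_mul_comm, ← Complex.exp_add]
  congr 2
  ring

end TrigSeries

/-! ### Convolutions of hyperbolic functions -/

section Convolution

lemma hasSum_of_eq {f g : ℤ → ℝ} {a b : ℝ} (h : HasSum f a) (hfg : ∀ j, g j = f j) (hab : b = a) :
    HasSum g b :=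
  hab ▸ h.congr_fun hfg

/-- A sign function on `ℤ`, with value `1` at `0`. -/
noncomputable def intSign (a : ℤ) : ℝ := if 0 ≤ a then 1 else -1

/-- In the convolutions below `tanh` and `coth` differ from the sign function by summable terms;
this is the contribution of the signs. -/
lemma hasSum_intSign (n : ℤ) :
    HasSum (fun j => intSign (n - j) + intSign j) (2 * (n + 1)) := by
  have hstep (n : ℤ) : HasSum (fun j => intSign (n + 1 - j) - intSign (n - j)) 2 := by
    convert hasSum_single (n + 1) ?_ using 1
    · rw [intSign, intSign, if_pos (by omega), if_neg (by omega)]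
      norm_num
    · intro j hj
      rw [sub_eq_zero, intSign, intSign]
      congr 1
      rw [eq_iff_iff]
      omega
  induction n using Int.induction_on with
  | zero =>
    refine hasSum_of_eq (hstep (-1)) (fun j => ?_) ?_
    · simp only [intSign]
      split_ifs <;> first | omega | norm_num
    · norm_num
  | succ n ih =>
    have h := ih.add (hstep n)
    refine hasSum_of_eq h (fun j => ?_) ?_
    · ring
    · push_cast
      ring
  | pred n ih =>
    have h := ih.sub (hstep (-(n : ℤ) - 1))
    refine hasSum_of_eq h (fun j => ?_) ?_
    · rw [sub_add_cancel]
      ring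
    · push_cast
      ring

/-- If `f` and `g` differ from the sign function by summable terms, the sum of
`f (n - j) + g j` over `j` is affine in `n`. -/
lemma hasSum_add_of_hasSum_sub_intSign {f g : ℤ → ℝ} {F G : ℝ}
    (hf : HasSum (fun a => f a - intSign a) F) (hg : HasSum (fun a => g a - intSign a) G) (n : ℤ) :
    HasSum (fun j => f (n - j) + g j) (F + G + 2 * (n + 1)) := by
  have h1 := (Equiv.subLeft n).hasSum_iff.2 hf
  refine ((h1.add hg).add (hasSum_intSign n)).congr_fun fun j => ?_
  simp only [Function.comp_apply, Equiv.subLeft_apply]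
  ring

lemma hasSum_zero_of_antisymm {f : ℤ → ℝ} (hf : Summable fun n : ℕ => f n)
    (h : ∀ n : ℕ, f (-(n + 1)) = -f n) : HasSum f 0 := by
  have := hf.hasSum.of_nat_of_neg_add_one (hf.hasSum.neg.congr_fun h)
  rwa [add_neg_cancel] at this

variable {τ : ℝ}

lemma summable_exp_neg_mul (hτ : 0 < τ) : Summable fun n : ℕ => Real.exp (-(τ * n)) := by
  have := summable_geometric_of_lt_one (Real.exp_pos (-τ)).le
    (by rw [Real.exp_lt_one_iff]; linarith)
  refine this.congr fun n => ?_
  rw [← Real.exp_nat_mul]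
  congr 1
  ring

lemma tanh_sub_one (x : ℝ) : Real.sinh x / Real.cosh x - 1 = -(Real.exp (-x) / Real.cosh x) := by
  have := (Real.cosh_pos x).ne'
  rw [← Real.cosh_sub_sinh]
  field_simp
  ring

lemma hasSum_tanh_half (hτ : 0 < τ) :
    HasSum (fun a : ℤ => Real.sinh (τ * (a + 1 / 2)) / Real.cosh (τ * (a + 1 / 2)) - intSign a)
      0 := by
  refine hasSum_zero_of_antisymm ?_ fun n => ?_
  · refine Summable.of_norm_bounded (summable_exp_neg_mul hτ) fun n => ?_
    rw [intSign, if_pos (by omega), tanh_sub_one, norm_neg, Real.norm_of_nonneg (by positivity)]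
    rw [Int.cast_natCast]
    refine (div_le_self (Real.exp_pos _).le (Real.one_le_cosh _)).trans ?_
    rw [Real.exp_le_exp]
    linarith
  · rw [intSign, intSign, if_neg (by omega), if_pos (by omega)]
    push_cast
    rw [show τ * (-((n : ℝ) + 1) + 1 / 2) = -(τ * (n + 1 / 2)) by ring, Real.sinh_neg,
      Real.cosh_neg]
    ring

lemma hasSum_coth_half (hτ : 0 < τ) :
    HasSum (fun a : ℤ => Real.cosh (τ * (a + 1 / 2)) / Real.sinh (τ * (a + 1 / 2)) - intSign a)
      0 := by
  refine hasSum_zero_of_antisymm ?_ fun n => ?_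
  · have hs : 0 < Real.sinh (τ / 2) := Real.sinh_pos_iff.2 (by linarith)
    refine Summable.of_norm_bounded ((summable_exp_neg_mul hτ).mul_right (1 / Real.sinh (τ / 2)))
      fun n => ?_
    rw [Int.cast_natCast]
    have hn : τ / 2 ≤ τ * ((n : ℝ) + 1 / 2) := by
      have : 0 ≤ τ * n := by positivity
      linarith
    have hs' : Real.sinh (τ / 2) ≤ Real.sinh (τ * ((n : ℝ) + 1 / 2)) := Real.sinh_le_sinh.2 hn
    have e : Real.cosh (τ * ((n : ℝ) + 1 / 2)) / Real.sinh (τ * ((n : ℝ) + 1 / 2)) - 1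
        = Real.exp (-(τ * ((n : ℝ) + 1 / 2))) * (1 / Real.sinh (τ * ((n : ℝ) + 1 / 2))) := by
      rw [← Real.cosh_sub_sinh]
      have := (hs.trans_le hs').ne'
      field_simp
    rw [intSign, if_pos (by omega), e,
      Real.norm_of_nonneg (mul_nonneg (Real.exp_pos _).le (one_div_nonneg.2 (hs.trans_le hs').le))]
    gcongr
    linarith
  · rw [intSign, intSign, if_neg (by omega), if_pos (by omega)]
    push_cast
    rw [show τ * (-((n : ℝ) + 1) + 1 / 2) = -(τ * (n + 1 / 2)) by ring, Real.sinh_neg,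
      Real.cosh_neg]
    ring

lemma hasSum_tanh (hτ : 0 < τ) :
    HasSum (fun a : ℤ => Real.sinh (τ * a) / Real.cosh (τ * a) - intSign a) (-1) := by
  have hs : Summable fun n : ℕ => Real.sinh (τ * n) / Real.cosh (τ * n) - 1 := by
    refine Summable.of_norm_bounded (summable_exp_neg_mul hτ) fun n => ?_
    rw [tanh_sub_one, norm_neg, Real.norm_of_nonneg (by positivity)]
    exact div_le_self (Real.exp_pos _).le (Real.one_le_cosh _)
  have h1 := hs.hasSum
  have h2 := ((hasSum_nat_add_iff' 1).2 h1).neg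
  have h3 := HasSum.of_nat_of_neg_add_one
    (f := fun a : ℤ => Real.sinh (τ * a) / Real.cosh (τ * a) - intSign a)
    (h1.congr_fun fun n => by simp [intSign])
    (h2.congr_fun fun n => by
      rw [intSign, if_neg (by omega)]
      push_cast
      rw [show τ * (-((n : ℝ) + 1)) = -(τ * (n + 1)) by ring, Real.sinh_neg, Real.cosh_neg]
      ring)
  refine hasSum_of_eq h3 (fun j => rfl) ?_
  simp

/-- For a fixed sum of the arguments the product is, up to a constant factor, a sum of two values of
`tanh`. -/
lemma sech_mul_sech {x y : ℝ} (h : Real.sinh (x + y) ≠ 0) :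
    1 / (2 * Real.cosh x) * (1 / (2 * Real.cosh y))
      = (Real.sinh x / Real.cosh x + Real.sinh y / Real.cosh y) *
        (1 / (4 * Real.sinh (x + y))) := by
  have h1 := (Real.cosh_pos x).ne'
  have h2 := (Real.cosh_pos y).ne'
  have e : Real.sinh x / Real.cosh x + Real.sinh y / Real.cosh y
      = Real.sinh (x + y) / (Real.cosh x * Real.cosh y) := by
    rw [Real.sinh_add]
    field_simp
  rw [e]
  generalize Real.sinh (x + y) = s at *
  field_simp
  norm_num

lemma sech_mul_csch {x y : ℝ} (h : Real.sinh y ≠ 0) :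
    1 / (2 * Real.cosh x) * (1 / (2 * Real.sinh y))
      = (Real.sinh x / Real.cosh x + Real.cosh y / Real.sinh y) *
        (1 / (4 * Real.cosh (x + y))) := by
  have h1 := (Real.cosh_pos x).ne'
  have h2 := (Real.cosh_pos (x + y)).ne'
  have e : Real.sinh x / Real.cosh x + Real.cosh y / Real.sinh y
      = Real.cosh (x + y) / (Real.cosh x * Real.sinh y) := by
    rw [Real.cosh_add]
    field_simp
    ring
  rw [e]
  generalize Real.cosh (x + y) = s at *
  field_simp
  norm_num

lemma sinh_half_ne_zero (hτ : 0 < τ) (n : ℤ) : Real.sinh (τ * (n + 1 / 2)) ≠ 0 := by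
  rw [Real.sinh_ne_zero]
  refine mul_ne_zero hτ.ne' fun h0 => ?_
  have : (2 * (n : ℝ) + 1) = 0 := by linarith
  have : (2 * n + 1 : ℤ) = 0 := by exact_mod_cast this
  omega

/-- The convolution of `sech (τ (a + 1/2))` with `sech (τ a)`. -/
lemma hasSum_sech_half_mul_sech (hτ : 0 < τ) (n : ℤ) :
    HasSum (fun j : ℤ => 1 / (2 * Real.cosh (τ * ((n - j : ℤ) + 1 / 2))) *
      (1 / (2 * Real.cosh (τ * j)))) ((2 * n + 1) * (1 / (4 * Real.sinh (τ * (n + 1 / 2))))) := by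
  have h := (hasSum_add_of_hasSum_sub_intSign (hasSum_tanh_half hτ) (hasSum_tanh hτ) n).mul_right
    (1 / (4 * Real.sinh (τ * (n + 1 / 2))))
  refine hasSum_of_eq h (fun j => ?_) (by ring)
  have e : τ * ((n : ℝ) + 1 / 2) = τ * ((n - j : ℤ) + 1 / 2) + τ * j := by
    push_cast
    ring
  rw [sech_mul_sech (e ▸ sinh_half_ne_zero hτ n), ← e]

/-- The convolution of `sech (τ (a + 1/2))` with `csch (τ (a + 1/2))`. -/
lemma hasSum_sech_half_mul_csch_half (hτ : 0 < τ) (n : ℤ) :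
    HasSum (fun j : ℤ => 1 / (2 * Real.cosh (τ * ((n - j : ℤ) + 1 / 2))) *
      (1 / (2 * Real.sinh (τ * (j + 1 / 2)))))
      (2 * (n + 1) * (1 / (4 * Real.cosh (τ * (n + 1))))) := by
  have h := (hasSum_add_of_hasSum_sub_intSign (hasSum_tanh_half hτ)
    (hasSum_coth_half hτ) n).mul_right (1 / (4 * Real.cosh (τ * (n + 1))))
  refine hasSum_of_eq h (fun j => ?_) (by ring)
  have e : τ * ((n : ℝ) + 1) = τ * ((n - j : ℤ) + 1 / 2) + τ * (j + 1 / 2) := by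
    push_cast
    ring
  rw [sech_mul_csch (sinh_half_ne_zero hτ j), ← e]

/-- The convolution of `sech (τ a)` with `csch (τ (a + 1/2))`. -/
lemma hasSum_sech_mul_csch_half (hτ : 0 < τ) (n : ℤ) :
    HasSum (fun j : ℤ => 1 / (2 * Real.cosh (τ * (n - j : ℤ))) *
      (1 / (2 * Real.sinh (τ * (j + 1 / 2)))))
      ((2 * n + 1) * (1 / (4 * Real.cosh (τ * (n + 1 / 2))))) := by
  have h := (hasSum_add_of_hasSum_sub_intSign (hasSum_tanh hτ) (hasSum_coth_half hτ) n).mul_right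
    (1 / (4 * Real.cosh (τ * (n + 1 / 2))))
  refine hasSum_of_eq h (fun j => ?_) (by ring)
  have e : τ * ((n : ℝ) + 1 / 2) = τ * (n - j : ℤ) + τ * (j + 1 / 2) := by
    push_cast
    ring
  rw [sech_mul_csch (sinh_half_ne_zero hτ j), ← e]

end Convolution

/-! ### Fourier series of the Jacobi functions -/

section FourierSeries

open Complex (I exp)

/-- The coefficients `1 / (2 cosh (τ (m + 1/2)))` of the Fourier series of `cn`. -/
noncomputable def cnCoeff (τ : ℝ) (m : ℤ) : ℝ := 1 / (2 * Real.cosh (τ * (m + 1 / 2)))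

/-- The coefficients `1 / (2 cosh (τ m))` of the Fourier series of `dn`. -/
noncomputable def dnCoeff (τ : ℝ) (m : ℤ) : ℝ := 1 / (2 * Real.cosh (τ * m))

/-- The coefficients `1 / (2 sinh (τ (m + 1/2)))` of the Fourier series of `i sn`. -/
noncomputable def snCoeff (τ : ℝ) (m : ℤ) : ℝ := 1 / (2 * Real.sinh (τ * (m + 1 / 2)))

/-- The series `∑ e^{i(2m+1)θ} / (2 cosh (τ (m + 1/2)))`, a multiple of `cn`. -/
noncomputable def cnSeries (τ : ℝ) : ℂ → ℂ := trigSeries (cnCoeff τ) 1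

/-- The series `∑ e^{2imθ} / (2 cosh (τ m))`, a multiple of `dn`. -/
noncomputable def dnSeries (τ : ℝ) : ℂ → ℂ := trigSeries (dnCoeff τ) 0

/-- The series `∑ e^{i(2m+1)θ} / (2 sinh (τ (m + 1/2)))`, a multiple of `i sn`. -/
noncomputable def snSeries (τ : ℝ) : ℂ → ℂ := trigSeries (snCoeff τ) 1

variable {τ : ℝ} {θ : ℂ}

lemma one_div_two_mul_cosh_le (x : ℝ) : 1 / (2 * Real.cosh x) ≤ Real.exp (-|x|) := by
  rw [← Real.cosh_abs x, div_le_iff₀ (by positivity), Real.cosh_eq, Real.exp_neg]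
  have h := Real.exp_pos |x|
  have h2 : 0 < (Real.exp |x|)⁻¹ := by positivity
  field_simp
  nlinarith [sq_nonneg (Real.exp |x|)⁻¹]

lemma cnCoeff_pos (τ : ℝ) (m : ℤ) : 0 < cnCoeff τ m := by
  unfold cnCoeff
  positivity

lemma dnCoeff_pos (τ : ℝ) (m : ℤ) : 0 < dnCoeff τ m := by
  unfold dnCoeff
  positivity

lemma exp_neg_abs_half_le (hτ : 0 < τ) (m : ℤ) :
    Real.exp (-|τ * (m + 1 / 2)|) ≤ Real.exp (τ / 2) * Real.exp (-τ) ^ m.natAbs := by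
  rw [← Real.exp_nat_mul, ← Real.exp_add, Real.exp_le_exp, abs_mul, abs_of_pos hτ]
  have h : (m.natAbs : ℝ) = |(m : ℝ)| := by rw [Nat.cast_natAbs, Int.cast_abs]
  have h1 : |(m : ℝ)| ≤ |(m : ℝ) + 1 / 2| + 1 / 2 := by
    have := abs_sub (m + 1 / 2 : ℝ) (1 / 2)
    rwa [add_sub_cancel_right, abs_of_pos (by norm_num : (0 : ℝ) < 1 / 2)] at this
  rw [h]
  nlinarith

lemma abs_cnCoeff_le (hτ : 0 < τ) (m : ℤ) :
    |cnCoeff τ m| ≤ Real.exp (τ / 2) * Real.exp (-τ) ^ m.natAbs := by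
  rw [abs_of_pos (cnCoeff_pos τ m)]
  exact (one_div_two_mul_cosh_le _).trans (exp_neg_abs_half_le hτ m)

lemma abs_dnCoeff_le (hτ : 0 < τ) (m : ℤ) :
    |dnCoeff τ m| ≤ 1 * Real.exp (-τ) ^ m.natAbs := by
  rw [abs_of_pos (dnCoeff_pos τ m), one_mul]
  refine (one_div_two_mul_cosh_le _).trans (le_of_eq ?_)
  rw [← Real.exp_nat_mul, abs_mul, abs_of_pos hτ, Nat.cast_natAbs, Int.cast_abs]
  congr 1
  ring

lemma abs_snCoeff_le (hτ : 0 < τ) (m : ℤ) :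
    |snCoeff τ m| ≤ (1 - Real.exp (-τ))⁻¹ * Real.exp (τ / 2) * Real.exp (-τ) ^ m.natAbs := by
  have h1 : 0 < 1 - Real.exp (-τ) := by
    rw [sub_pos, Real.exp_lt_one_iff]
    linarith
  set x := τ * ((m : ℝ) + 1 / 2) with hx
  have hx1 : τ / 2 ≤ |x| := by
    have : (1 : ℝ) ≤ |2 * (m : ℝ) + 1| := by
      have : (1 : ℤ) ≤ |2 * m + 1| := Int.one_le_abs (by omega)
      exact_mod_cast this
    have e : x = τ / 2 * (2 * m + 1) := by rw [hx]; ring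
    rw [e, abs_mul, abs_of_pos (by positivity)]
    nlinarith
  have h2 : |snCoeff τ m| = 1 / (2 * Real.sinh |x|) := by
    rw [snCoeff, ← hx, abs_div, abs_one, abs_mul, abs_two, Real.abs_sinh]
  have h3 : (1 - Real.exp (-τ)) * Real.exp |x| ≤ 2 * Real.sinh |x| := by
    rw [Real.sinh_eq]
    have : Real.exp (-|x|) ≤ Real.exp (-τ) * Real.exp |x| := by
      rw [← Real.exp_add, Real.exp_le_exp]
      linarith
    linarith
  have h4 : 0 < (1 - Real.exp (-τ)) * Real.exp |x| := by positivity
  rw [h2, mul_assoc]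
  calc 1 / (2 * Real.sinh |x|) ≤ 1 / ((1 - Real.exp (-τ)) * Real.exp |x|) :=
        one_div_le_one_div_of_le h4 h3
    _ = (1 - Real.exp (-τ))⁻¹ * Real.exp (-|x|) := by
        rw [Real.exp_neg |x|]
        field_simp
    _ ≤ _ := by
        gcongr
        exact exp_neg_abs_half_le hτ m

lemma abs_one_le : |((1 : ℤ) : ℝ)| ≤ 1 := by simp

lemma abs_zero_le : |((0 : ℤ) : ℝ)| ≤ 1 := by simp

lemma summable_cnSeries (hτ : 0 < τ) (hθ : |θ.im| < τ / 2) :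
    Summable fun m : ℤ => ‖(cnCoeff τ m : ℂ) * exp (I * (2 * m + (1 : ℤ)) * θ)‖ :=
  summable_trigSeries abs_one_le (abs_cnCoeff_le hτ) hθ

lemma summable_dnSeries (hτ : 0 < τ) (hθ : |θ.im| < τ / 2) :
    Summable fun m : ℤ => ‖(dnCoeff τ m : ℂ) * exp (I * (2 * m + (0 : ℤ)) * θ)‖ :=
  summable_trigSeries abs_zero_le (abs_dnCoeff_le hτ) hθ

/-- The coefficients of the termwise derivative are the convolution of those of the two factors. -/
lemma hasDerivAt_cnSeries (hτ : 0 < τ) (hθ : |θ.im| < τ / 2) :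
    HasDerivAt (cnSeries τ) (2 * I * (dnSeries τ θ * snSeries τ θ)) θ := by
  refine (hasDerivAt_trigSeries abs_one_le (abs_cnCoeff_le hτ) hθ).congr_deriv ?_
  rw [dnSeries, snSeries, trigSeries_mul_trigSeries abs_zero_le abs_one_le (abs_dnCoeff_le hτ)
    (abs_snCoeff_le hτ) hθ fun n => (hasSum_sech_mul_csch_half hτ n).tsum_eq, trigSeries,
    ← tsum_mul_left]
  refine tsum_congr fun m => ?_
  have := (Real.cosh_pos (τ * ((m : ℝ) + 1 / 2))).ne'
  rw [cnCoeff, zero_add]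
  generalize Real.cosh (τ * ((m : ℝ) + 1 / 2)) = s at *
  have : (s : ℂ) ≠ 0 := by exact_mod_cast this
  push_cast
  field_simp
  norm_num
  ring

lemma hasDerivAt_snSeries (hτ : 0 < τ) (hθ : |θ.im| < τ / 2) :
    HasDerivAt (snSeries τ) (2 * I * (cnSeries τ θ * dnSeries τ θ)) θ := by
  refine (hasDerivAt_trigSeries abs_one_le (abs_snCoeff_le hτ) hθ).congr_deriv ?_
  rw [dnSeries, cnSeries, trigSeries_mul_trigSeries abs_one_le abs_zero_le (abs_cnCoeff_le hτ)
    (abs_dnCoeff_le hτ) hθ fun n => (hasSum_sech_half_mul_sech hτ n).tsum_eq, trigSeries,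
    ← tsum_mul_left]
  refine tsum_congr fun m => ?_
  have := sinh_half_ne_zero hτ m
  rw [snCoeff, add_zero]
  generalize Real.sinh (τ * ((m : ℝ) + 1 / 2)) = s at *
  have : (s : ℂ) ≠ 0 := by exact_mod_cast this
  push_cast
  field_simp
  norm_num
  ring

lemma hasDerivAt_dnSeries (hτ : 0 < τ) (hθ : |θ.im| < τ / 2) :
    HasDerivAt (dnSeries τ) (2 * I * (cnSeries τ θ * snSeries τ θ)) θ := by
  refine (hasDerivAt_trigSeries abs_zero_le (abs_dnCoeff_le hτ) hθ).congr_deriv ?_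
  rw [snSeries, cnSeries, trigSeries_mul_trigSeries abs_one_le abs_one_le (abs_cnCoeff_le hτ)
    (abs_snCoeff_le hτ) hθ fun n => (hasSum_sech_half_mul_csch_half hτ n).tsum_eq, trigSeries,
    ← tsum_mul_left, ← (Equiv.addRight (1 : ℤ)).tsum_eq]
  refine tsum_congr fun m => ?_
  simp only [Equiv.coe_addRight]
  have := (Real.cosh_pos (τ * ((m : ℝ) + 1))).ne'
  have e : I * (2 * ((m + 1 : ℤ) : ℂ) + (0 : ℤ)) * θ = I * (2 * (m : ℂ) + (1 + 1 : ℤ)) * θ := by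
    push_cast
    ring
  rw [e, dnCoeff, Int.cast_add (R := ℝ) m 1, Int.cast_one (R := ℝ)]
  generalize Real.cosh (τ * ((m : ℝ) + 1)) = s at *
  have : (s : ℂ) ≠ 0 := by exact_mod_cast this
  push_cast
  field_simp
  norm_num
  ring

lemma trigSeries_neg {A : ℤ → ℝ} {ε : ℤ} {σ : ℝ} (h : ∀ m, A (-ε - m) = σ * A m) (θ : ℂ) :
    trigSeries A ε (-θ) = σ * trigSeries A ε θ := by
  rw [trigSeries, trigSeries, ← tsum_mul_left, ← (Equiv.subLeft (-ε)).tsum_eq]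
  refine tsum_congr fun m => ?_
  simp only [Equiv.subLeft_apply]
  rw [h]
  push_cast
  rw [mul_assoc]
  congr 3
  ring

lemma conj_trigSeries (A : ℤ → ℝ) (ε : ℤ) (θ : ℂ) :
    starRingEnd ℂ (trigSeries A ε θ) = trigSeries A ε (-starRingEnd ℂ θ) := by
  rw [trigSeries, trigSeries, Complex.conj_tsum]
  refine tsum_congr fun m => ?_
  rw [map_mul, Complex.conj_ofReal, ← Complex.exp_conj]
  congr 2
  simp [map_ofNat]

lemma cnSeries_neg (θ : ℂ) : cnSeries τ (-θ) = cnSeries τ θ := by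
  rw [cnSeries, trigSeries_neg (σ := 1), Complex.ofReal_one, one_mul]
  intro m
  rw [cnCoeff, cnCoeff, one_mul, ← Real.cosh_neg]
  push_cast
  ring_nf

lemma dnSeries_neg (θ : ℂ) : dnSeries τ (-θ) = dnSeries τ θ := by
  rw [dnSeries, trigSeries_neg (σ := 1), Complex.ofReal_one, one_mul]
  intro m
  rw [dnCoeff, dnCoeff, one_mul, ← Real.cosh_neg]
  push_cast
  ring_nf

lemma snSeries_neg (θ : ℂ) : snSeries τ (-θ) = -snSeries τ θ := by
  rw [snSeries, trigSeries_neg (σ := -1), Complex.ofReal_neg, Complex.ofReal_one, neg_one_mul]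
  intro m
  rw [snCoeff, snCoeff, neg_one_mul, ← div_neg, ← mul_neg, ← Real.sinh_neg]
  push_cast
  ring_nf

lemma snSeries_zero : snSeries τ 0 = 0 := by
  have h := snSeries_neg (τ := τ) 0
  rw [neg_zero] at h
  exact CharZero.eq_neg_self_iff.1 h

lemma conj_cnSeries (θ : ℂ) : starRingEnd ℂ (cnSeries τ θ) = cnSeries τ (starRingEnd ℂ θ) := by
  rw [← cnSeries_neg (starRingEnd ℂ θ)]
  exact conj_trigSeries _ _ _

lemma conj_dnSeries (θ : ℂ) : starRingEnd ℂ (dnSeries τ θ) = dnSeries τ (starRingEnd ℂ θ) := by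
  rw [← dnSeries_neg (starRingEnd ℂ θ)]
  exact conj_trigSeries _ _ _

lemma conj_snSeries (θ : ℂ) : starRingEnd ℂ (snSeries τ θ) = -snSeries τ (starRingEnd ℂ θ) := by
  rw [← snSeries_neg (starRingEnd ℂ θ)]
  exact conj_trigSeries _ _ _

lemma eq_of_hasDerivAt_zero_of_strip {f : ℂ → ℂ} {b : ℝ}
    (hf : ∀ θ : ℂ, |θ.im| < b → HasDerivAt f 0 θ) (hθ : |θ.im| < b) : f θ = f 0 := by
  have e : {θ : ℂ | |θ.im| < b} = Complex.imCLM ⁻¹' Metric.ball 0 b := by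
    ext z
    simp
  have ho : IsOpen {θ : ℂ | |θ.im| < b} := e ▸ Metric.isOpen_ball.preimage Complex.imCLM.continuous
  have hc : Convex ℝ {θ : ℂ | |θ.im| < b} :=
    e ▸ (convex_ball (0 : ℝ) b).linear_preimage Complex.imCLM.toLinearMap
  refine ho.is_const_of_deriv_eq_zero hc.isPreconnected
    (fun z hz => (hf z hz).differentiableAt.differentiableWithinAt)
    (fun z hz => (hf z hz).deriv) hθ ?_
  have := abs_nonneg θ.im
  simp only [Set.mem_ofPred_eq, Complex.zero_im, abs_zero]
  linarith

/-- A first integral of the differential system. -/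
lemma dnSeries_sq_sub (hτ : 0 < τ) (hθ : |θ.im| < τ / 2) :
    dnSeries τ θ ^ 2 - cnSeries τ θ ^ 2 = dnSeries τ 0 ^ 2 - cnSeries τ 0 ^ 2 := by
  refine eq_of_hasDerivAt_zero_of_strip (f := fun z => dnSeries τ z ^ 2 - cnSeries τ z ^ 2)
    (fun z hz => ?_) hθ
  refine (((hasDerivAt_dnSeries hτ hz).pow 2).sub
    ((hasDerivAt_cnSeries hτ hz).pow 2)).congr_deriv ?_
  push_cast
  ring

/-- A first integral of the differential system. -/
lemma cnSeries_sq_sub (hτ : 0 < τ) (hθ : |θ.im| < τ / 2) :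
    cnSeries τ θ ^ 2 - snSeries τ θ ^ 2 = cnSeries τ 0 ^ 2 := by
  rw [eq_of_hasDerivAt_zero_of_strip (f := fun z => cnSeries τ z ^ 2 - snSeries τ z ^ 2)
    (fun z hz => ?_) hθ, snSeries_zero]
  · ring
  · refine (((hasDerivAt_cnSeries hτ hz).pow 2).sub
      ((hasDerivAt_snSeries hτ hz).pow 2)).congr_deriv ?_
    push_cast
    ring

end FourierSeries

/-! ### The Fourier series as quotients of theta series -/

section Quotients

open Complex (I exp)

variable {τ : ℝ} {θ : ℂ}

lemma norm_exp_neg (τ : ℝ) : ‖exp (-(τ : ℂ))‖ = Real.exp (-τ) := by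
  rw [Complex.norm_exp]
  simp

lemma norm_exp_neg_lt_one (hτ : 0 < τ) : ‖exp (-(τ : ℂ))‖ < 1 := by
  rw [norm_exp_neg, Real.exp_lt_one_iff]
  linarith

lemma norm_exp_neg_sq_lt (hθ : |θ.im| < τ / 2) :
    ‖exp (-(τ : ℂ)) ^ 2‖ < ‖exp (-τ + 2 * I * θ)‖ ∧ ‖exp (-τ + 2 * I * θ)‖ < 1 := by
  have h := abs_lt.1 hθ
  rw [norm_pow, norm_exp_neg, ← Real.exp_nat_mul, Complex.norm_exp, Real.exp_lt_exp,
    Real.exp_lt_one_iff]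
  simp only [Complex.add_re, Complex.neg_re, Complex.ofReal_re, Complex.mul_re, Complex.mul_im,
    Complex.I_re, Complex.I_im, Complex.re_ofNat, Complex.im_ofNat]
  push_cast
  constructor <;> linarith

lemma cnSeries_eq_kroneckerSeries (τ : ℝ) (θ : ℂ) :
    cnSeries τ θ = exp (-τ / 2 + I * θ) *
      kroneckerSeries (exp (-τ) ^ 2) (-exp (-τ)) (exp (-τ + 2 * I * θ)) := by
  rw [cnSeries, trigSeries, kroneckerSeries, ← tsum_mul_left]
  refine tsum_congr fun m => ?_
  have h1 : exp (-(τ : ℂ)) * (exp (-(τ : ℂ)) ^ 2) ^ m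
      = exp (-(τ * (m + 1 / 2))) * exp (-(τ * (m + 1 / 2))) := by
    rw [← Complex.exp_nat_mul, ← Complex.exp_int_mul, ← Complex.exp_add, ← Complex.exp_add]
    congr 1
    push_cast
    ring
  have h2 : exp (I * (2 * m + (1 : ℤ)) * θ) * exp (-(τ * (m + 1 / 2)))
      = exp (-τ / 2 + I * θ) * exp (-τ + 2 * I * θ) ^ m := by
    rw [← Complex.exp_int_mul, ← Complex.exp_add, ← Complex.exp_add]
    congr 1
    push_cast
    ring
  have h3 : Complex.cosh (τ * (m + 1 / 2)) ≠ 0 := by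
    have := Complex.ofReal_ne_zero.2 (Real.cosh_pos (τ * (m + 1 / 2))).ne'
    push_cast at this
    exact this
  have h4 : 2 * Complex.cosh (τ * (m + 1 / 2)) * exp (-(τ * (m + 1 / 2)))
      = 1 + exp (-(τ * (m + 1 / 2))) * exp (-(τ * (m + 1 / 2))) := by
    rw [Complex.cosh, mul_div_cancel₀ _ two_ne_zero, add_mul, ← Complex.exp_add,
      add_neg_cancel, Complex.exp_zero]
  have h5 := Complex.exp_ne_zero (-(τ * (m + 1 / 2)))
  rw [neg_mul, sub_neg_eq_add, h1, ← h4, ← mul_div_assoc, ← h2, cnCoeff]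
  push_cast
  field_simp

lemma dnSeries_eq_kroneckerSeries (τ : ℝ) (θ : ℂ) :
    dnSeries τ θ = kroneckerSeries (exp (-τ) ^ 2) (-1) (exp (-τ + 2 * I * θ)) := by
  rw [dnSeries, trigSeries, kroneckerSeries]
  refine tsum_congr fun m => ?_
  have h1 : (exp (-(τ : ℂ)) ^ 2) ^ m = exp (-(τ * m)) * exp (-(τ * m)) := by
    rw [← Complex.exp_nat_mul, ← Complex.exp_int_mul, ← Complex.exp_add]
    congr 1
    push_cast
    ring
  have h2 : exp (I * (2 * m + (0 : ℤ)) * θ) * exp (-(τ * m)) = exp (-τ + 2 * I * θ) ^ m := by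
    rw [← Complex.exp_int_mul, ← Complex.exp_add]
    congr 1
    push_cast
    ring
  have h3 : Complex.cosh (τ * m) ≠ 0 := by
    have := (Real.cosh_pos (τ * m)).ne'
    exact_mod_cast this
  have h4 : 2 * Complex.cosh (τ * m) * exp (-(τ * m)) = 1 + exp (-(τ * m)) * exp (-(τ * m)) := by
    rw [Complex.cosh, mul_div_cancel₀ _ two_ne_zero, add_mul, ← Complex.exp_add,
      add_neg_cancel, Complex.exp_zero]
  have h5 := Complex.exp_ne_zero (-(τ * m))
  rw [neg_one_mul, sub_neg_eq_add, h1, ← h4, ← h2, dnCoeff]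
  push_cast
  field_simp

lemma neg_ofReal_mul_zpow_ne_one {a b : ℝ} (ha : 0 < a) (hb : 0 < b) (m : ℤ) :
    -(a : ℂ) * (b : ℂ) ^ m ≠ 1 := by
  have : (0 : ℝ) < a * b ^ m := by positivity
  have h : -(a * b ^ m) ≠ 1 := by linarith
  rw [neg_mul]
  exact_mod_cast h

lemma exp_neg_eq_ofReal (τ : ℝ) : exp (-(τ : ℂ)) = (Real.exp (-τ) : ℝ) := by
  push_cast
  rfl

lemma neg_exp_neg_mul_zpow_ne_one (τ : ℝ) (m : ℤ) :
    -exp (-(τ : ℂ)) * (exp (-(τ : ℂ)) ^ 2) ^ m ≠ 1 := by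
  rw [exp_neg_eq_ofReal, ← Complex.ofReal_pow]
  exact neg_ofReal_mul_zpow_ne_one (Real.exp_pos _) (by positivity) m

lemma neg_one_mul_zpow_ne_one (τ : ℝ) (m : ℤ) :
    -1 * (exp (-(τ : ℂ)) ^ 2) ^ m ≠ 1 := by
  rw [exp_neg_eq_ofReal, ← Complex.ofReal_pow, ← Complex.ofReal_one]
  exact neg_ofReal_mul_zpow_ne_one one_pos (by positivity) m

lemma cnSeries_mul_thetaSeries (hθ : |θ.im| < τ / 2) :
    cnSeries τ θ * (thetaSeries (exp (-τ)) (-exp (-τ)) *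
        thetaSeries (exp (-τ)) (exp (-τ + 2 * I * θ)))
      = exp (-τ / 2 + I * θ) * (cqFactorial (exp (-τ) ^ 2) (exp (-τ) ^ 2) ^ 3 *
        thetaSeries (exp (-τ)) (-exp (-τ) * exp (-τ + 2 * I * θ))) := by
  have h := norm_exp_neg_sq_lt hθ
  rw [cnSeries_eq_kroneckerSeries, mul_assoc,
    kroneckerSeries_mul (Complex.exp_ne_zero _) (neg_ne_zero.2 (Complex.exp_ne_zero _))
      (neg_exp_neg_mul_zpow_ne_one τ) h.1 h.2]

lemma dnSeries_mul_thetaSeries (hθ : |θ.im| < τ / 2) :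
    dnSeries τ θ * (thetaSeries (exp (-τ)) (-1) *
        thetaSeries (exp (-τ)) (exp (-τ + 2 * I * θ)))
      = cqFactorial (exp (-τ) ^ 2) (exp (-τ) ^ 2) ^ 3 *
        thetaSeries (exp (-τ)) (-exp (-τ + 2 * I * θ)) := by
  have h := norm_exp_neg_sq_lt hθ
  rw [dnSeries_eq_kroneckerSeries,
    kroneckerSeries_mul (Complex.exp_ne_zero _) (neg_ne_zero.2 one_ne_zero)
      (neg_one_mul_zpow_ne_one τ) h.1 h.2, neg_one_mul]

lemma thetaSeries_neg_ne_zero (hτ : 0 < τ) :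
    thetaSeries (exp (-τ)) (-exp (-τ)) ≠ 0 :=
  thetaSeries_ne_zero (Complex.exp_ne_zero _) (norm_exp_neg_lt_one hτ)
    (neg_ne_zero.2 (Complex.exp_ne_zero _)) (neg_exp_neg_mul_zpow_ne_one τ)

/-- At `θ = π/2` the theta series in the numerator is evaluated at a zero. -/
lemma cnSeries_pi_div_two (hτ : 0 < τ) : cnSeries τ ((Real.pi / 2 : ℝ) : ℂ) = 0 := by
  have hθ : |(((Real.pi / 2 : ℝ) : ℂ)).im| < τ / 2 := by
    rw [Complex.ofReal_im, abs_zero]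
    positivity
  have h := cnSeries_mul_thetaSeries hθ
  have e : exp (-τ + 2 * I * ((Real.pi / 2 : ℝ) : ℂ)) = -exp (-τ) := by
    rw [Complex.exp_add, show 2 * I * ((Real.pi / 2 : ℝ) : ℂ) = Real.pi * I by push_cast; ring,
      Complex.exp_pi_mul_I]
    ring
  have e2 : -exp (-τ) * -exp (-τ) = exp (-(τ : ℂ)) ^ 2 * 1 := by ring
  have h0 := thetaSeries_neg_ne_zero hτ
  rw [e, e2, thetaSeries_sq_mul (Complex.exp_ne_zero _) one_ne_zero,
    thetaSeries_one (Complex.exp_ne_zero _) (norm_exp_neg_lt_one hτ), mul_zero, mul_zero,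
    mul_zero] at h
  exact (mul_eq_zero.1 h).resolve_right (mul_ne_zero h0 h0)

lemma dnSeries_pi_div_two_ne_zero (hτ : 0 < τ) : dnSeries τ ((Real.pi / 2 : ℝ) : ℂ) ≠ 0 := by
  have hθ : |(((Real.pi / 2 : ℝ) : ℂ)).im| < τ / 2 := by
    rw [Complex.ofReal_im, abs_zero]
    positivity
  have h := dnSeries_mul_thetaSeries hθ
  have e : -exp (-τ + 2 * I * ((Real.pi / 2 : ℝ) : ℂ)) = exp (-τ) := by
    rw [Complex.exp_add, show 2 * I * ((Real.pi / 2 : ℝ) : ℂ) = Real.pi * I by push_cast; ring,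
      Complex.exp_pi_mul_I]
    ring
  intro h0
  rw [h0, zero_mul, e] at h
  refine mul_ne_zero (pow_ne_zero 3 (cqFactorial_self_ne_zero
    (norm_sq_lt_one (norm_exp_neg_lt_one hτ)))) (thetaSeries_ne_zero (Complex.exp_ne_zero _)
    (norm_exp_neg_lt_one hτ) (Complex.exp_ne_zero _) fun n h1 => ?_) h.symm
  have h2 : Real.exp (-τ) * (Real.exp (-τ) ^ 2) ^ n = 1 := by
    rw [exp_neg_eq_ofReal] at h1
    exact_mod_cast h1
  rw [← Real.exp_nat_mul, ← Real.rpow_intCast, ← Real.exp_mul, ← Real.exp_add,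
    Real.exp_eq_one_iff] at h2
  have h3 : τ * (1 + 2 * n : ℤ) = 0 := by
    push_cast at h2 ⊢
    linarith
  have h4 := (mul_eq_zero.1 h3).resolve_left hτ.ne'
  have : (1 + 2 * n : ℤ) = 0 := by exact_mod_cast h4
  omega

lemma cnSeries_ne_zero (hτ : 0 < τ) {t : ℝ} (ht0 : 0 ≤ t) (ht : t < Real.pi / 2) :
    cnSeries τ t ≠ 0 := by
  have hθ : |(t : ℂ).im| < τ / 2 := by
    rw [Complex.ofReal_im, abs_zero]
    positivity
  have h := cnSeries_mul_thetaSeries hθ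
  intro h0
  rw [h0, zero_mul] at h
  refine mul_ne_zero (Complex.exp_ne_zero _) (mul_ne_zero (pow_ne_zero 3 (cqFactorial_self_ne_zero
    (norm_sq_lt_one (norm_exp_neg_lt_one hτ)))) (thetaSeries_ne_zero (Complex.exp_ne_zero _)
    (norm_exp_neg_lt_one hτ) (mul_ne_zero (neg_ne_zero.2 (Complex.exp_ne_zero _))
      (Complex.exp_ne_zero _)) fun n h1 => ?_)) h.symm
  have e : -exp (-τ) * exp (-τ + 2 * I * t) * (exp (-(τ : ℂ)) ^ 2) ^ n
      = -((Real.exp (-2 * τ - 2 * τ * n) : ℝ) * exp ((2 * t : ℝ) * I)) := by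
    rw [← Complex.exp_nat_mul, ← Complex.exp_int_mul, neg_mul, neg_mul, ← Complex.exp_add,
      ← Complex.exp_add, Complex.ofReal_exp, ← Complex.exp_add]
    congr 2
    push_cast
    ring
  have hr := Real.exp_pos (-2 * τ - 2 * τ * n)
  rw [e] at h1
  generalize Real.exp (-2 * τ - 2 * τ * n) = r at *
  have him := congrArg Complex.im h1
  have hre := congrArg Complex.re h1
  rw [Complex.neg_im, Complex.im_ofReal_mul, Complex.exp_ofReal_mul_I_im, Complex.one_im,
    Real.sin_two_mul] at him
  rw [Complex.neg_re, Complex.re_ofReal_mul, Complex.exp_ofReal_mul_I_re, Complex.one_re,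
    Real.cos_two_mul'] at hre
  have hc : 0 < Real.cos t := Real.cos_pos_of_mem_Ioo ⟨by linarith [Real.pi_pos], ht⟩
  have hs : Real.sin t = 0 := by
    have : r * Real.cos t * Real.sin t = 0 := by linarith
    exact (mul_eq_zero.1 this).resolve_left (by positivity)
  rw [hs] at hre
  have : 0 < r * Real.cos t ^ 2 := by positivity
  nlinarith

end Quotients

/-! ### The modulus with a given nome -/

section Modulus

open Complex (I exp)

variable {τ : ℝ}

/-- The restriction of `cnSeries` to the real axis, where it is real. -/
noncomputable def cnReal (τ t : ℝ) : ℝ := (cnSeries τ t).re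

/-- The restriction of `dnSeries` to the real axis, where it is real. -/
noncomputable def dnReal (τ t : ℝ) : ℝ := (dnSeries τ t).re

/-- The restriction of `-i snSeries` to the real axis, where it is real. -/
noncomputable def snReal (τ t : ℝ) : ℝ := (snSeries τ t).im

/-- The restriction of `cnSeries` to the imaginary axis, where it is real. -/
noncomputable def cnImag (τ y : ℝ) : ℝ := (cnSeries τ (I * y)).re

/-- The restriction of `dnSeries` to the imaginary axis, where it is real. -/
noncomputable def dnImag (τ y : ℝ) : ℝ := (dnSeries τ (I * y)).re

/-- The restriction of `-snSeries` to the imaginary axis, where it is real. -/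
noncomputable def snImag (τ y : ℝ) : ℝ := -(snSeries τ (I * y)).re

lemma ofReal_cnReal (τ t : ℝ) : (cnReal τ t : ℂ) = cnSeries τ t :=
  Complex.conj_eq_iff_re.1 (by rw [conj_cnSeries, Complex.conj_ofReal])

lemma ofReal_dnReal (τ t : ℝ) : (dnReal τ t : ℂ) = dnSeries τ t :=
  Complex.conj_eq_iff_re.1 (by rw [conj_dnSeries, Complex.conj_ofReal])

lemma ofReal_snReal (τ t : ℝ) : I * (snReal τ t : ℂ) = snSeries τ t := by
  have h := conj_snSeries (τ := τ) t
  rw [Complex.conj_ofReal] at h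
  have h1 := congrArg Complex.re h
  rw [Complex.conj_re, Complex.neg_re] at h1
  apply Complex.ext
  · simp only [Complex.mul_re, Complex.I_re, Complex.I_im, Complex.ofReal_re, Complex.ofReal_im]
    linarith
  · simp [snReal]

lemma ofReal_cnImag (τ y : ℝ) : (cnImag τ y : ℂ) = cnSeries τ (I * y) :=
  Complex.conj_eq_iff_re.1 (by
    rw [conj_cnSeries, map_mul, Complex.conj_ofReal, Complex.conj_I, neg_mul, cnSeries_neg])

lemma ofReal_dnImag (τ y : ℝ) : (dnImag τ y : ℂ) = dnSeries τ (I * y) :=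
  Complex.conj_eq_iff_re.1 (by
    rw [conj_dnSeries, map_mul, Complex.conj_ofReal, Complex.conj_I, neg_mul, dnSeries_neg])

lemma ofReal_snImag (τ y : ℝ) : -(snImag τ y : ℂ) = snSeries τ (I * y) := by
  rw [snImag, Complex.ofReal_neg, neg_neg]
  exact Complex.conj_eq_iff_re.1 (by
    rw [conj_snSeries, map_mul, Complex.conj_ofReal, Complex.conj_I, neg_mul, snSeries_neg,
      neg_neg])

lemma abs_im_ofReal_lt (hτ : 0 < τ) (t : ℝ) : |(t : ℂ).im| < τ / 2 := by
  rw [Complex.ofReal_im, abs_zero]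
  positivity

lemma abs_im_I_mul_lt {y : ℝ} (hy : |y| < τ / 2) : |(I * (y : ℂ)).im| < τ / 2 := by
  simpa using hy

lemma hasDerivAt_cnReal (hτ : 0 < τ) (t : ℝ) :
    HasDerivAt (cnReal τ) (-(2 * (dnReal τ t * snReal τ t))) t := by
  refine (hasDerivAt_cnSeries hτ (abs_im_ofReal_lt hτ t)).real_of_complex.congr_deriv ?_
  rw [← ofReal_dnReal, ← ofReal_snReal]
  simp [Complex.mul_re, Complex.mul_im]

lemma hasDerivAt_dnReal (hτ : 0 < τ) (t : ℝ) :
    HasDerivAt (dnReal τ) (-(2 * (cnReal τ t * snReal τ t))) t := by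
  refine (hasDerivAt_dnSeries hτ (abs_im_ofReal_lt hτ t)).real_of_complex.congr_deriv ?_
  rw [← ofReal_cnReal, ← ofReal_snReal]
  simp [Complex.mul_re, Complex.mul_im]

lemma hasDerivAt_snReal (hτ : 0 < τ) (t : ℝ) :
    HasDerivAt (snReal τ) (2 * (cnReal τ t * dnReal τ t)) t := by
  have h := ((hasDerivAt_snSeries hτ (abs_im_ofReal_lt hτ t)).const_mul (-I)).real_of_complex
  have e : (fun x : ℝ => (-I * snSeries τ x).re) = snReal τ := by
    funext x
    simp [snReal]
  rw [e] at h
  refine h.congr_deriv ?_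
  rw [← ofReal_cnReal, ← ofReal_dnReal]
  simp [Complex.mul_re, Complex.mul_im]

lemma hasDerivAt_cnImag (hτ : 0 < τ) {y : ℝ} (hy : |y| < τ / 2) :
    HasDerivAt (cnImag τ) (2 * (dnImag τ y * snImag τ y)) y := by
  have h := (HasDerivAt.comp (y : ℂ) (hasDerivAt_cnSeries hτ (abs_im_I_mul_lt hy))
    ((hasDerivAt_id (y : ℂ)).const_mul I)).real_of_complex
  refine h.congr_deriv ?_
  rw [← ofReal_dnImag, ← ofReal_snImag]
  simp [Complex.mul_re, Complex.mul_im]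

lemma hasDerivAt_dnImag (hτ : 0 < τ) {y : ℝ} (hy : |y| < τ / 2) :
    HasDerivAt (dnImag τ) (2 * (cnImag τ y * snImag τ y)) y := by
  have h := (HasDerivAt.comp (y : ℂ) (hasDerivAt_dnSeries hτ (abs_im_I_mul_lt hy))
    ((hasDerivAt_id (y : ℂ)).const_mul I)).real_of_complex
  refine h.congr_deriv ?_
  rw [← ofReal_cnImag, ← ofReal_snImag]
  simp [Complex.mul_re, Complex.mul_im]

lemma hasDerivAt_snImag (hτ : 0 < τ) {y : ℝ} (hy : |y| < τ / 2) :
    HasDerivAt (snImag τ) (2 * (cnImag τ y * dnImag τ y)) y := by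
  have h := (HasDerivAt.comp (y : ℂ) (hasDerivAt_snSeries hτ (abs_im_I_mul_lt hy))
    ((hasDerivAt_id (y : ℂ)).const_mul I)).real_of_complex.neg
  refine h.congr_deriv ?_
  rw [← ofReal_cnImag, ← ofReal_dnImag]
  simp [Complex.mul_re, Complex.mul_im]

lemma cnReal_sq_add (hτ : 0 < τ) (t : ℝ) : cnReal τ t ^ 2 + snReal τ t ^ 2 = cnReal τ 0 ^ 2 := by
  have h := cnSeries_sq_sub hτ (abs_im_ofReal_lt hτ t)
  rw [← Complex.ofReal_zero, ← ofReal_cnReal, ← ofReal_cnReal, ← ofReal_snReal, mul_pow,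
    Complex.I_sq] at h
  have : (cnReal τ t : ℂ) ^ 2 + (snReal τ t : ℂ) ^ 2 = (cnReal τ 0 : ℂ) ^ 2 := by
    linear_combination h
  exact_mod_cast this

lemma dnReal_sq_sub (hτ : 0 < τ) (t : ℝ) :
    dnReal τ t ^ 2 - cnReal τ t ^ 2 = dnReal τ 0 ^ 2 - cnReal τ 0 ^ 2 := by
  have h := dnSeries_sq_sub hτ (abs_im_ofReal_lt hτ t)
  rw [← Complex.ofReal_zero, ← ofReal_cnReal, ← ofReal_cnReal, ← ofReal_dnReal,
    ← ofReal_dnReal] at h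
  exact_mod_cast h

lemma cnImag_sq_sub (hτ : 0 < τ) {y : ℝ} (hy : |y| < τ / 2) :
    cnImag τ y ^ 2 - snImag τ y ^ 2 = cnReal τ 0 ^ 2 := by
  have h := cnSeries_sq_sub hτ (abs_im_I_mul_lt hy)
  rw [← Complex.ofReal_zero, ← ofReal_cnReal, ← ofReal_cnImag, ← ofReal_snImag, neg_sq] at h
  exact_mod_cast h

lemma dnImag_sq_sub (hτ : 0 < τ) {y : ℝ} (hy : |y| < τ / 2) :
    dnImag τ y ^ 2 - cnImag τ y ^ 2 = dnReal τ 0 ^ 2 - cnReal τ 0 ^ 2 := by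
  have h := dnSeries_sq_sub hτ (abs_im_I_mul_lt hy)
  rw [← Complex.ofReal_zero, ← ofReal_cnReal, ← ofReal_cnImag, ← ofReal_dnReal,
    ← ofReal_dnImag] at h
  exact_mod_cast h

lemma hasSum_cnImag (hτ : 0 < τ) {y : ℝ} (hy : |y| < τ / 2) :
    HasSum (fun m : ℤ => cnCoeff τ m * Real.exp (-((2 * m + 1) * y))) (cnImag τ y) := by
  have h := (summable_cnSeries hτ (abs_im_I_mul_lt hy)).of_norm.hasSum
  refine (Complex.hasSum_re h).congr_fun fun m => ?_
  have e : I * (2 * (m : ℂ) + (1 : ℤ)) * (I * (y : ℂ)) = ((-((2 * m + 1) * y) : ℝ) : ℂ) := by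
    push_cast
    linear_combination (2 * (m : ℂ) + 1) * y * Complex.I_sq
  rw [e, ← Complex.ofReal_exp, ← Complex.ofReal_mul, Complex.ofReal_re]

lemma cnImag_pos (hτ : 0 < τ) {y : ℝ} (hy : |y| < τ / 2) : 0 < cnImag τ y := by
  have h := hasSum_cnImag hτ hy
  rw [← h.tsum_eq]
  exact h.summable.tsum_pos (fun m => (mul_pos (cnCoeff_pos τ m) (Real.exp_pos _)).le) 0
    (mul_pos (cnCoeff_pos τ 0) (Real.exp_pos _))

lemma hasSum_dnReal_zero (hτ : 0 < τ) : HasSum (dnCoeff τ) (dnReal τ 0) := by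
  have h := (summable_dnSeries hτ (abs_im_ofReal_lt hτ 0)).of_norm.hasSum
  refine (Complex.hasSum_re h).congr_fun fun m => ?_
  simp

lemma dnReal_zero_pos (hτ : 0 < τ) : 0 < dnReal τ 0 := by
  have h := hasSum_dnReal_zero hτ
  rw [← h.tsum_eq]
  exact h.summable.tsum_pos (fun m => (dnCoeff_pos τ m).le) 0 (dnCoeff_pos τ 0)

lemma cnImag_zero (τ : ℝ) : cnImag τ 0 = cnReal τ 0 := by
  simp [cnImag, cnReal]

lemma dnImag_zero (τ : ℝ) : dnImag τ 0 = dnReal τ 0 := by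
  simp [dnImag, dnReal]

lemma cnReal_zero_pos (hτ : 0 < τ) : 0 < cnReal τ 0 := by
  rw [← cnImag_zero]
  exact cnImag_pos hτ (by rw [abs_zero]; positivity)

/-- The difference of the squares is the value of `dnSeries` squared at `π/2`. -/
lemma cnReal_zero_lt (hτ : 0 < τ) : cnReal τ 0 < dnReal τ 0 := by
  have h := dnReal_sq_sub hτ (Real.pi / 2)
  have h1 : cnReal τ (Real.pi / 2) = 0 := by
    rw [← Complex.ofReal_eq_zero, ofReal_cnReal, cnSeries_pi_div_two hτ]
  have h2 : dnReal τ (Real.pi / 2) ≠ 0 := by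
    rw [← Complex.ofReal_ne_zero, ofReal_dnReal]
    exact dnSeries_pi_div_two_ne_zero hτ
  rw [h1] at h
  have h3 : 0 < dnReal τ (Real.pi / 2) ^ 2 := by positivity
  have := dnReal_zero_pos hτ
  exact lt_of_pow_lt_pow_left₀ 2 this.le (by linarith)

/-- The modulus whose nome is `exp (-τ)`. -/
noncomputable def nomeModulus (τ : ℝ) : ℝ := cnReal τ 0 / dnReal τ 0

lemma nomeModulus_pos (hτ : 0 < τ) : 0 < nomeModulus τ :=
  div_pos (cnReal_zero_pos hτ) (dnReal_zero_pos hτ)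

lemma nomeModulus_lt_one (hτ : 0 < τ) : nomeModulus τ < 1 :=
  (div_lt_one (dnReal_zero_pos hτ)).2 (cnReal_zero_lt hτ)

lemma coModulus_pos {k : ℝ} (hk0 : 0 < k) (hk1 : k < 1) : 0 < coModulus k :=
  Real.sqrt_pos.2 (by nlinarith)

lemma coModulus_lt_one {k : ℝ} (hk0 : 0 < k) : coModulus k < 1 := by
  rw [coModulus, Real.sqrt_lt' one_pos]
  nlinarith

lemma coModulus_sq {k : ℝ} (hk0 : 0 < k) (hk1 : k < 1) : coModulus k ^ 2 = 1 - k ^ 2 :=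
  Real.sq_sqrt (by nlinarith)

/-- On the real axis the normalized series satisfy the system of `cn, sn, dn`. -/
lemma isJacobiSystem_real (hτ : 0 < τ) :
    IsJacobiSystem (2 * dnReal τ 0) (nomeModulus τ ^ 2) Set.univ
      (fun t => cnReal τ t / cnReal τ 0) (fun t => snReal τ t / cnReal τ 0)
      (fun t => dnReal τ t / dnReal τ 0) := by
  have hc := (cnReal_zero_pos hτ).ne'
  have hd := (dnReal_zero_pos hτ).ne'
  refine ⟨fun t _ => ?_, fun t _ => ?_, fun t _ => ?_, fun t _ => ?_, fun t _ => ?_⟩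
  · refine ((hasDerivAt_cnReal hτ t).div_const _).congr_deriv ?_
    field_simp
  · refine ((hasDerivAt_snReal hτ t).div_const _).congr_deriv ?_
    field_simp
  · refine ((hasDerivAt_dnReal hτ t).div_const _).congr_deriv ?_
    rw [nomeModulus]
    field_simp
  · have h := cnReal_sq_add hτ t
    field_simp
    linarith
  · have h := cnReal_sq_add hτ t
    have h' := dnReal_sq_sub hτ t
    rw [nomeModulus]
    field_simp
    linarith

lemma cnReal_eq (hτ : 0 < τ) (t : ℝ) :
    cnReal τ t = cnReal τ 0 * jacobiCn (nomeModulus τ) (2 * dnReal τ 0 * t) := by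
  have hk0 := nomeModulus_pos hτ
  have hk1 := nomeModulus_lt_one hτ
  have hc := (cnReal_zero_pos hτ).ne'
  have h := (IsJacobiSystem.unique (sq_nonneg _) (by nlinarith) isOpen_univ isPreconnected_univ
    (isJacobiSystem_real hτ) (isJacobiSystem_jacobi hk0 hk1 (2 * dnReal τ 0) 0) (Set.mem_univ 0)
    (div_self hc) (div_self (dnReal_zero_pos hτ).ne') (by simp [jacobiCn_zero hk0 hk1])
    (by simp [jacobiDn_zero hk0 hk1]) (Set.mem_univ t)).1
  rw [sub_zero, div_eq_iff hc] at h
  rw [h, mul_comm]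

/-- The quarter period is read off from the first zero `π/2` of the Fourier series of `cn`. -/
lemma ellipticK_nomeModulus (hτ : 0 < τ) :
    ellipticK (nomeModulus τ) = Real.pi * dnReal τ 0 := by
  have hd := dnReal_zero_pos hτ
  have hc := (cnReal_zero_pos hτ).ne'
  refine (eq_ellipticK_of_jacobiCn_eq_zero (nomeModulus_pos hτ) (nomeModulus_lt_one hτ)
    (by positivity) ?_ fun u hu0 hu h0 => ?_).symm
  · have h := cnReal_eq hτ (Real.pi / 2)
    rw [← Complex.ofReal_inj, ofReal_cnReal, cnSeries_pi_div_two hτ, eq_comm,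
      Complex.ofReal_eq_zero] at h
    exact (congrArg _ (by ring)).trans ((mul_eq_zero.1 h).resolve_left hc)
  · have h := cnReal_eq hτ (u / (2 * dnReal τ 0))
    rw [mul_div_cancel₀ _ (by positivity), h0, mul_zero, ← Complex.ofReal_eq_zero,
      ofReal_cnReal] at h
    refine cnSeries_ne_zero hτ (by positivity) ?_ h
    rw [div_lt_iff₀ (by positivity)]
    linarith

/-- Along the imaginary axis the series satisfy Jacobi's imaginary transformation. -/
lemma isJacobiSystem_imag (hτ : 0 < τ) :
    IsJacobiSystem (2 * dnReal τ 0) (coModulus (nomeModulus τ) ^ 2) (Metric.ball 0 (τ / 2))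
      (fun y => cnReal τ 0 / cnImag τ y) (fun y => snImag τ y / cnImag τ y)
      (fun y => nomeModulus τ * dnImag τ y / cnImag τ y) := by
  have hc := (cnReal_zero_pos hτ).ne'
  have hd := (dnReal_zero_pos hτ).ne'
  have hI {y : ℝ} (hy : y ∈ Metric.ball (0 : ℝ) (τ / 2)) : |y| < τ / 2 := by simpa using hy
  rw [coModulus_sq (nomeModulus_pos hτ) (nomeModulus_lt_one hτ), nomeModulus]
  refine ⟨fun y hy => ?_, fun y hy => ?_, fun y hy => ?_, fun y hy => ?_, fun y hy => ?_⟩ <;>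
    have hp := (cnImag_pos hτ (hI hy)).ne' <;>
    have h1 := cnImag_sq_sub hτ (hI hy) <;>
    have h2 := dnImag_sq_sub hτ (hI hy)
  · refine ((hasDerivAt_const y _).div (hasDerivAt_cnImag hτ (hI hy)) hp).congr_deriv ?_
    field_simp
    ring
  · refine ((hasDerivAt_snImag hτ (hI hy)).div (hasDerivAt_cnImag hτ (hI hy)) hp).congr_deriv ?_
    field_simp
    linear_combination dnImag τ y * h1
  · refine (((hasDerivAt_dnImag hτ (hI hy)).const_mul _).div (hasDerivAt_cnImag hτ (hI hy))
      hp).congr_deriv ?_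
    field_simp
    linear_combination -snImag τ y * h2
  · field_simp
    linarith
  · field_simp
    linear_combination cnReal τ 0 ^ 2 * h2 + (cnReal τ 0 ^ 2 - dnReal τ 0 ^ 2) * h1

lemma isJacobiSystem_imag_eq (hτ : 0 < τ) {y : ℝ} (hy : |y| < τ / 2) :
    cnReal τ 0 / cnImag τ y
        = jacobiCn (coModulus (nomeModulus τ)) (2 * dnReal τ 0 * y) ∧
      nomeModulus τ * dnImag τ y / cnImag τ y
        = jacobiDn (coModulus (nomeModulus τ)) (2 * dnReal τ 0 * y) := by
  have hk0 := coModulus_pos (nomeModulus_pos hτ) (nomeModulus_lt_one hτ)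
  have hk1 := coModulus_lt_one (nomeModulus_pos hτ)
  have hc := (cnReal_zero_pos hτ).ne'
  have hd := (dnReal_zero_pos hτ).ne'
  have H := isJacobiSystem_jacobi hk0 hk1 (2 * dnReal τ 0) 0
  have H' : IsJacobiSystem (2 * dnReal τ 0) (coModulus (nomeModulus τ) ^ 2)
      (Metric.ball 0 (τ / 2)) _ _ _ :=
    ⟨fun t _ => H.1 t (Set.mem_univ t), fun t _ => H.2 t (Set.mem_univ t),
      fun t _ => H.3 t (Set.mem_univ t), fun t _ => H.4 t (Set.mem_univ t),
      fun t _ => H.5 t (Set.mem_univ t)⟩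
  have h := IsJacobiSystem.unique (sq_nonneg _) (by nlinarith) Metric.isOpen_ball
    (convex_ball (0 : ℝ) (τ / 2)).isPreconnected (isJacobiSystem_imag hτ) H'
    (Metric.mem_ball_self (by positivity)) (by rw [cnImag_zero, div_self hc])
    (by rw [cnImag_zero, dnImag_zero, nomeModulus, div_mul_cancel₀ _ hd, div_self hc])
    (by simp [jacobiCn_zero hk0 hk1])
    (by simp [jacobiDn_zero hk0 hk1]) (show y ∈ Metric.ball (0 : ℝ) (τ / 2) by simpa using hy)
  simp only [sub_zero] at h
  exact ⟨h.1, h.2.2⟩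

/-- `cnImag` grows beyond all bounds near the end `τ / 2` of the strip: each of the first `n` terms
with a negative index is close to `1` there, up to a factor of at most two. -/
lemma le_cnImag (hτ : 0 < τ) {y : ℝ} (hy : |y| < τ / 2) (n : ℕ) :
    n * (1 / 2 * Real.exp (-((2 * n + 1) * (τ / 2 - y)))) ≤ cnImag τ y := by
  have h := hasSum_cnImag hτ hy
  have hinj : Function.Injective fun i : ℕ => -1 - (i : ℤ) := fun a b hab => by simpa using hab
  have hle := sum_le_hasSum ((Finset.range n).map ⟨_, hinj⟩)
    (fun m _ => (mul_pos (cnCoeff_pos τ m) (Real.exp_pos _)).le) h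
  refine le_trans ?_ hle
  rw [Finset.sum_map, ← nsmul_eq_mul, ← Finset.card_range n, ← Finset.sum_const,
    Finset.card_range]
  refine Finset.sum_le_sum fun i hi => ?_
  have hin : (i : ℝ) ≤ n := by exact_mod_cast (Finset.mem_range.1 hi).le
  have hy' := abs_lt.1 hy
  simp only [Function.Embedding.coeFn_mk, cnCoeff]
  push_cast
  have e : τ * (-1 - (i : ℝ) + 1 / 2) = -(τ * (i + 1 / 2)) := by ring
  have hcosh : Real.cosh (τ * ((i : ℝ) + 1 / 2)) ≤ Real.exp (τ * ((i : ℝ) + 1 / 2)) := by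
    rw [← Real.cosh_add_sinh]
    have : 0 ≤ Real.sinh (τ * ((i : ℝ) + 1 / 2)) := Real.sinh_nonneg_iff.2 (by positivity)
    linarith
  rw [e, Real.cosh_neg]
  calc 1 / 2 * Real.exp (-((2 * n + 1) * (τ / 2 - y)))
      ≤ 1 / 2 * Real.exp (-((2 * i + 1) * (τ / 2 - y))) := by
        gcongr
        linarith
    _ = 1 / (2 * Real.exp (τ * (i + 1 / 2))) * Real.exp (-((2 * (-1 - i) + 1) * y)) := by
        rw [one_div_mul_eq_div, one_div (2 * _), mul_inv, ← Real.exp_neg, mul_assoc, ← Real.exp_add]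
        rw [div_eq_inv_mul]
        congr 2
        ring
    _ ≤ _ := by gcongr

/-- On the imaginary axis `cn` for the complementary modulus is a constant divided by `cnImag`,
which is unbounded near `τ/2`. -/
lemma jacobiCn_coModulus_nomeModulus (hτ : 0 < τ) :
    jacobiCn (coModulus (nomeModulus τ)) (2 * dnReal τ 0 * (τ / 2)) = 0 := by
  have hk0 := coModulus_pos (nomeModulus_pos hτ) (nomeModulus_lt_one hτ)
  have hk1 := coModulus_lt_one (nomeModulus_pos hτ)
  set f : ℝ → ℝ := fun y => jacobiCn (coModulus (nomeModulus τ)) (2 * dnReal τ 0 * y) with hf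
  have hcont : Continuous f :=
    Real.continuous_cos.comp ((continuous_jacobiAm hk0 hk1).comp (by fun_prop))
  have hev : ∀ᶠ y in nhdsWithin (τ / 2) (Set.Iio (τ / 2)), |y| < τ / 2 := by
    filter_upwards [Ioo_mem_nhdsLT (show -(τ / 2) < τ / 2 by linarith)] with y hy
    exact abs_lt.2 hy
  have hbound (n : ℕ) : f (τ / 2) * (n / 2) ≤ cnReal τ 0 := by
    have hl : Filter.Tendsto
        (fun y => f y * (n * (1 / 2 * Real.exp (-((2 * n + 1) * (τ / 2 - y))))))
        (nhdsWithin (τ / 2) (Set.Iio (τ / 2))) (nhds (f (τ / 2) * (n / 2))) := by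
      have hc : Continuous fun y => f y *
          (n * (1 / 2 * Real.exp (-((2 * n + 1) * (τ / 2 - y))))) := by fun_prop
      have := hc.tendsto (τ / 2)
      simp only [sub_self, mul_zero, neg_zero, Real.exp_zero] at this
      refine (this.mono_left nhdsWithin_le_nhds).trans (le_of_eq ?_)
      congr 2
      ring
    refine le_of_tendsto hl (hev.mono fun y hy => ?_)
    have hp := cnImag_pos hτ hy
    have h1 : f y = cnReal τ 0 / cnImag τ y := ((isJacobiSystem_imag_eq hτ hy).1).symm
    rw [h1, div_mul_eq_mul_div, div_le_iff₀ hp]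
    exact mul_le_mul_of_nonneg_left (le_cnImag hτ hy n) (cnReal_zero_pos hτ).le
  have h0 : 0 ≤ f (τ / 2) := by
    refine ge_of_tendsto ((hcont.tendsto (τ / 2)).mono_left
      (nhdsWithin_le_nhds (s := Set.Iio (τ / 2)))) (hev.mono fun y hy => ?_)
    have h1 : f y = cnReal τ 0 / cnImag τ y := ((isJacobiSystem_imag_eq hτ hy).1).symm
    rw [h1]
    exact (div_pos (cnReal_zero_pos hτ) (cnImag_pos hτ hy)).le
  by_contra hne
  have hpos : 0 < f (τ / 2) := lt_of_le_of_ne h0 (Ne.symm hne)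
  obtain ⟨n, hn⟩ := exists_nat_gt (2 * cnReal τ 0 / f (τ / 2))
  rw [div_lt_iff₀ hpos] at hn
  linarith [hbound n]

lemma ellipticK_coModulus_nomeModulus (hτ : 0 < τ) :
    ellipticK (coModulus (nomeModulus τ)) = τ * dnReal τ 0 := by
  have hd := dnReal_zero_pos hτ
  refine (eq_ellipticK_of_jacobiCn_eq_zero (coModulus_pos (nomeModulus_pos hτ)
    (nomeModulus_lt_one hτ)) (coModulus_lt_one (nomeModulus_pos hτ)) (by positivity) ?_
    fun u hu0 hu h0 => ?_).symm
  · exact (congrArg _ (by ring)).trans (jacobiCn_coModulus_nomeModulus hτ)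
  · have hy : |u / (2 * dnReal τ 0)| < τ / 2 := by
      rw [abs_of_nonneg (by positivity), div_lt_iff₀ (by positivity)]
      linarith
    have h := (isJacobiSystem_imag_eq hτ hy).1
    rw [mul_div_cancel₀ _ (by positivity), h0] at h
    exact (div_pos (cnReal_zero_pos hτ) (cnImag_pos hτ hy)).ne' h

theorem nome_nomeModulus (hτ : 0 < τ) : nome (nomeModulus τ) = Real.exp (-τ) := by
  have hd := dnReal_zero_pos hτ
  rw [nome, ellipticK_nomeModulus hτ, ellipticK_coModulus_nomeModulus hτ]
  congr 1
  field_simp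

lemma ellipticK_strictMono {k l : ℝ} (hk0 : 0 < k) (hkl : k < l) (hl1 : l < 1) :
    ellipticK k < ellipticK l := by
  have hk1 := hkl.trans hl1
  have hl0 := hk0.trans hkl
  refine intervalIntegral.integral_lt_integral_of_continuousOn_of_le_of_exists_lt
    (by positivity) (continuous_integrand hk0 hk1).continuousOn
    (continuous_integrand hl0 hl1).continuousOn (fun θ _ => ?_)
    ⟨Real.pi / 2, Set.right_mem_Icc.2 (by positivity), ?_⟩
  · have := radicand_pos hl0 hl1 θ
    gcongr
  · have := radicand_pos hl0 hl1 (Real.pi / 2)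
    rw [Real.sin_pi_div_two] at *
    gcongr

lemma nome_strictMono {k l : ℝ} (hk0 : 0 < k) (hkl : k < l) (hl1 : l < 1) : nome k < nome l := by
  have hk1 := hkl.trans hl1
  have hl0 := hk0.trans hkl
  have h1 := ellipticK_strictMono hk0 hkl hl1
  have hco : coModulus l < coModulus k :=
    Real.sqrt_lt_sqrt (by nlinarith) (by nlinarith)
  have h2 := ellipticK_strictMono (coModulus_pos hl0 hl1) hco (coModulus_lt_one hk0)
  have h3 := ellipticK_pos hk0 hk1
  have h4 := ellipticK_pos (coModulus_pos hl0 hl1) (coModulus_lt_one hl0)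
  have h5 := h4.trans h2
  rw [nome, nome, Real.exp_lt_exp, neg_mul, neg_mul, neg_div, neg_div, neg_lt_neg_iff,
    mul_div_assoc, mul_div_assoc]
  gcongr

lemma nome_injOn : Set.InjOn nome (Set.Ioo 0 1) :=
  StrictMonoOn.injOn fun _ hk _ hl hkl => nome_strictMono hk.1 hkl hl.2

end Modulus

/-! ### The sums of hyperbolic secants over a lattice -/

section SechSum

open Complex (exp)

variable {τ y : ℝ}

/-- The sum `∑ 1 / (2 cosh (y + τ m))` over `m ∈ ℤ`. -/
noncomputable def sechSum (τ y : ℝ) : ℝ := ∑' m : ℤ, 1 / (2 * Real.cosh (y + τ * m))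

lemma ofReal_sechSum (τ y : ℝ) :
    (sechSum τ y : ℂ) = exp (-y) * kroneckerSeries (exp (-τ) ^ 2) (-exp (-y) ^ 2) (exp (-τ)) := by
  rw [sechSum, Complex.ofReal_tsum, kroneckerSeries, ← tsum_mul_left]
  refine tsum_congr fun m => ?_
  have h1 : exp (-(y : ℂ)) ^ 2 * (exp (-(τ : ℂ)) ^ 2) ^ m
      = exp (-(y + τ * m)) * exp (-(y + τ * m)) := by
    rw [← Complex.exp_nat_mul, ← Complex.exp_nat_mul, ← Complex.exp_int_mul, ← Complex.exp_add,
      ← Complex.exp_add]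
    congr 1
    push_cast
    ring
  have h2 : exp (-(y : ℂ)) * exp (-τ) ^ m = exp (-(y + τ * m)) := by
    rw [← Complex.exp_int_mul, ← Complex.exp_add]
    congr 1
    ring
  have h3 : Complex.cosh (y + τ * m) ≠ 0 := by
    have := Complex.ofReal_ne_zero.2 (Real.cosh_pos (y + τ * m)).ne'
    push_cast at this
    exact this
  have h4 : 2 * Complex.cosh (y + τ * m) * exp (-(y + τ * m))
      = 1 + exp (-(y + τ * m)) * exp (-(y + τ * m)) := by
    rw [Complex.cosh, mul_div_cancel₀ _ two_ne_zero, add_mul, ← Complex.exp_add,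
      add_neg_cancel, Complex.exp_zero]
  have h5 := Complex.exp_ne_zero (-(y + τ * m))
  rw [neg_mul, sub_neg_eq_add, h1, ← h4, ← mul_div_assoc, h2]
  push_cast
  field_simp

lemma neg_exp_sq_mul_zpow_ne_one (τ y : ℝ) (m : ℤ) :
    -exp (-(y : ℂ)) ^ 2 * (exp (-(τ : ℂ)) ^ 2) ^ m ≠ 1 := by
  rw [exp_neg_eq_ofReal, exp_neg_eq_ofReal, ← Complex.ofReal_pow, ← Complex.ofReal_pow]
  exact neg_ofReal_mul_zpow_ne_one (by positivity) (by positivity) m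

lemma neg_exp_sq_ne_zero (y : ℝ) : -exp (-(y : ℂ)) ^ 2 ≠ 0 :=
  neg_ne_zero.2 (pow_ne_zero 2 (Complex.exp_ne_zero _))

lemma sechSum_mul_thetaSeries (hτ : 0 < τ) (y : ℝ) :
    (sechSum τ y : ℂ) * (thetaSeries (exp (-τ)) (-exp (-y) ^ 2) *
        thetaSeries (exp (-τ)) (exp (-τ)))
      = exp (-y) * (cqFactorial (exp (-τ) ^ 2) (exp (-τ) ^ 2) ^ 3 *
        thetaSeries (exp (-τ)) (-exp (-y) ^ 2 * exp (-τ))) := by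
  have h1 := norm_exp_neg_lt_one hτ
  have h0 : 0 < ‖exp (-(τ : ℂ))‖ := norm_pos_iff.2 (Complex.exp_ne_zero _)
  rw [ofReal_sechSum, mul_assoc, kroneckerSeries_mul (Complex.exp_ne_zero _)
    (neg_exp_sq_ne_zero y) (neg_exp_sq_mul_zpow_ne_one τ y) (by rw [norm_pow]; nlinarith) h1]

lemma thetaSeries_neg_exp_sq_ne_zero (hτ : 0 < τ) (y : ℝ) :
    thetaSeries (exp (-τ)) (-exp (-(y : ℂ)) ^ 2) ≠ 0 :=
  thetaSeries_ne_zero (Complex.exp_ne_zero _) (norm_exp_neg_lt_one hτ)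
    (neg_exp_sq_ne_zero y) (neg_exp_sq_mul_zpow_ne_one τ y)

lemma thetaSeries_exp_ne_zero (hτ : 0 < τ) (hy : |y| < τ / 2) :
    thetaSeries (exp (-τ)) (exp (-(τ : ℂ)) * exp (-(y : ℂ)) ^ 2) ≠ 0 := by
  refine thetaSeries_ne_zero (Complex.exp_ne_zero _) (norm_exp_neg_lt_one hτ)
    (mul_ne_zero (Complex.exp_ne_zero _) (pow_ne_zero 2 (Complex.exp_ne_zero _))) fun n h => ?_
  have h2 : Real.exp (-τ) * Real.exp (-y) ^ 2 * (Real.exp (-τ) ^ 2) ^ n = 1 := by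
    rw [exp_neg_eq_ofReal, exp_neg_eq_ofReal] at h
    exact_mod_cast h
  rw [← Real.exp_nat_mul, ← Real.exp_nat_mul, ← Real.rpow_intCast, ← Real.exp_mul, ← Real.exp_add,
    ← Real.exp_add, Real.exp_eq_one_iff] at h2
  push_cast at h2
  -- The exponent vanishes only if `y` is an odd multiple of `τ / 2`.
  have h3 : y = -((2 * n + 1) * (τ / 2)) := by linarith
  have h4 : (1 : ℝ) ≤ |2 * (n : ℝ) + 1| := by
    have : (1 : ℤ) ≤ |2 * n + 1| := Int.one_le_abs (by omega)
    exact_mod_cast this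
  rw [h3, abs_neg, abs_mul, abs_of_pos (by positivity : 0 < τ / 2)] at hy
  nlinarith

lemma exp_neg_add_I_mul (τ y : ℝ) :
    exp (-τ + 2 * Complex.I * (Complex.I * y)) = exp (-τ) * exp (-y) ^ 2 := by
  rw [← Complex.exp_nat_mul, ← Complex.exp_add]
  congr 1
  push_cast
  linear_combination 2 * (y : ℂ) * Complex.I_sq

/-- After division by the theta series, which do not vanish here, both sides are the same theta
quotient. -/
lemma sechSum_mul_cnImag (hτ : 0 < τ) (hy : |y| < τ / 2) :
    sechSum τ y * cnImag τ y = cnReal τ 0 * dnImag τ y := by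
  have hF := sechSum_mul_thetaSeries hτ y
  have hC := cnSeries_mul_thetaSeries (abs_im_I_mul_lt hy)
  have hD := dnSeries_mul_thetaSeries (abs_im_I_mul_lt hy)
  have h0 := cnSeries_mul_thetaSeries (abs_im_ofReal_lt hτ 0)
  rw [← ofReal_cnImag, exp_neg_add_I_mul] at hC
  rw [← ofReal_dnImag, exp_neg_add_I_mul] at hD
  rw [← ofReal_cnReal, Complex.ofReal_zero, mul_zero, mul_zero, add_zero, add_zero] at h0
  have hX := Complex.exp_ne_zero (-(y : ℂ))
  have e1 : -exp (-(τ : ℂ)) * (exp (-τ) * exp (-(y : ℂ)) ^ 2)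
      = exp (-τ) ^ 2 * (-exp (-y) ^ 2) := by ring
  have e2 : -exp (-(τ : ℂ)) * exp (-τ) = exp (-τ) ^ 2 * (-1) := by ring
  have e3 : exp (-(τ : ℂ) / 2 + Complex.I * (Complex.I * y))
      = exp (-(τ : ℂ) / 2) * exp (-y) := by
    rw [← Complex.exp_add]
    congr 1
    linear_combination (y : ℂ) * Complex.I_sq
  rw [e1, thetaSeries_sq_mul (Complex.exp_ne_zero _) (neg_exp_sq_ne_zero y), e3] at hC
  rw [e2, thetaSeries_sq_mul (Complex.exp_ne_zero _) (neg_ne_zero.2 one_ne_zero)] at h0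
  have n1 := thetaSeries_neg_exp_sq_ne_zero hτ y
  have n2 : thetaSeries (exp (-τ)) (exp (-(τ : ℂ))) ≠ 0 := by
    simpa using thetaSeries_exp_ne_zero (y := 0) hτ (by rw [abs_zero]; positivity)
  have n3 := thetaSeries_neg_ne_zero hτ
  have n4 := thetaSeries_exp_ne_zero hτ hy
  have n5 : thetaSeries (exp (-(τ : ℂ))) (-1) ≠ 0 := by
    simpa using thetaSeries_neg_exp_sq_ne_zero hτ 0
  rw [show -exp (-(y : ℂ)) ^ 2 * exp (-τ) = -(exp (-τ) * exp (-y) ^ 2) by ring] at hF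
  rw [← Complex.ofReal_inj]
  push_cast
  generalize thetaSeries (exp (-τ)) (-exp (-(y : ℂ)) ^ 2) = t1 at *
  generalize thetaSeries (exp (-τ)) (exp (-(τ : ℂ))) = t2 at *
  generalize thetaSeries (exp (-τ)) (-exp (-(τ : ℂ))) = t3 at *
  generalize thetaSeries (exp (-τ)) (exp (-(τ : ℂ)) * exp (-(y : ℂ)) ^ 2) = t4 at *
  generalize thetaSeries (exp (-τ)) (-(exp (-(τ : ℂ)) * exp (-(y : ℂ)) ^ 2)) = t6 at *
  generalize thetaSeries (exp (-τ)) (-1) = t5 at *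
  generalize cqFactorial (exp (-(τ : ℂ)) ^ 2) (exp (-τ) ^ 2) = e at *
  generalize exp (-(y : ℂ)) = X at *
  have hF' : (sechSum τ y : ℂ) = X * (e ^ 3 * t6) / (t1 * t2) := by
    rw [eq_div_iff (mul_ne_zero n1 n2), hF]
  have hC' : (cnImag τ y : ℂ)
      = exp (-τ / 2) * X * (e ^ 3 * (-(-X ^ 2)⁻¹ * t1)) / (t3 * t4) := by
    rw [eq_div_iff (mul_ne_zero n3 n4), hC]
  have hD' : (dnImag τ y : ℂ) = e ^ 3 * t6 / (t5 * t4) := by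
    rw [eq_div_iff (mul_ne_zero n5 n4), hD]
  have h0' : (cnReal τ 0 : ℂ) = exp (-τ / 2) * (e ^ 3 * (-(-1)⁻¹ * t5)) / (t3 * t2) := by
    rw [eq_div_iff (mul_ne_zero n3 n2), h0]
  rw [hF', hC', hD', h0']
  generalize exp (-(τ : ℂ) / 2) = s at *
  field_simp

/-- The sum is a multiple of a quotient of two of the series on the imaginary axis, that is, of a
value of `dn` for the complementary modulus. -/
lemma sechSum_eq_jacobiDn (hτ : 0 < τ) (hy : |y| < τ / 2) :
    sechSum τ y = dnReal τ 0 * jacobiDn (coModulus (nomeModulus τ)) (2 * dnReal τ 0 * y) := by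
  have hc := (cnImag_pos hτ hy).ne'
  have hd := (dnReal_zero_pos hτ).ne'
  rw [← (isJacobiSystem_imag_eq hτ hy).2, nomeModulus, eq_comm]
  have h := sechSum_mul_cnImag hτ hy
  field_simp
  linarith

lemma ofReal_qFactorial (x : ℝ) {p : ℝ} (hp : |p| < 1) :
    (qFactorial x p : ℂ) = cqFactorial x p := by
  have h := (multipliable_qFactorial x hp).map_tprod Complex.ofRealHom Complex.continuous_ofReal
  rw [qFactorial, cqFactorial]
  refine h.trans (tprod_congr fun n => ?_)
  simp

/-- The product form of the sum, by the triple product for each of the theta series. -/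
lemma sechSum_eq_prod (hτ : 0 < τ) (y : ℝ) :
    sechSum τ y = 1 / (2 * Real.cosh y) *
      ((qFactorial (-(Real.exp (-y) ^ 2 * Real.exp (-τ))) (Real.exp (-τ) ^ 2) *
          qFactorial (-(Real.exp y ^ 2 * Real.exp (-τ))) (Real.exp (-τ) ^ 2) *
          qFactorial (Real.exp (-τ) ^ 2) (Real.exp (-τ) ^ 2) *
          qFactorial (Real.exp (-τ) ^ 2) (Real.exp (-τ) ^ 2)) /
        (qFactorial (-(Real.exp (-y) ^ 2 * Real.exp (-τ) ^ 2)) (Real.exp (-τ) ^ 2) *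
          qFactorial (-(Real.exp y ^ 2 * Real.exp (-τ) ^ 2)) (Real.exp (-τ) ^ 2) *
          qFactorial (Real.exp (-τ)) (Real.exp (-τ) ^ 2) *
          qFactorial (Real.exp (-τ)) (Real.exp (-τ) ^ 2))) := by
  have hp0 := Real.exp_pos (-τ)
  have hp1 : Real.exp (-τ) < 1 := by
    rw [Real.exp_lt_one_iff]
    linarith
  have hQ : |Real.exp (-τ) ^ 2| < 1 := by
    rw [abs_of_pos (by positivity)]
    nlinarith
  have hF := sechSum_mul_thetaSeries hτ y
  have hq1 := norm_exp_neg_lt_one hτ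
  have hQ' := norm_sq_lt_one hq1
  have hq0 := Complex.exp_ne_zero (-(τ : ℂ))
  have hX := Complex.exp_ne_zero (-(y : ℂ))
  have n1 := thetaSeries_neg_exp_sq_ne_zero hτ y
  have n2 : thetaSeries (exp (-τ)) (exp (-(τ : ℂ))) ≠ 0 := by
    simpa using thetaSeries_exp_ne_zero (y := 0) hτ (by rw [abs_zero]; positivity)
  have hY : exp (y : ℂ) = (exp (-y))⁻¹ := by rw [Complex.exp_neg, inv_inv]
  have hcosh : 2 * Complex.cosh y = (1 + exp (-y) ^ 2) / exp (-y) := by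
    rw [Complex.cosh, hY]
    field_simp
  have hcosh0 : 1 + exp (-(y : ℂ)) ^ 2 ≠ 0 := by
    intro h
    rw [h, zero_div, mul_eq_zero] at hcosh
    have := Complex.ofReal_ne_zero.2 (Real.cosh_pos y).ne'
    push_cast at this
    exact hcosh.elim two_ne_zero this
  rw [← Complex.ofReal_inj]
  push_cast [ofReal_qFactorial _ hQ]
  rw [hcosh, hY]
  rw [thetaSeries_eq_prod hq0 hq1 (neg_exp_sq_ne_zero y),
    cqFactorial_eq_mul (-exp (-y) ^ 2) hQ'] at n1 hF
  rw [thetaSeries_eq_prod hq0 hq1 hq0] at n2 hF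
  rw [thetaSeries_eq_prod hq0 hq1 (mul_ne_zero (neg_exp_sq_ne_zero y) hq0)] at hF
  generalize exp (-(y : ℂ)) = X at *
  generalize exp (-(τ : ℂ)) = p at *
  rw [show p ^ 2 / p = p by field_simp, show p ^ 2 / (-X ^ 2) = -(X⁻¹ ^ 2 * p ^ 2) by field_simp,
    show p ^ 2 / (-X ^ 2 * p) = -(X⁻¹ ^ 2 * p) by field_simp,
    show -X ^ 2 * p = -(X ^ 2 * p) by ring, show -X ^ 2 * p ^ 2 = -(X ^ 2 * p ^ 2) by ring,
    show 1 - -X ^ 2 = 1 + X ^ 2 by ring] at hF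
  rw [show p ^ 2 / (-X ^ 2) = -(X⁻¹ ^ 2 * p ^ 2) by field_simp,
    show -X ^ 2 * p ^ 2 = -(X ^ 2 * p ^ 2) by ring] at n1
  rw [show p ^ 2 / p = p by field_simp] at n2
  generalize cqFactorial (-(X ^ 2 * p)) (p ^ 2) = a1 at *
  generalize cqFactorial (-(X⁻¹ ^ 2 * p)) (p ^ 2) = a2 at *
  generalize cqFactorial (-(X ^ 2 * p ^ 2)) (p ^ 2) = a3 at *
  generalize cqFactorial (-(X⁻¹ ^ 2 * p ^ 2)) (p ^ 2) = a4 at *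
  generalize cqFactorial (p ^ 2) (p ^ 2) = e at *
  generalize cqFactorial p (p ^ 2) = b at *
  have he : e ≠ 0 := right_ne_zero_of_mul n1
  have h4 : a4 ≠ 0 := right_ne_zero_of_mul (left_ne_zero_of_mul n1)
  have h3 : a3 ≠ 0 := right_ne_zero_of_mul (left_ne_zero_of_mul (left_ne_zero_of_mul n1))
  have hb : b ≠ 0 := right_ne_zero_of_mul (left_ne_zero_of_mul n2)
  field_simp
  refine mul_right_cancel₀ (pow_ne_zero 2 he) ?_
  linear_combination hF

end SechSum

/-! ### The weights and their moments -/

section Weights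

variable {τ : ℝ} {N : ℕ}

lemma exp_neg_rpow_add (τ x : ℝ) :
    Real.exp (-τ) ^ x + Real.exp (-τ) ^ (-x) = 2 * Real.cosh (τ * x) := by
  rw [← Real.exp_mul, ← Real.exp_mul, Real.cosh_eq]
  ring_nf

lemma weightTerm_exp (τ : ℝ) (N : ℕ) (j m : ℤ) :
    weightTerm (Real.exp (-τ)) N j m = cnCoeff τ (j - 1 + 2 * N * m) := by
  rw [weightTerm, cnCoeff, show -(j : ℝ) - 2 * N * m + 1 / 2 = -((j : ℝ) + 2 * N * m - 1 / 2) by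
    ring, exp_neg_rpow_add]
  congr 4
  push_cast
  ring

lemma weightSum_exp (τ : ℝ) (N : ℕ) (j : ℤ) :
    weightSum (Real.exp (-τ)) N j = sechSum (2 * N * τ) (τ * (j - 1 / 2)) := by
  refine tsum_congr fun m => ?_
  rw [weightTerm_exp, cnCoeff]
  congr 3
  push_cast
  ring

lemma summable_cnCoeff (hτ : 0 < τ) : Summable (cnCoeff τ) := by
  have h := summable_cnSeries hτ (abs_im_ofReal_lt hτ 0)
  refine h.congr fun m => ?_
  rw [Complex.ofReal_zero, mul_zero, Complex.exp_zero, mul_one, Complex.norm_real,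
    Real.norm_of_nonneg (cnCoeff_pos τ m).le]

lemma summable_weightTerm (hτ : 0 < τ) (hN : 1 ≤ N) (j : ℤ) :
    Summable (weightTerm (Real.exp (-τ)) N j) := by
  have hinj : Function.Injective fun m : ℤ => j - 1 + 2 * (N : ℤ) * m := by
    intro a b hab
    have h : 2 * (N : ℤ) * a = 2 * N * b := by simpa using hab
    exact mul_left_cancel₀ (by omega : 2 * (N : ℤ) ≠ 0) h
  exact ((summable_cnCoeff hτ).comp_injective hinj).congr fun m => (weightTerm_exp τ N j m).symm

lemma weightSum_pos (hτ : 0 < τ) (hN : 1 ≤ N) (j : ℤ) :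
    0 < weightSum (Real.exp (-τ)) N j := by
  have hpos (m : ℤ) : 0 < weightTerm (Real.exp (-τ)) N j m := by
    rw [weightTerm_exp]
    exact cnCoeff_pos _ _
  exact (summable_weightTerm hτ hN j).tsum_pos (fun m => (hpos m).le) 0 (hpos 0)

/-- Every integer is `j - 1 + 2Nm` for exactly one `m` and one index `j` of a node. -/
lemma bijective_sub_one_add_mul (hN : 1 ≤ N) :
    Function.Bijective fun p : (Finset.Icc (-(N : ℤ) + 1) N : Finset ℤ) × ℤ =>
      (p.1 : ℤ) - 1 + 2 * N * p.2 := by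
  have hN' : (0 : ℤ) < 2 * N := by omega
  constructor
  · rintro ⟨⟨i, hi⟩, m⟩ ⟨⟨j, hj⟩, n⟩ h
    simp only [Finset.mem_Icc] at hi hj h
    have h1 : i - j = 2 * N * (n - m) := by linarith
    have h2 : n - m = 0 := by
      have ha : 2 * (N : ℤ) * (n - m) < 2 * N * 1 := by linarith
      have hb : 2 * (N : ℤ) * (-1) < 2 * N * (n - m) := by linarith
      have := lt_of_mul_lt_mul_left ha hN'.le
      have := lt_of_mul_lt_mul_left hb hN'.le
      omega
    rw [h2, mul_zero] at h1
    simp only [Prod.mk.injEq, Subtype.mk.injEq]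
    omega
  · intro l
    have h1 := Int.emod_nonneg (l + N) hN'.ne'
    have h2 := Int.emod_lt_of_pos (l + N) hN'
    have h3 := Int.emod_add_mul_ediv (l + N) (2 * N)
    refine ⟨(⟨(l + N) % (2 * N) - N + 1, Finset.mem_Icc.2 ⟨by omega, by omega⟩⟩,
      (l + N) / (2 * N)), ?_⟩
    simp only
    linarith

/-- The moments of the weights are the values of a Fourier series at multiples of `π / (2N)`,
since the exponential functions of that series are periodic on these points. -/
lemma sum_weightSum_mul_node_zpow (hτ : 0 < τ) (hN : 1 ≤ N) (n : ℤ) :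
    ∑ j ∈ Finset.Icc (-(N : ℤ) + 1) N, (weightSum (Real.exp (-τ)) N j : ℂ) * node N j ^ n
      = cnReal τ (Real.pi * n / (2 * N)) := by
  have hN0 : (N : ℂ) ≠ 0 := by exact_mod_cast (by omega : N ≠ 0)
  have hs := ((Equiv.ofBijective _ (bijective_sub_one_add_mul hN)).summable_iff).2
    (summable_cnSeries hτ (abs_im_ofReal_lt hτ (Real.pi * n / (2 * N)))).of_norm
  simp only [Function.comp_def] at hs
  rw [ofReal_cnReal, cnSeries, trigSeries,
    ← (Equiv.ofBijective _ (bijective_sub_one_add_mul hN)).tsum_eq, hs.tsum_prod, tsum_fintype,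
    ← Finset.sum_coe_sort]
  refine Finset.sum_congr rfl fun j _ => ?_
  rw [weightSum, Complex.ofReal_tsum, ← tsum_mul_right]
  refine tsum_congr fun m => ?_
  simp only [Equiv.ofBijective_apply]
  rw [weightTerm_exp, node, ← Complex.exp_int_mul]
  congr 1
  rw [Complex.exp_eq_exp_iff_exists_int]
  refine ⟨-(m * n), ?_⟩
  push_cast
  field_simp
  ring

lemma weightSum_exp_eq_prod (hτ : 0 < τ) (hN : 1 ≤ N) (j : ℤ) :
    weightSum (Real.exp (-τ)) N j
      = 1 / (Real.exp (-τ) ^ ((j : ℝ) - 1 / 2) + Real.exp (-τ) ^ (1 / 2 - (j : ℝ))) *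
        ((qFactorial (-Real.exp (-τ) ^ (2 * (N : ℤ) + 2 * j - 1)) (Real.exp (-τ) ^ (4 * N)) *
            qFactorial (-Real.exp (-τ) ^ (2 * (N : ℤ) - 2 * j + 1)) (Real.exp (-τ) ^ (4 * N)) *
            qFactorial (Real.exp (-τ) ^ (4 * N)) (Real.exp (-τ) ^ (4 * N)) *
            qFactorial (Real.exp (-τ) ^ (4 * N)) (Real.exp (-τ) ^ (4 * N))) /
          (qFactorial (-Real.exp (-τ) ^ (4 * (N : ℤ) + 2 * j - 1)) (Real.exp (-τ) ^ (4 * N)) *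
            qFactorial (-Real.exp (-τ) ^ (4 * (N : ℤ) - 2 * j + 1)) (Real.exp (-τ) ^ (4 * N)) *
            qFactorial (Real.exp (-τ) ^ (2 * N)) (Real.exp (-τ) ^ (4 * N)) *
            qFactorial (Real.exp (-τ) ^ (2 * N)) (Real.exp (-τ) ^ (4 * N)))) := by
  have hN0 : (0 : ℝ) < N := by exact_mod_cast hN
  rw [weightSum_exp, sechSum_eq_prod (by positivity), show 1 / 2 - (j : ℝ) = -(j - 1 / 2) by ring,
    exp_neg_rpow_add]
  simp only [← Real.rpow_intCast, ← Real.rpow_natCast, ← Real.exp_mul, ← Real.exp_add]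
  push_cast
  ring_nf

lemma weightSum_exp_eq_jacobiDn (hτ : 0 < τ) (hN : 1 ≤ N) {j : ℤ}
    (hj : j ∈ Finset.Icc (-(N : ℤ) + 1) N) :
    weightSum (Real.exp (-τ)) N j = ellipticK (nomeModulus (2 * N * τ)) / Real.pi *
      jacobiDn (coModulus (nomeModulus (2 * N * τ)))
        (((j : ℝ) - 1 / 2) / N * ellipticK (coModulus (nomeModulus (2 * N * τ)))) := by
  have hN0 : (0 : ℝ) < N := by exact_mod_cast hN
  have hτ' : 0 < 2 * N * τ := by positivity
  rw [Finset.mem_Icc] at hj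
  have hj1 : -(N : ℝ) + 1 ≤ j := by exact_mod_cast hj.1
  have hj2 : (j : ℝ) ≤ N := by exact_mod_cast hj.2
  have hy : |τ * ((j : ℝ) - 1 / 2)| < 2 * N * τ / 2 := by
    have h : |(j : ℝ) - 1 / 2| < N := abs_lt.2 ⟨by linarith, by linarith⟩
    rw [abs_mul, abs_of_pos hτ]
    nlinarith
  rw [weightSum_exp, sechSum_eq_jacobiDn hτ' hy, ellipticK_nomeModulus hτ',
    ellipticK_coModulus_nomeModulus hτ', mul_div_cancel_left₀ _ Real.pi_ne_zero]
  congr 2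
  field_simp

end Weights

/-- With the weights of the theorem the trigonometric moments at the nodes are values of `cn`. -/
lemma moment_eq_jacobiCn {k : ℝ} (hk0 : 0 < k) (hk1 : k < 1) {τ : ℝ} (hτ : 0 < τ)
    (hk : nomeModulus τ = k) {N : ℕ} (hN : 1 ≤ N) (n : ℤ) :
    ∑ j ∈ Finset.Icc (-(N : ℤ) + 1) N,
        ((Real.pi / (k * ellipticK k) * weightSum (nome k) N j : ℝ) : ℂ) * node N j ^ n
      = (jacobiCn k (n * (ellipticK k / N)) : ℝ) := by
  have hK := ellipticK_pos hk0 hk1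
  have hN0 : (0 : ℝ) < N := by exact_mod_cast hN
  have hd := dnReal_zero_pos hτ
  have hKd : ellipticK k = Real.pi * dnReal τ 0 := hk ▸ ellipticK_nomeModulus hτ
  have hc : cnReal τ 0 = k * dnReal τ 0 := by
    rw [← hk, nomeModulus, div_mul_cancel₀ _ hd.ne']
  have hnome : nome k = Real.exp (-τ) := hk ▸ nome_nomeModulus hτ
  simp only [Complex.ofReal_mul _ (weightSum _ _ _), mul_assoc _ (weightSum _ _ _ : ℂ)]
  rw [← Finset.mul_sum, hnome, sum_weightSum_mul_node_zpow hτ hN, ← Complex.ofReal_mul,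
    Complex.ofReal_inj, cnReal_eq hτ, hk, hc, hKd]
  have hpi := Real.pi_pos
  have e : 2 * dnReal τ 0 * (Real.pi * n / (2 * N)) = n * (Real.pi * dnReal τ 0 / N) := by
    field_simp
  rw [e]
  field_simp

end EllipticCircle

/-! ### Orthogonality on the regular polygon -/

theorem proposition7 (k : ℝ) (hk0 : 0 < k) (hk1 : k < 1) (N : ℕ) (hN : 1 ≤ N) :
    let K : ℝ := ellipticK k
    let q : ℝ := nome k
    let w : ℝ := K / N
    let a : ℕ → ℝ := cnReflection k w
    let Φ : ℕ → Polynomial ℂ := szegoPoly a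
    let h : ℕ → ℝ := szegoNorm a
    let z : ℤ → ℂ := node N
    let J : Finset ℤ := Finset.Icc (-(N : ℤ) + 1) N
    let S : ℤ → ℝ := weightSum q N
    let ρ : ℤ → ℝ := fun j => Real.pi / (k * K) * S j
    -- the reflection parameters degenerate
    a (2 * N - 1) = -1 ∧
    (∀ n ≤ 2 * N, (Φ n).Monic ∧ (Φ n).natDegree = n) ∧
    -- the last polynomial, whose zeros are simple and are the nodes
    Φ (2 * N) = Polynomial.X ^ (2 * N) + 1 ∧
    (Φ (2 * N)).roots = J.val.map z ∧
    (Φ (2 * N)).roots.Nodup ∧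
    -- orthogonality on the nodes
    (∀ n < 2 * N, 0 < h n) ∧
    (∀ n < 2 * N, ∀ m < 2 * N,
      ∑ j ∈ J, (ρ j : ℂ) * (Φ n).eval (z j) * (Φ m).eval (1 / z j)
        = if n = m then (h n : ℂ) else 0) ∧
    -- the series defining the weights converges, and has a product form
    (∀ j ∈ J, Summable (weightTerm q N j)) ∧
    (∀ j ∈ J,
      S j = 1 / (q ^ ((j : ℝ) - 1 / 2) + q ^ (1 / 2 - (j : ℝ))) *
        ((qFactorial (-q ^ (2 * (N : ℤ) + 2 * j - 1)) (q ^ (4 * N)) *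
            qFactorial (-q ^ (2 * (N : ℤ) - 2 * j + 1)) (q ^ (4 * N)) *
            qFactorial (q ^ (4 * N)) (q ^ (4 * N)) *
            qFactorial (q ^ (4 * N)) (q ^ (4 * N))) /
          (qFactorial (-q ^ (4 * (N : ℤ) + 2 * j - 1)) (q ^ (4 * N)) *
            qFactorial (-q ^ (4 * (N : ℤ) - 2 * j + 1)) (q ^ (4 * N)) *
            qFactorial (q ^ (2 * N)) (q ^ (4 * N)) *
            qFactorial (q ^ (2 * N)) (q ^ (4 * N))))) ∧
    -- and a dn form, in terms of the unique modulus whose nome is `q ^ (2 * N)`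
    ∃ k₁ : ℝ, (0 < k₁ ∧ k₁ < 1 ∧ nome k₁ = q ^ (2 * N)) ∧
      (∀ k₂ : ℝ, 0 < k₂ → k₂ < 1 → nome k₂ = q ^ (2 * N) → k₂ = k₁) ∧
      ∀ j ∈ J,
        S j = ellipticK k₁ / Real.pi *
          jacobiDn (coModulus k₁) (((j : ℝ) - 1 / 2) / N * ellipticK (coModulus k₁)) := by
  intro K q w a Φ h z J S ρ
  have hK := ellipticK_pos hk0 hk1
  have hK' := ellipticK_pos (coModulus_pos hk0 hk1) (coModulus_lt_one hk0)
  -- By the monotonicity of the nome, `k` is the modulus that belongs to `τ = π K' / K`.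
  obtain ⟨τ, hτ, hq⟩ : ∃ τ : ℝ, 0 < τ ∧ nome k = Real.exp (-τ) :=
    ⟨Real.pi * ellipticK (coModulus k) / ellipticK k, by positivity, by
      rw [nome, neg_mul, neg_div]⟩
  have hk : nomeModulus τ = k :=
    nome_injOn ⟨nomeModulus_pos hτ, nomeModulus_lt_one hτ⟩ ⟨hk0, hk1⟩
      ((nome_nomeModulus hτ).trans hq.symm)
  have hN0 : (0 : ℝ) < N := by exact_mod_cast hN
  have hτ' : 0 < 2 * N * τ := by positivity
  have hqN : nome (nomeModulus (2 * N * τ)) = q ^ (2 * N) := by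
    rw [nome_nomeModulus hτ', show q = Real.exp (-τ) from hq, ← Real.exp_nat_mul]
    congr 1
    push_cast
    ring
  have hρ : ∀ j ∈ J, 0 < ρ j := fun j _ =>
    mul_pos (by positivity) (by
      change 0 < weightSum (nome k) N j
      rw [hq]
      exact weightSum_pos hτ hN j)
  have hmom : ∀ n : ℤ, ∑ j ∈ J, (ρ j : ℂ) * z j ^ n = (jacobiCn k (n * w) : ℝ) :=
    moment_eq_jacobiCn hk0 hk1 hτ hk hN
  have hlast : Φ (2 * N) = X ^ (2 * N) + 1 := szegoPoly_two_mul hk0 hk1 hN hρ hmom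
  have hroots := roots_X_pow_add_one hN
  refine ⟨cnReflection_last hk0 hk1 hN, fun n _ => szegoPoly_monic_and_natDegree a n, hlast,
    hlast ▸ hroots.1, hlast ▸ hroots.2, fun n hn => szegoNorm_pos hk0 hk1 hn,
    fun n _ m _ => szegoPoly_orthogonal hk0 hk1 w (fun j _ => Complex.exp_ne_zero _) hmom n m,
    fun j _ => ?_, fun j _ => ?_, nomeModulus (2 * N * τ),
    ⟨nomeModulus_pos hτ', nomeModulus_lt_one hτ', hqN⟩,
    fun k₂ h0 h1 h2 => nome_injOn ⟨h0, h1⟩ ⟨nomeModulus_pos hτ', nomeModulus_lt_one hτ'⟩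
      (h2.trans hqN.symm), fun j hj => ?_⟩
  · change Summable (weightTerm (nome k) N j)
    rw [hq]
    exact summable_weightTerm hτ hN j
  · simp only [S, q, hq]
    exact weightSum_exp_eq_prod hτ hN j
  · simp only [S, q, hq]
    exact weightSum_exp_eq_jacobiDn hτ hN hj
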